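/- Let $K$ be a field of characteristic $0$, let $n\in\{3,4\}$, let $S=K[x_1,\dots,x_n]$, and let $f\in S$ be a non-zero homogeneous polynomial of degree $3$. If $n=4$, assume moreover that $f$ is not a cone, i.e. that no invertible linear change of coordinates turns $f$ into a polynomial in which some variable does not occur. Let $I_f\subseteq S$ be the ideal of all polynomials $g$ such that $g(\partial/\partial x_1,\dots,\partial/\partial x_n)f=0$, and let $R_f=S/I_f$. Then the following conditions are equivalent: (1) $R_f$ is quadratic, i.e. the ideal $I_f$ is generated by homogeneous polynomials of degree $2$; (2) $R_f$ is Koszul, i.e. for every $i\ge 0$ the generators of the $i$-th free module in the minimal graded free resolution of $K$ over $R_f$ all have degree $i$; (3) the ideal of $S$ generated by the $2$-minors of the Hessian matrix $(\partial^2 f/\partial x_i\partial x_j)_{1\le i,j\le n}$ has codimension (height) $n$. Furthermore, for $n=3$ these conditions are also equivalent to: (4) $f$ does not lie in the Zariski closure, in the affine space of cubic forms in $x_1,x_2,x_3$ over $K$, of the $\operatorname{GL}_3(K)$-orbit of the Fermat cubic $x_1^3+x_2^3+x_3^3$. -/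

import Mathlib

open MvPolynomial

noncomputable section

namespace CubicKoszul

variable {K : Type*} [Field K] {n : ℕ}

/-! ### Macaulay inverse systems -/

/-- Partial derivatives commute. -/
theorem pderiv_comm (i j : Fin n) :
    (pderiv (R := K) i).toLinearMap * (pderiv j).toLinearMap =
      (pderiv j).toLinearMap * (pderiv i).toLinearMap := by
  classical
  have h : ⁅pderiv (R := K) i, pderiv (R := K) j⁆ = 0 := by
    apply MvPolynomial.derivation_ext
    intro k
    simp [Derivation.commutator_apply, pderiv_X, Pi.single_apply, apply_ite]
  refine LinearMap.ext fun f => ?_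
  have := congrArg (fun D => D f) h
  simpa [Derivation.commutator_apply, sub_eq_zero] using this

/-- The (commutative) algebra of constant coefficient differential operators on `K[x₁, …, xₙ]`. -/
abbrev constDiffOps (K : Type*) [Field K] (n : ℕ) :
    Subalgebra K (Module.End K (MvPolynomial (Fin n) K)) :=
  Algebra.adjoin K (Set.range fun i : Fin n => (pderiv i).toLinearMap)

/-- Constant coefficient differential operators commute. -/
instance constDiffOps_isMulCommutative (K : Type*) [Field K] (n : ℕ) :
    IsMulCommutative (constDiffOps K n) :=
  Algebra.isMulCommutative_adjoin K (by
    rintro _ ⟨i, rfl⟩ _ ⟨j, rfl⟩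
    exact pderiv_comm i j)

section

open scoped IsMulCommutative

/-- The substitution `g ↦ g(∂/∂x₁, …, ∂/∂xₙ)`: the `K`-algebra homomorphism from polynomials to
operators that sends `xᵢ` to `∂/∂xᵢ` (see `diffOp_X`). -/
def diffOp (K : Type*) [Field K] (n : ℕ) :
    MvPolynomial (Fin n) K →ₐ[K] Module.End K (MvPolynomial (Fin n) K) :=
  (constDiffOps K n).val.comp
    (aeval fun i => (⟨(pderiv i).toLinearMap, Algebra.subset_adjoin ⟨i, rfl⟩⟩ : constDiffOps K n))

theorem diffOp_X (i : Fin n) : diffOp K n (X i) = (pderiv i).toLinearMap := by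
  simp only [diffOp, AlgHom.comp_apply, aeval_X, Subalgebra.coe_val]

end

/-- The ideal `I_f` of all polynomials `g` with `g(∂/∂x₁, …, ∂/∂xₙ) f = 0`. -/
def inverseSystemIdeal (f : MvPolynomial (Fin n) K) : Ideal (MvPolynomial (Fin n) K) where
  carrier := {g | diffOp K n g f = 0}
  zero_mem' := by simp
  add_mem' := by
    intro a b ha hb
    simp only [Set.mem_ofPred_eq, map_add, LinearMap.add_apply] at *
    rw [ha, hb, add_zero]
  smul_mem' := by
    intro c a ha
    simp only [Set.mem_ofPred_eq, smul_eq_mul, map_mul, Module.End.mul_apply] at *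
    rw [ha, map_zero]

/-! ### Quadratic and Koszul algebras

A standard graded algebra is presented as `R = K[x₁, …, xₙ] / I`. -/

/-- The algebra `K[x₁, …, xₙ] / I` is quadratic: `I` is generated by forms of degree `2`. -/
def IsQuadratic (I : Ideal (MvPolynomial (Fin n) K)) : Prop :=
  ∃ Q : Set (MvPolynomial (Fin n) K), (∀ q ∈ Q, q.IsHomogeneous 2) ∧ I = Ideal.span Q

/-- The graded component `R_d` of `R = K[x₁, …, xₙ] / I`. -/
def gradedPiece (I : Ideal (MvPolynomial (Fin n) K)) (d : ℕ) :
    Submodule K (MvPolynomial (Fin n) K ⧸ I) :=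
  (homogeneousSubmodule (Fin n) K d).map (Ideal.Quotient.mkₐ K I).toLinearMap

/-- The homogeneous maximal ideal `R₊ = (x₁, …, xₙ)` of `R = K[x₁, …, xₙ] / I`, so that the
`R`-module `K` is `R / R₊`. -/
def irrelevantIdeal (I : Ideal (MvPolynomial (Fin n) K)) : Ideal (MvPolynomial (Fin n) K ⧸ I) :=
  Ideal.span (Set.range fun i => Ideal.Quotient.mk I (X i))

/-- A minimal graded free resolution of the residue field `K = R / R₊` over
`R = K[x₁, …, xₙ] / I`,
`⋯ → R^{rank 2} → R^{rank 1} → R^{rank 0} = R → K → 0`,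
where the last map is the projection. The `j`-th basis element of the `i`-th free module has degree
`deg i j`, i.e. that module is `⨁ⱼ R(-deg i j)`, and `d i` is the matrix of the map from the
`(i+1)`-st to the `i`-th free module. -/
structure MinimalResolution (I : Ideal (MvPolynomial (Fin n) K)) where
  rank : ℕ → ℕ
  deg : ∀ i, Fin (rank i) → ℕ
  d : ∀ i, Matrix (Fin (rank i)) (Fin (rank (i + 1))) (MvPolynomial (Fin n) K ⧸ I)
  rank_zero : rank 0 = 1
  deg_zero : ∀ j, deg 0 j = 0
  /-- The maps are homogeneous of degree `0`: entries are homogeneous of the degree that the shifts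
  prescribe (and vanish if that degree is negative). -/
  homogeneous : ∀ i r c, d i r c = 0 ∨ ∃ e, deg i r + e = deg (i + 1) c ∧ d i r c ∈ gradedPiece I e
  /-- Minimality: all entries lie in `R₊`. -/
  minimal : ∀ i r c, d i r c ∈ irrelevantIdeal I
  /-- Exactness at the `0`-th free module `R`: the image of `d 0` is `R₊`, the kernel of the
  projection `R → K`. -/
  exact_zero : ∀ v : Fin (rank 0) → MvPolynomial (Fin n) K ⧸ I,
    v ∈ LinearMap.range (d 0).mulVecLin ↔ ∀ j, v j ∈ irrelevantIdeal I
  /-- Exactness at the `(i+1)`-st free module. -/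
  exact_succ : ∀ i, LinearMap.range (d (i + 1)).mulVecLin = LinearMap.ker (d i).mulVecLin

/-- The algebra `K[x₁, …, xₙ] / I` is Koszul: for all `i`, the generators of the `i`-th free module
in the minimal graded free resolution of `K` (which exists, and is unique up to isomorphism, for
every standard graded algebra) have degree `i`. -/
def IsKoszul (I : Ideal (MvPolynomial (Fin n) K)) : Prop :=
  ∃ F : MinimalResolution I, ∀ i j, F.deg i j = i

/-! ### Hessian matrix -/

/-- The Hessian matrix of `f`. -/
def hessian (f : MvPolynomial (Fin n) K) : Matrix (Fin n) (Fin n) (MvPolynomial (Fin n) K) :=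
  Matrix.of fun i j => pderiv i (pderiv j f)

/-- The ideal generated by the `k`-minors of a matrix: the determinants of the submatrices given by
the choice of `k` rows and `k` columns. -/
def minorsIdeal {R : Type*} [CommRing R] (k : ℕ) (M : Matrix (Fin n) (Fin n) R) : Ideal R :=
  Ideal.span (Set.range fun p : (Fin k ↪o Fin n) × (Fin k ↪o Fin n) => (M.submatrix p.1 p.2).det)

/-! ### Linear changes of coordinates and orbit closures -/

/-- The linear substitution `xᵢ ↦ ∑ⱼ Aᵢⱼ xⱼ` applied to `f`. -/
def linSubst (A : Matrix (Fin n) (Fin n) K) (f : MvPolynomial (Fin n) K) :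
    MvPolynomial (Fin n) K :=
  bind₁ (fun i => ∑ j, C (A i j) * X j) f

/-- `f` is a cone: after an invertible linear change of coordinates some variable does not occur. -/
def IsCone (f : MvPolynomial (Fin n) K) : Prop :=
  ∃ A : GL (Fin n) K, ∃ i, i ∉ (linSubst (A : Matrix (Fin n) (Fin n) K) f).vars

/-- The `GL_n(K)`-orbit of `f`. -/
def glOrbit (f : MvPolynomial (Fin n) K) : Set (MvPolynomial (Fin n) K) :=
  Set.range fun A : GL (Fin n) K => linSubst (A : Matrix (Fin n) (Fin n) K) f

/-- The point with coordinates the coefficients of the form `f` of degree `d`, in the affine space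
whose coordinates are indexed by the monomials of degree `d`. -/
def formCoeffs (d : ℕ) (f : MvPolynomial (Fin n) K) : {m : Fin n →₀ ℕ // m.degree = d} → K :=
  fun m => coeff m.1 f

/-- The Zariski closure, in the affine space of forms of degree `d`, of a set of such forms. -/
def zariskiClosure (d : ℕ) (Z : Set (MvPolynomial (Fin n) K)) : Set (MvPolynomial (Fin n) K) :=
  {f | f.IsHomogeneous d ∧ formCoeffs d f ∈ zeroLocus K (vanishingIdeal K (formCoeffs d '' Z))}

/-- The Fermat cubic `x₁³ + ⋯ + xₙ³`. -/
def fermatCubic (K : Type*) [Field K] (n : ℕ) : MvPolynomial (Fin n) K := ∑ i, X i ^ 3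

end CubicKoszul

end

open CubicKoszul

/-! Let `T = triForm f` be the symmetric trilinear form of the cubic, so that `T p` is the Hessian
of `f` at the point `p`. Over an algebraically closed extension `k` of `K`, everything is compared
with one condition (R): `T p` has rank at most one only for `p = 0`. Since the 2-minors of the
Hessian are quadrics, (R) is condition (3) by the Nullstellensatz (`height_minorsIdeal_eq_iff`).

Conditions (1) and (2) each imply (R). All forms of degree 4 lie in `I_f`, so neither a quadratic
nor a Koszul algebra allows the quadrics in `I_f` to have a common zero other than the origin. If `T
p = c φ ⊗ φ` with `c` and `φ` nonzero, then the coefficients of `φ` are such a zero, because `g(∂)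
∂_p f = c g(φ)` for every quadric `g`. So rank at most one forces `T p = 0`. For `n = 4` this gives
`p = 0` as `f` is not a cone. For `n = 3` a nonzero `p` would make `f` a binary cubic, whose pencil
of polars has a degenerate member, again a contradiction (`eq_zero_of_isRankLEOne`).

(R) implies Koszul, and then quadratic. One finds `p`, `q` such that `T p` has rank exactly two and
`q` is a transversal base point of the quadrics `T l` with `l` in the kernel of `T p`
(`exists_isTransversalPair`). For `n = 3` eigenvalues suffice. For `n = 4` the rank two form comes
from an intersection count on a product of two projective 3-spaces, and `q` lies on a line of a
singular conic in a pencil. Let `y`, `a` be the classes of `p`, `q`. By duality in the Gorenstein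
algebra `R`, both `R/(y)` and the annihilator of `y` are free over `k[a]/(a²)`, and the annihilator
is generated by linear forms. Modules killed by `y`, free over `k[a]/(a²)` and generated in one
degree are then closed under syzygies up to copies of `yR`. Short exact sequences thus give linear
resolutions of `yR`, of `(y, a)` and finally of the irrelevant ideal (`IsKoszulPair.isLinear`), and
linearity descends from `k` to `K` (`IsLinear.descend`).

For `n = 3`, the closure of the Fermat orbit consists of the cubics that violate (R). Having a
nonzero traceless self-adjoint endomorphism is a closed condition that holds on the orbit, and such
an endomorphism yields a point with a Hessian of rank at most one. Conversely such a point brings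
`f` to the form `ξ₀³ + binary` or `ξ₀ ξ₂² + binary`, up to scalars, and these are limits of sums of
three cubes. -/

namespace CubicKoszul

/-! ### Linear free resolutions of graded modules -/

section LinearResolutions

universe u

variable {k : Type*} [Field k] {R : Type u} [CommRing R] [Algebra k R]

/-- The graded module of relations among the elements `b i`, shifted by one. -/
def syz (𝒜 : ℕ → Submodule k R) {M : Type*} [AddCommGroup M] [Module R M] {ι : Type*} [Fintype ι]
    (b : ι → M) (j : ℕ) : Submodule k (ι → R) where
  carrier := {t | (∀ i, t i ∈ 𝒜 (j + 1)) ∧ ∑ i, t i • b i = 0}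
  zero_mem' := ⟨fun i => by simp, by simp⟩
  add_mem' := by
    rintro s t ⟨hs, hs'⟩ ⟨ht, ht'⟩
    refine ⟨fun i => add_mem (hs i) (ht i), ?_⟩
    simp only [Pi.add_apply, add_smul, Finset.sum_add_distrib, hs', ht', add_zero]
  smul_mem' := by
    rintro c t ⟨ht, ht'⟩
    refine ⟨fun i => Submodule.smul_mem _ _ (ht i), ?_⟩
    simp only [Pi.smul_apply, Algebra.smul_def, mul_smul, ← Finset.smul_sum, ht', smul_zero]

theorem mem_syz {𝒜 : ℕ → Submodule k R} {M : Type*} [AddCommGroup M] [Module R M] {ι : Type*}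
    [Fintype ι] {b : ι → M} {j : ℕ} {t : ι → R} :
    t ∈ syz 𝒜 b j ↔ (∀ i, t i ∈ 𝒜 (j + 1)) ∧ ∑ i, t i • b i = 0 := Iff.rfl

/-- The family `b` is a `k`-basis of the degree `0` part of a graded module, and it generates. -/
structure IsGenBasis (𝒜 : ℕ → Submodule k R) {M : Type*} [AddCommGroup M] [Module k M] [Module R M]
    (gr : ℕ → Submodule k M) {ι : Type*} [Fintype ι] (b : ι → M) : Prop where
  li : LinearIndependent k b
  mem_iff : ∀ j m, m ∈ gr j ↔ ∃ t : ι → R, (∀ i, t i ∈ 𝒜 j) ∧ ∑ i, t i • b i = m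

/-- The graded module with pieces `gr j` is generated in degree `0`, and its first `s` steps of
a minimal free resolution are linear. -/
def IsLinear (𝒜 : ℕ → Submodule k R) : ℕ → ∀ {M : Type u} [AddCommGroup M] [Module k M]
    [Module R M], (ℕ → Submodule k M) → Prop
  | 0, _, _, _, _, _ => True
  | s + 1, M, _, _, _, gr => ∃ (ι : Type) (_ : Fintype ι) (b : ι → M),
      IsGenBasis 𝒜 gr b ∧ IsLinear 𝒜 s (syz 𝒜 b)

/-- The pieces `𝒜 j` are multiplicative, and `𝒜 0` consists of the constants. -/
structure IsConnectedGraded (𝒜 : ℕ → Submodule k R) : Prop where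
  zero_iff : ∀ x, x ∈ 𝒜 0 ↔ ∃ c : k, algebraMap k R c = x
  mul_mem : ∀ {i j x y}, x ∈ 𝒜 i → y ∈ 𝒜 j → x * y ∈ 𝒜 (i + j)

variable {𝒜 : ℕ → Submodule k R}

section

variable {M : Type*} [AddCommGroup M] [Module k M] [Module R M] [IsScalarTower k R M]
  {gr : ℕ → Submodule k M}

theorem IsGenBasis.mem_zero_iff (h𝒜 : IsConnectedGraded 𝒜) {ι : Type*} [Fintype ι] {b : ι → M}
    (hb : IsGenBasis 𝒜 gr b) (m : M) : m ∈ gr 0 ↔ ∃ c : ι → k, ∑ i, c i • b i = m := by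
  rw [hb.mem_iff]
  constructor
  · rintro ⟨t, ht, rfl⟩
    choose c hc using fun i => (h𝒜.zero_iff _).1 (ht i)
    exact ⟨c, by simp only [← hc, algebraMap_smul]⟩
  · rintro ⟨c, rfl⟩
    exact ⟨fun i => algebraMap k R (c i), fun i => (h𝒜.zero_iff _).2 ⟨_, rfl⟩, by
      simp only [algebraMap_smul]⟩

theorem IsGenBasis.mem (h𝒜 : IsConnectedGraded 𝒜) {ι : Type*} [Fintype ι] {b : ι → M}
    (hb : IsGenBasis 𝒜 gr b) (i : ι) : b i ∈ gr 0 := by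
  classical
  exact (hb.mem_zero_iff h𝒜 _).2 ⟨Pi.single i 1, by simp [Pi.single_apply]⟩

theorem IsGenBasis.eq_zero (h𝒜 : IsConnectedGraded 𝒜) {ι : Type*} [Fintype ι] {b : ι → M}
    (hb : IsGenBasis 𝒜 gr b) {t : ι → R} (ht : ∀ i, t i ∈ 𝒜 0) (h : ∑ i, t i • b i = 0) :
    t = 0 := by
  choose c hc using fun i => (h𝒜.zero_iff _).1 (ht i)
  have := Fintype.linearIndependent_iff.1 hb.li c (by simpa only [← hc, algebraMap_smul] using h)
  funext i
  simp [← hc, this i]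

omit [Module k M] [IsScalarTower k R M] in
theorem syz_smul_mem (h𝒜 : IsConnectedGraded 𝒜) {ι : Type*} [Fintype ι] {b : ι → M} {i j : ℕ}
    {r : R} {t : ι → R} (hr : r ∈ 𝒜 i) (ht : t ∈ syz 𝒜 b j) : r • t ∈ syz 𝒜 b (i + j) :=
  ⟨fun l => by simpa [add_assoc] using h𝒜.mul_mem hr (ht.1 l), by
    simp only [Pi.smul_apply, smul_eq_mul, mul_smul, ← Finset.smul_sum, ht.2, smul_zero]⟩

end

variable {M M' : Type u} [AddCommGroup M] [Module k M] [Module R M] [IsScalarTower k R M]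
  [AddCommGroup M'] [Module k M'] [Module R M'] [IsScalarTower k R M']
  {gr : ℕ → Submodule k M} {gr' : ℕ → Submodule k M'}

/-- A degreewise isomorphism carries generators to generators, and the relations among them are the
same tuples, so the rest of the resolution is reused unchanged. -/
theorem IsLinear.of_map (h𝒜 : IsConnectedGraded 𝒜) (e : M →ₗ[R] M')
    (he : ∀ j, ∀ m ∈ gr j, e m = 0 → m = 0) (hgr : ∀ j m', m' ∈ gr' j ↔ ∃ m ∈ gr j, e m = m')
    {s : ℕ} (h : IsLinear 𝒜 s gr) : IsLinear 𝒜 s gr' := by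
  cases s with
  | zero => trivial
  | succ s =>
    obtain ⟨ι, _, b, hb, hs⟩ := h
    refine ⟨ι, inferInstance, e ∘ b, ⟨?_, ?_⟩, ?_⟩
    · rw [Fintype.linearIndependent_iff]
      intro c hc
      refine Fintype.linearIndependent_iff.1 hb.li c (he 0 _ ((hb.mem_zero_iff h𝒜 _).2 ⟨c, rfl⟩) ?_)
      rw [← hc, map_sum]
      refine Finset.sum_congr rfl fun i _ => ?_
      rw [← algebraMap_smul R (c i) (b i), map_smul, algebraMap_smul]; rfl
    · intro j m'
      rw [hgr]
      constructor
      · rintro ⟨m, hm, rfl⟩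
        obtain ⟨t, ht, rfl⟩ := (hb.mem_iff _ _).1 hm
        exact ⟨t, ht, by simp⟩
      · rintro ⟨t, ht, rfl⟩
        exact ⟨_, (hb.mem_iff _ _).2 ⟨t, ht, rfl⟩, by simp⟩
    · convert hs using 1
      funext j
      ext t
      simp only [mem_syz, Function.comp_apply, and_congr_right_iff]
      intro ht
      rw [show ∑ i, t i • e (b i) = e (∑ i, t i • b i) by simp]
      exact ⟨fun h => he (j + 1) _ ((hb.mem_iff _ _).2 ⟨t, ht, rfl⟩) h, fun h => by rw [h, map_zero]⟩

/-- Two bases of the degree 0 part differ by an invertible matrix of constants, and this matrix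
identifies the two modules of relations. -/
theorem IsLinear.basis_change (h𝒜 : IsConnectedGraded 𝒜) {s : ℕ} (h : IsLinear 𝒜 (s + 1) gr)
    {κ : Type*} [Fintype κ] {c : κ → M} (hc : LinearIndependent k c)
    (hc0 : Submodule.span k (Set.range c) = gr 0) :
    IsGenBasis 𝒜 gr c ∧ ∃ (ι : Type) (_ : Fintype ι) (e : (ι → R) →ₗ[R] (κ → R)) (b : ι → M),
      Function.Injective e ∧ (∀ j t, t ∈ syz 𝒜 c j ↔ ∃ t' ∈ syz 𝒜 b j, e t' = t) ∧
      IsLinear 𝒜 s (syz 𝒜 b) := by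
  classical
  obtain ⟨ι, _, b, hb, hs⟩ := h
  have hcb : ∀ l, ∃ q : ι → k, ∑ i, q i • b i = c l := fun l =>
    (hb.mem_zero_iff h𝒜 _).1 (hc0 ▸ Submodule.subset_span ⟨l, rfl⟩)
  have hbc : ∀ i, ∃ p : κ → k, ∑ l, p l • c l = b i := fun i =>
    (Submodule.mem_span_range_iff_exists_fun k).1 (hc0 ▸ hb.mem h𝒜 i)
  choose q hq using hcb
  choose p hp using hbc
  have hpq : Matrix.of p * Matrix.of q = 1 := by
    ext i i'
    have h1 : ∑ i', (∑ l, p i l * q l i') • b i' = b i := by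
      simp only [Finset.sum_smul, mul_smul]
      rw [Finset.sum_comm]
      simp only [← Finset.smul_sum, hq, hp]
    have := Fintype.linearIndependent_iff.1 hb.li
      (fun i' => (∑ l, p i l * q l i') - (1 : Matrix ι ι k) i i')
      (by simp [sub_smul, Finset.sum_sub_distrib, h1, Matrix.one_apply])
    simpa [Matrix.mul_apply, sub_eq_zero] using this i'
  have hqp : Matrix.of q * Matrix.of p = 1 := by
    ext i i'
    have h1 : ∑ i', (∑ l, q i l * p l i') • c i' = c i := by
      simp only [Finset.sum_smul, mul_smul]
      rw [Finset.sum_comm]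
      simp only [← Finset.smul_sum, hq, hp]
    have := Fintype.linearIndependent_iff.1 hc
      (fun i' => (∑ l, q i l * p l i') - (1 : Matrix κ κ k) i i')
      (by simp [sub_smul, Finset.sum_sub_distrib, h1, Matrix.one_apply])
    simpa [Matrix.mul_apply, sub_eq_zero] using this i'
  set P : Matrix ι κ R := (Matrix.of p).map (algebraMap k R) with hP
  set Q : Matrix κ ι R := (Matrix.of q).map (algebraMap k R) with hQ
  have hPQ : P * Q = 1 := by rw [hP, hQ, ← Matrix.map_mul, hpq]; simp
  have hQP : Q * P = 1 := by rw [hP, hQ, ← Matrix.map_mul, hqp]; simp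
  have hPb : ∀ t : ι → R, ∑ l, (Matrix.vecMul t P) l • c l = ∑ i, t i • b i := by
    intro t
    simp only [Matrix.vecMul, dotProduct, Finset.sum_smul, mul_smul]
    rw [Finset.sum_comm]
    refine Finset.sum_congr rfl fun i _ => ?_
    rw [← Finset.smul_sum]
    simp [hP, hp]
  have hQc : ∀ t : κ → R, ∑ l, (Matrix.vecMul t Q) l • b l = ∑ i, t i • c i := by
    intro t
    rw [← hPb, Matrix.vecMul_vecMul, hQP, Matrix.vecMul_one]
  have hPm : ∀ j (t : ι → R), (∀ i, t i ∈ 𝒜 j) → ∀ l, Matrix.vecMul t P l ∈ 𝒜 j := by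
    intro j t ht l
    refine sum_mem fun i _ => ?_
    have := Submodule.smul_mem _ (p i l) (ht i)
    rwa [Algebra.smul_def, mul_comm] at this
  have hQm : ∀ j (t : κ → R), (∀ i, t i ∈ 𝒜 j) → ∀ l, Matrix.vecMul t Q l ∈ 𝒜 j := by
    intro j t ht l
    refine sum_mem fun i _ => ?_
    have := Submodule.smul_mem _ (q i l) (ht i)
    rwa [Algebra.smul_def, mul_comm] at this
  refine ⟨⟨hc, fun j m => ?_⟩, ι, inferInstance, P.vecMulLinear, b, ?_, ?_, hs⟩
  · rw [hb.mem_iff]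
    constructor
    · rintro ⟨t, ht, rfl⟩
      exact ⟨_, hPm j t ht, hPb t⟩
    · rintro ⟨t, ht, rfl⟩
      exact ⟨_, hQm j t ht, hQc t⟩
  · intro t t' htt
    have := congrArg (fun v => Matrix.vecMul v Q) htt
    simpa [Matrix.vecMul_vecMul, hPQ] using this
  · intro j t
    constructor
    · rintro ⟨h1, h2⟩
      refine ⟨Matrix.vecMul t Q, ⟨hQm _ t h1, by rw [hQc, h2]⟩, ?_⟩
      simp [Matrix.vecMul_vecMul, hQP]
    · rintro ⟨t', ⟨h1, h2⟩, rfl⟩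
      exact ⟨hPm _ _ h1, by rw [← h2, ← hPb]; rfl⟩

/-- The existential choice of generators in `IsLinear` is harmless: linearity may be continued from
any prescribed basis of the degree 0 part. -/
theorem IsLinear.syz_of_basis (h𝒜 : IsConnectedGraded 𝒜) {s : ℕ} (h : IsLinear 𝒜 (s + 1) gr)
    {κ : Type} [Fintype κ] {c : κ → M} (hc : LinearIndependent k c)
    (hc0 : Submodule.span k (Set.range c) = gr 0) :
    IsGenBasis 𝒜 gr c ∧ IsLinear 𝒜 s (syz 𝒜 c) := by
  obtain ⟨h1, ι, _, e, b, he, hs, hl⟩ := h.basis_change h𝒜 hc hc0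
  exact ⟨h1, hl.of_map h𝒜 e (fun j m _ hm => (map_eq_zero_iff e he).1 hm) hs⟩

/-- Horseshoe lemma: generators of `A` together with lifts of generators of `C` generate `B`, and
the three modules of relations form a short exact sequence of the same kind. Exactness is only
required in the graded pieces. -/
theorem IsLinear.of_shortExact (h𝒜 : IsConnectedGraded 𝒜) : ∀ (s : ℕ) {A B C : Type u}
    [AddCommGroup A] [Module k A] [Module R A] [IsScalarTower k R A]
    [AddCommGroup B] [Module k B] [Module R B] [IsScalarTower k R B]
    [AddCommGroup C] [Module k C] [Module R C] [IsScalarTower k R C]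
    {grA : ℕ → Submodule k A} {grB : ℕ → Submodule k B} {grC : ℕ → Submodule k C}
    (f : A →ₗ[R] B) (g : B →ₗ[R] C), Function.Injective f →
    (∀ j b, (b ∈ grB j ∧ g b = 0) ↔ ∃ a ∈ grA j, f a = b) →
    (∀ j c, c ∈ grC j ↔ ∃ b ∈ grB j, g b = c) →
    (∀ j, ∀ r ∈ 𝒜 j, ∀ b ∈ grB 0, r • b ∈ grB j) →
    IsLinear 𝒜 s grA → IsLinear 𝒜 s grC → IsLinear 𝒜 s grB
  | 0 => fun _ _ _ _ _ _ _ _ => trivial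
  | s + 1 => fun f g hf hex hg hB => by
    rename_i grA grB grC
    rintro ⟨ι, _, a, ha, hA⟩ ⟨κ, _, c, hc, hC⟩
    have hk : ∀ (x : k) m, f (x • m) = x • f m := fun x m => by
      rw [← algebraMap_smul R x m, map_smul, algebraMap_smul]
    have hk' : ∀ (x : k) m, g (x • m) = x • g m := fun x m => by
      rw [← algebraMap_smul R x m, map_smul, algebraMap_smul]
    choose c' hc' hgc using fun l => (hg 0 _).1 (hc.mem h𝒜 l)
    have hfB : ∀ j, ∀ x ∈ grA j, f x ∈ grB j := fun j x hx => ((hex j _).2 ⟨x, hx, rfl⟩).1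
    have hgf : ∀ j, ∀ x ∈ grA j, g (f x) = 0 := fun j x hx => ((hex j _).2 ⟨x, hx, rfl⟩).2
    have hga : ∀ i, g (f (a i)) = 0 := fun i => hgf 0 _ (ha.mem h𝒜 i)
    refine ⟨ι ⊕ κ, inferInstance, Sum.elim (f ∘ a) c', ⟨?_, ?_⟩, ?_⟩
    · rw [Fintype.linearIndependent_iff]
      intro x hx
      simp only [Fintype.sum_sum_type, Sum.elim_inl, Sum.elim_inr, Function.comp_apply] at hx
      have h2 : ∀ l, x (Sum.inr l) = 0 := by
        refine Fintype.linearIndependent_iff.1 hc.li (fun l => x (Sum.inr l)) ?_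
        have := congrArg g hx
        simpa [hk', hga, hgc] using this
      have h1 : ∀ l, x (Sum.inl l) = 0 := by
        refine Fintype.linearIndependent_iff.1 ha.li (fun l => x (Sum.inl l)) (hf ?_)
        simpa [hk, h2] using hx
      rintro (i | l)
      exacts [h1 i, h2 l]
    · intro j m
      constructor
      · intro hm
        obtain ⟨t, ht, htm⟩ := (hc.mem_iff _ _).1 ((hg j _).2 ⟨m, hm, rfl⟩)
        have : m - ∑ l, t l • c' l ∈ grB j ∧ g (m - ∑ l, t l • c' l) = 0 :=
          ⟨sub_mem hm (sum_mem fun l _ => hB j _ (ht l) _ (hc' l)), by simp [← htm, hgc]⟩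
        obtain ⟨x, hx, hx'⟩ := (hex j _).1 this
        obtain ⟨t', ht', rfl⟩ := (ha.mem_iff _ _).1 hx
        refine ⟨Sum.elim t' t, ?_, ?_⟩
        · rintro (i | l)
          exacts [ht' i, ht l]
        · simp only [map_sum, map_smul] at hx'
          simp [hx']
      · rintro ⟨t, ht, rfl⟩
        refine sum_mem fun i _ => hB j _ (ht i) _ ?_
        rcases i with i | l
        exacts [hfB 0 _ (ha.mem h𝒜 i), hc' l]
    · let F : (ι → R) →ₗ[R] (ι ⊕ κ → R) :=
        (LinearEquiv.sumArrowLequivProdArrow ι κ R R).symm.toLinearMap ∘ₗ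
          LinearMap.inl R (ι → R) (κ → R)
      let G : (ι ⊕ κ → R) →ₗ[R] (κ → R) := LinearMap.funLeft R R Sum.inr
      have hF1 : ∀ x i, F x (Sum.inl i) = x i := fun _ _ => rfl
      have hF2 : ∀ x i, F x (Sum.inr i) = 0 := fun _ _ => rfl
      have hG : ∀ x i, G x i = x (Sum.inr i) := fun _ _ => rfl
      refine IsLinear.of_shortExact h𝒜 s F G ?_ ?_ ?_ ?_ hA hC
      · intro x y h
        funext i
        exact congrFun h (Sum.inl i)
      · intro j t
        constructor
        · rintro ⟨⟨h1, h2⟩, h3⟩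
          have h3' : ∀ l, t (Sum.inr l) = 0 := fun l => congrFun h3 l
          refine ⟨fun i => t (Sum.inl i), ⟨fun i => h1 _, hf ?_⟩, ?_⟩
          · simpa [h3'] using h2
          · funext i
            rcases i with i | l
            · rfl
            · exact (h3' l).symm
        · rintro ⟨x, ⟨h1, h2⟩, rfl⟩
          refine ⟨⟨?_, ?_⟩, ?_⟩
          · rintro (i | l)
            exacts [h1 i, zero_mem _]
          · have := congrArg f h2
            simpa [hF1, hF2] using this
          · funext l; rfl
      · intro j t
        constructor
        · rintro ⟨h1, h2⟩
          have h3 : ∑ l, t l • c' l ∈ grB (j + 1) ∧ g (∑ l, t l • c' l) = 0 :=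
            ⟨sum_mem fun l _ => hB _ _ (h1 l) _ (hc' l), by simpa [hgc] using h2⟩
          obtain ⟨x, hx, hx'⟩ := (hex _ _).1 h3
          obtain ⟨t', ht', rfl⟩ := (ha.mem_iff _ _).1 hx
          -- A relation `t` among the generators of `C` lifts only up to an element of `A`, which is
          -- expressed as `t'` in the generators of `A` and subtracted.
          refine ⟨Sum.elim (-t') t, ⟨?_, ?_⟩, ?_⟩
          · rintro (i | l)
            exacts [neg_mem (ht' i), h1 l]
          · simp only [map_sum, map_smul] at hx'
            simp [← hx']
          · funext l; rfl
        · rintro ⟨x, ⟨h1, h2⟩, rfl⟩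
          refine ⟨fun l => h1 _, ?_⟩
          have := congrArg g h2
          simpa [hga, hgc, hG] using this
      · intro j r hr t ht
        exact syz_smul_mem h𝒜 hr ht

theorem sum_smul_single_prod {S M ι κ : Type*} [Semiring S] [AddCommGroup M] [Module S M] [Fintype ι]
    [DecidableEq ι] [Fintype κ] (b : κ → M) (t : ι × κ → S) (i : ι) :
    (∑ x, t x • (Pi.single x.1 (b x.2) : ι → M)) i = ∑ l, t (i, l) • b l := by
  simp only [Fintype.sum_prod_type, Finset.sum_apply, Pi.smul_apply, Pi.single_apply]
  rw [Finset.sum_eq_single i]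
  · simp
  · intro i' _ hi'
    simp [hi'.symm]
  · simp

theorem IsLinear.pi (h𝒜 : IsConnectedGraded 𝒜) (ι : Type) [Fintype ι] : ∀ {s : ℕ} {M : Type u}
    [AddCommGroup M] [Module k M] [Module R M] [IsScalarTower k R M] {gr : ℕ → Submodule k M},
    IsLinear 𝒜 s gr → IsLinear 𝒜 s (fun j => Submodule.pi Set.univ fun _ : ι => gr j)
  | 0 => fun _ => trivial
  | s + 1 => by
    classical
    rename_i M _ _ _ _ gr
    rintro ⟨κ, _, b, hb, hs⟩
    refine ⟨ι × κ, inferInstance, fun x => Pi.single x.1 (b x.2), ⟨?_, ?_⟩, ?_⟩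
    · rw [Fintype.linearIndependent_iff]
      rintro t ht ⟨i, l⟩
      refine Fintype.linearIndependent_iff.1 hb.li (fun l => t (i, l)) ?_ l
      rw [← sum_smul_single_prod, ht]; rfl
    · intro j m
      rw [Submodule.mem_pi]
      constructor
      · intro h
        choose t ht htm using fun i => (hb.mem_iff _ _).1 (h i (Set.mem_univ i))
        exact ⟨fun x => t x.1 x.2, fun x => ht _ _, by funext i; rw [sum_smul_single_prod, htm]⟩
      · rintro ⟨t, ht, rfl⟩ i -
        rw [sum_smul_single_prod]
        exact (hb.mem_iff _ _).2 ⟨_, fun l => ht (i, l), rfl⟩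
    · refine (IsLinear.pi h𝒜 ι hs).of_map h𝒜 (LinearEquiv.curry R R ι κ).symm.toLinearMap ?_ ?_
      · intro j m _ hm
        exact (LinearEquiv.map_eq_zero_iff _).1 hm
      · intro j t
        constructor
        · rintro ⟨h1, h2⟩
          refine ⟨fun i l => t (i, l), ?_, rfl⟩
          rw [Submodule.mem_pi]
          refine fun i _ => ⟨fun l => h1 _, ?_⟩
          rw [← sum_smul_single_prod, h2]; rfl
        · rintro ⟨t, ht, rfl⟩
          rw [Submodule.mem_pi] at ht
          refine ⟨fun x => (ht x.1 trivial).1 x.2, ?_⟩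
          funext i
          rw [sum_smul_single_prod]
          exact (ht i trivial).2

/-- A finite dimensional graded module concentrated in degree `0`. -/
theorem IsLinear.of_concentrated (h𝒜 : IsConnectedGraded 𝒜) [FiniteDimensional k (gr 0)]
    (h1 : ∀ j, ∀ r ∈ 𝒜 (j + 1), ∀ m ∈ gr 0, r • m = 0) (h2 : ∀ j, gr (j + 1) = ⊥) {s : ℕ}
    (h : IsLinear 𝒜 s fun j => 𝒜 (j + 1)) : IsLinear 𝒜 (s + 1) gr := by
  let b := Module.finBasis k (gr 0)
  have hb0 : ∀ (t : Fin (Module.finrank k (gr 0)) → R) j, (∀ i, t i ∈ 𝒜 (j + 1)) →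
      ∑ i, t i • (b i : M) = 0 := fun t j ht =>
    Finset.sum_eq_zero fun i _ => h1 j _ (ht i) _ (b i).2
  refine ⟨_, inferInstance, fun i => (b i : M), ⟨?_, ?_⟩, ?_⟩
  · exact b.linearIndependent.map' (gr 0).subtype (Submodule.ker_subtype _)
  · rintro (_ | j) m
    · constructor
      · intro hm
        refine ⟨fun i => algebraMap k R (b.repr ⟨m, hm⟩ i), fun i => (h𝒜.zero_iff _).2 ⟨_, rfl⟩, ?_⟩
        have := congrArg (gr 0).subtype (b.sum_repr ⟨m, hm⟩)
        rw [map_sum] at this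
        simpa only [algebraMap_smul, map_smul, Submodule.subtype_apply] using this
      · rintro ⟨t, ht, rfl⟩
        refine sum_mem fun i _ => ?_
        obtain ⟨c, hc⟩ := (h𝒜.zero_iff _).1 (ht i)
        rw [← hc, algebraMap_smul]
        exact Submodule.smul_mem _ _ (b i).2
    · rw [h2, Submodule.mem_bot]
      constructor
      · rintro rfl
        exact ⟨0, fun i => zero_mem _, by simp⟩
      · rintro ⟨t, ht, rfl⟩
        exact hb0 t j ht
  · have : syz 𝒜 (fun i => (b i : M)) = fun j => Submodule.pi Set.univ fun _ => 𝒜 (j + 1) := by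
      funext j
      ext t
      rw [mem_syz, Submodule.mem_pi]
      exact ⟨fun h i _ => h.1 i, fun h => ⟨fun i => h i trivial, hb0 t j fun i => h i trivial⟩⟩
    rw [this]
    exact IsLinear.pi h𝒜 _ h

end LinearResolutions

end CubicKoszul

namespace CubicKoszul

/-! ### Linear resolutions from a Koszul pair -/

section KoszulPairs

universe u

variable {k : Type*} [Field k] {R : Type u} [CommRing R] [Algebra k R] {𝒜 : ℕ → Submodule k R}

theorem exists_isGenBasis {M : Type*} [AddCommGroup M] [Module k M] [Module R M]
    [IsScalarTower k R M] {gr : ℕ → Submodule k M}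
    [FiniteDimensional k (gr 0)] (h1 : ∀ j, ∀ r ∈ 𝒜 j, ∀ m ∈ gr 0, r • m ∈ gr j)
    (h2 : ∀ j, ∀ m ∈ gr j, m ∈ Submodule.span k {x | ∃ r ∈ 𝒜 j, ∃ m ∈ gr 0, r • m = x}) :
    ∃ (ι : Type) (_ : Fintype ι) (b : ι → M), IsGenBasis 𝒜 gr b := by
  let b := Module.finBasis k (gr 0)
  refine ⟨_, inferInstance, fun i => (b i : M),
    b.linearIndependent.map' (gr 0).subtype (Submodule.ker_subtype _), fun j m => ⟨fun hm => ?_, ?_⟩⟩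
  · refine Submodule.span_induction (p := fun m _ => ∃ t : _ → R, (∀ i, t i ∈ 𝒜 j) ∧
      ∑ i, t i • (b i : M) = m) ?_ ?_ ?_ ?_ (h2 j m hm)
    · rintro _ ⟨r, hr, m, hm, rfl⟩
      refine ⟨fun i => b.repr ⟨m, hm⟩ i • r, fun i => Submodule.smul_mem _ _ hr, ?_⟩
      have := congrArg (gr 0).subtype (b.sum_repr ⟨m, hm⟩)
      rw [map_sum] at this
      simp only [map_smul, Submodule.subtype_apply] at this
      conv_rhs => rw [← this, Finset.smul_sum]
      refine Finset.sum_congr rfl fun i _ => ?_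
      simp only [Algebra.smul_def, mul_comm _ r, mul_smul, algebraMap_smul]
    · exact ⟨0, fun i => zero_mem _, by simp⟩
    · rintro _ _ _ _ ⟨s, hs, rfl⟩ ⟨t, ht, rfl⟩
      exact ⟨s + t, fun i => add_mem (hs i) (ht i), by simp [add_smul, Finset.sum_add_distrib]⟩
    · rintro c _ _ ⟨s, hs, rfl⟩
      exact ⟨c • s, fun i => Submodule.smul_mem _ _ (hs i), by simp [Finset.smul_sum]⟩
  · rintro ⟨t, ht, rfl⟩
    exact sum_mem fun i _ => h1 j _ (ht i) _ (b i).2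

/-- Two linear elements `y`, `a` of a graded algebra such that the annihilator of `y` is generated
by linear forms, and is free over `k[a]/(a²)`, as is the algebra modulo `y`. -/
structure IsKoszulPair (𝒜 : ℕ → Submodule k R) (y a : R) : Prop where
  y_mem : y ∈ 𝒜 1
  a_mem : a ∈ 𝒜 1
  y_ne : y ≠ 0
  of_span_y : ∀ {j r}, r ∈ 𝒜 (j + 1) → r ∈ Ideal.span {y} → ∃ s ∈ 𝒜 j, r = y * s
  of_span_ya : ∀ {j r}, r ∈ 𝒜 (j + 1) → r ∈ Ideal.span {y, a} →
    ∃ s ∈ 𝒜 j, ∃ t ∈ 𝒜 j, r = y * s + a * t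
  sq_mem : a * a ∈ Ideal.span {y}
  colon_zero : ∀ c ∈ 𝒜 0, a * c ∈ Ideal.span {y} → c = 0
  colon_succ : ∀ {j r}, r ∈ 𝒜 (j + 1) → a * r ∈ Ideal.span {y} →
    ∃ s ∈ 𝒜 j, ∃ t ∈ 𝒜 j, r = y * s + a * t
  top : ∀ {j r}, r ∈ 𝒜 (j + 2) → ∃ s ∈ 𝒜 (j + 1), ∃ t ∈ 𝒜 (j + 1), r = y * s + a * t
  ann_gen : ∀ {j r}, r ∈ 𝒜 (j + 1) → y * r = 0 →
    r ∈ Submodule.span k {x | ∃ s ∈ 𝒜 j, ∃ l ∈ 𝒜 1, y * l = 0 ∧ s * l = x}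
  ann_zero : ∀ l ∈ 𝒜 1, y * l = 0 → a * l = 0 → l = 0
  ann_succ : ∀ {j m}, m ∈ 𝒜 (j + 2) → y * m = 0 → a * m = 0 → ∃ m' ∈ 𝒜 (j + 1), y * m' = 0 ∧ m = a * m'

/-- A graded module that is generated in degree `0`, killed by `y`, and free over `k[a]/(a²)`. -/
structure IsPeriodic (𝒜 : ℕ → Submodule k R) (y a : R) {M : Type*} [AddCommGroup M] [Module k M]
    [Module R M] (gr : ℕ → Submodule k M) : Prop where
  gen : ∃ (ι : Type) (_ : Fintype ι) (b : ι → M), IsGenBasis 𝒜 gr b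
  kill : ∀ j, ∀ m ∈ gr j, y • m = 0
  zero : ∀ m ∈ gr 0, a • m = 0 → m = 0
  succ : ∀ j, ∀ m ∈ gr (j + 1), a • m = 0 → ∃ m' ∈ gr j, m = a • m'

theorem finiteDimensional_syz_zero [FiniteDimensional k (𝒜 1)] {M : Type*} [AddCommGroup M]
    [Module R M] {ι : Type*} [Fintype ι] (b : ι → M) : FiniteDimensional k (syz 𝒜 b 0) := by
  refine Submodule.finiteDimensional_of_le
    (S₂ := LinearMap.range ((𝒜 1).subtype.compLeft ι)) ?_
  intro t ht
  exact ⟨fun i => ⟨t i, ht.1 i⟩, rfl⟩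

variable {y a : R}

/-- The projection to the quotient by `y`. -/
abbrev modY (y : R) : R →ₗ[R] (R ⧸ Ideal.span {y}) := (Ideal.Quotient.mkₐ R (Ideal.span {y})).toLinearMap

theorem modY_eq_zero {y r : R} : modY y r = 0 ↔ r ∈ Ideal.span {y} := Ideal.Quotient.eq_zero_iff_mem

theorem compLeft_modY_eq_zero {y : R} {ι : Type*} {t : ι → R} :
    (modY y).compLeft ι t = 0 ↔ ∀ i, t i ∈ Ideal.span {y} := by
  rw [funext_iff]
  exact forall_congr' fun i => modY_eq_zero

/-- The syzygies of a module killed by `y` over the quotient by `y`. -/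
def syzModY (𝒜 : ℕ → Submodule k R) (y : R) {M : Type*} [AddCommGroup M]
    [Module R M] {ι : Type*} [Fintype ι] (b : ι → M) (j : ℕ) :
    Submodule k (ι → R ⧸ Ideal.span {y}) :=
  (syz 𝒜 b j).map (((modY y).compLeft ι).restrictScalars k)

theorem mem_syzModY {M : Type*} [AddCommGroup M]
    [Module R M] {ι : Type*} [Fintype ι] {b : ι → M} {j : ℕ} {t : ι → R ⧸ Ideal.span {y}} :
    t ∈ syzModY 𝒜 y b j ↔ ∃ s ∈ syz 𝒜 b j, (modY y).compLeft ι s = t := Iff.rfl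

/-- The multiples of `y`. -/
def multiplesY (𝒜 : ℕ → Submodule k R) (y : R) (j : ℕ) : Submodule k R :=
  (𝒜 j).map (LinearMap.mulLeft k y)

theorem mem_multiplesY {j : ℕ} {r : R} : r ∈ multiplesY 𝒜 y j ↔ ∃ s ∈ 𝒜 j, y * s = r := Iff.rfl

section

variable {M : Type u} [AddCommGroup M] [Module k M] [Module R M] [IsScalarTower k R M]
  {gr : ℕ → Submodule k M}

/-- The entries have degree at least two, hence `t = y s + a r`. As `y` kills the module, `a` kills
`∑ r b`, so freeness over `k[a]/(a²)` gives `∑ r b = a ∑ u b`. Then `r - a u` is a relation, and `a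
(r - a u)` differs from `t` by elements of `(y)` because `a² ∈ (y)`. -/
theorem IsPeriodic.exists_mul (h𝒜 : IsConnectedGraded 𝒜) (h : IsKoszulPair 𝒜 y a)
    (hM : IsPeriodic 𝒜 y a gr) {ι : Type} [Fintype ι] {b : ι → M} (hb : IsGenBasis 𝒜 gr b) {j : ℕ}
    {t : ι → R} (ht : t ∈ syz 𝒜 b (j + 1)) :
    ∃ t' ∈ syz 𝒜 b j, (modY y).compLeft ι t = (modY y).compLeft ι (a • t') := by
  choose s hs r hr htsr using fun i => h.top (ht.1 i)
  have hys : ∀ (s : ι → R), (∑ i, (y * s i) • b i) = 0 := fun s => by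
    refine Finset.sum_eq_zero fun i _ => ?_
    rw [mul_comm, mul_smul, hM.kill 0 _ (hb.mem h𝒜 i), smul_zero]
  have h1 : a • ∑ i, r i • b i = 0 := by
    have := ht.2
    simp only [htsr, add_smul, Finset.sum_add_distrib, hys, zero_add] at this
    simpa [Finset.smul_sum, mul_smul] using this
  obtain ⟨m', hm', hmm⟩ := hM.succ j _ ((hb.mem_iff _ _).2 ⟨r, hr, rfl⟩) h1
  obtain ⟨u, hu, rfl⟩ := (hb.mem_iff _ _).1 hm'
  refine ⟨r - a • u, ⟨fun i => sub_mem (hr i) ?_, ?_⟩, ?_⟩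
  · simpa [add_comm] using h𝒜.mul_mem h.a_mem (hu i)
  · simp only [Pi.sub_apply, Pi.smul_apply, smul_eq_mul, sub_smul, mul_smul,
      Finset.sum_sub_distrib, hmm, ← Finset.smul_sum, sub_self]
  · rw [← sub_eq_zero, ← map_sub, compLeft_modY_eq_zero]
    intro i
    have : (t - a • (r - a • u)) i = y * s i + a * a * u i := by
      simp only [Pi.sub_apply, Pi.smul_apply, smul_eq_mul, htsr]
      ring
    rw [this]
    exact add_mem (Ideal.mul_mem_right _ _ (Ideal.mem_span_singleton_self y))
      (Ideal.mul_mem_right _ _ h.sq_mem)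

/-- Modulo `y`, every relation of positive degree is a multiple of `a` by `IsPeriodic.exists_mul`.
This gives both generation in degree 0 and the kernel condition for `a` in positive degree. -/
theorem IsPeriodic.syzModY [FiniteDimensional k (𝒜 1)] (h𝒜 : IsConnectedGraded 𝒜)
    (h : IsKoszulPair 𝒜 y a)
    (hM : IsPeriodic 𝒜 y a gr) {ι : Type} [Fintype ι] {b : ι → M} (hb : IsGenBasis 𝒜 gr b) :
    IsPeriodic 𝒜 y a (syzModY 𝒜 y b) := by
  have := finiteDimensional_syz_zero (𝒜 := 𝒜) b
  have hfin : FiniteDimensional k (CubicKoszul.syzModY 𝒜 y b 0) := by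
    unfold CubicKoszul.syzModY
    infer_instance
  have hsm : ∀ i j, ∀ r ∈ 𝒜 i, ∀ m ∈ CubicKoszul.syzModY 𝒜 y b j,
      r • m ∈ CubicKoszul.syzModY 𝒜 y b (i + j) := by
    rintro i j r hr _ ⟨t, ht, rfl⟩
    exact ⟨r • t, syz_smul_mem h𝒜 hr ht, map_smul ((modY y).compLeft ι) r t⟩
  refine ⟨exists_isGenBasis (fun j r hr m hm => hsm j 0 r hr m hm) ?_, ?_, ?_, ?_⟩
  · intro j
    induction j with
    | zero =>
      intro m hm
      exact Submodule.subset_span ⟨1, (h𝒜.zero_iff _).2 ⟨1, map_one _⟩, m, hm, one_smul _ _⟩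
    | succ j ih =>
      rintro _ ⟨t, ht, rfl⟩
      obtain ⟨t', ht', htt⟩ := hM.exists_mul h𝒜 h hb ht
      have h1 := ih _ ⟨t', ht', rfl⟩
      have h2 := Submodule.mem_map_of_mem
        (f := (LinearMap.lsmul R (ι → R ⧸ Ideal.span {y}) a).restrictScalars k) h1
      have h3 : ((modY y).compLeft ι).restrictScalars k t =
          (LinearMap.lsmul R (ι → R ⧸ Ideal.span {y}) a).restrictScalars k
            (((modY y).compLeft ι).restrictScalars k t') := by
        refine htt.trans ?_
        exact map_smul _ _ _
      rw [h3]
      refine (Submodule.map_span_le _ _ _).2 ?_ h2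
      rintro _ ⟨r, hr, m, hm, rfl⟩
      refine Submodule.subset_span ⟨a * r, ?_, m, hm, mul_smul _ _ _⟩
      simpa [add_comm] using h𝒜.mul_mem h.a_mem hr
  · rintro j _ ⟨t, ht, rfl⟩
    refine (map_smul ((modY y).compLeft ι) y t).symm.trans ?_
    rw [compLeft_modY_eq_zero]
    exact fun i => Ideal.mul_mem_right _ _ (Ideal.mem_span_singleton_self y)
  · rintro _ ⟨t, ht, rfl⟩ hat
    have hat : (modY y).compLeft ι (a • t) = 0 := (map_smul ((modY y).compLeft ι) a t).trans hat
    rw [compLeft_modY_eq_zero] at hat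
    -- The entries of `t` are linear, so the coefficients `r` of `a` are constants; a relation with
    -- constant coefficients among basis elements is zero, and only multiples of `y` remain.
    choose s hs r hr htsr using fun i => h.colon_succ (ht.1 i) (hat i)
    have hys : ∀ (s : ι → R), (∑ i, (y * s i) • b i) = 0 := fun s => by
      refine Finset.sum_eq_zero fun i _ => ?_
      rw [mul_comm, mul_smul, hM.kill 0 _ (hb.mem h𝒜 i), smul_zero]
    have h1 : a • ∑ i, r i • b i = 0 := by
      have := ht.2
      simp only [htsr, add_smul, Finset.sum_add_distrib, hys, zero_add] at this
      simpa [Finset.smul_sum, mul_smul] using this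
    have h2 := hb.eq_zero h𝒜 hr (hM.zero _ ((hb.mem_iff _ _).2 ⟨r, hr, rfl⟩) h1)
    refine compLeft_modY_eq_zero.2 fun i => ?_
    rw [htsr, h2]
    simpa using Ideal.mul_mem_right _ _ (Ideal.mem_span_singleton_self y)
  · rintro j _ ⟨t, ht, rfl⟩ -
    obtain ⟨t', ht', htt⟩ := hM.exists_mul h𝒜 h hb ht
    exact ⟨_, ⟨t', ht', rfl⟩, htt.trans (map_smul _ _ _)⟩

end

/-- The annihilator of `y` enters as the module of relations of the single generator `y` of `yR`. -/
theorem IsKoszulPair.isPeriodic_ann [FiniteDimensional k (𝒜 1)] (h𝒜 : IsConnectedGraded 𝒜)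
    (h : IsKoszulPair 𝒜 y a) : IsPeriodic 𝒜 y a (syz 𝒜 fun _ : Unit => y) := by
  have := finiteDimensional_syz_zero (𝒜 := 𝒜) (fun _ : Unit => y)
  have hmem : ∀ {j} {t : Unit → R}, t ∈ syz 𝒜 (fun _ : Unit => y) j ↔ t () ∈ 𝒜 (j + 1) ∧ y * t () = 0 := by
    intro j t
    rw [mem_syz]
    exact and_congr ⟨fun h => h (), fun h _ => h⟩ (by simp [mul_comm])
  refine ⟨exists_isGenBasis (fun j r hr m hm => syz_smul_mem h𝒜 hr hm) ?_, ?_, ?_, ?_⟩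
  · intro j m hm
    obtain ⟨h1, h2⟩ := hmem.1 hm
    have h3 := Submodule.mem_map_of_mem
      (f := (LinearMap.pi fun _ : Unit => LinearMap.id : R →ₗ[k] (Unit → R))) (h.ann_gen h1 h2)
    have h4 : (LinearMap.pi fun _ : Unit => LinearMap.id : R →ₗ[k] (Unit → R)) (m ()) = m := rfl
    rw [h4] at h3
    refine (Submodule.map_span_le _ _ _).2 ?_ h3
    rintro _ ⟨s, hs, l, hl, hyl, rfl⟩
    exact Submodule.subset_span ⟨s, hs, fun _ => l, hmem.2 ⟨hl, hyl⟩, rfl⟩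
  · intro j m hm
    funext i
    exact (hmem.1 hm).2
  · intro m hm ham
    funext i
    exact h.ann_zero _ (hmem.1 hm).1 (hmem.1 hm).2 (congrFun ham i)
  · intro j m hm ham
    obtain ⟨m', h1, h2, h3⟩ := h.ann_succ (hmem.1 hm).1 (hmem.1 hm).2 (congrFun ham ())
    exact ⟨fun _ => m', hmem.2 ⟨h1, h2⟩, funext fun _ => h3⟩

/-- The two statements feed each other. The relations of `yR` form the annihilator of `y`, which is
periodic. The relations of a periodic module are an extension of a periodic module, the relations
modulo `y`, by copies of `yR`. -/
theorem IsKoszulPair.isLinear_multiplesY_and_periodic [FiniteDimensional k (𝒜 1)]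
    (h𝒜 : IsConnectedGraded 𝒜) (h : IsKoszulPair 𝒜 y a) : ∀ s : ℕ, IsLinear 𝒜 s (multiplesY 𝒜 y) ∧
      ∀ {M : Type u} [AddCommGroup M] [Module k M] [Module R M] [IsScalarTower k R M]
        {gr : ℕ → Submodule k M}, IsPeriodic 𝒜 y a gr → IsLinear 𝒜 s gr
  | 0 => ⟨trivial, fun _ => trivial⟩
  | s + 1 => by
    obtain ⟨hN, hP⟩ := h.isLinear_multiplesY_and_periodic h𝒜 s
    refine ⟨⟨Unit, inferInstance, fun _ => y, ⟨?_, ?_⟩, hP (h.isPeriodic_ann h𝒜)⟩, ?_⟩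
    · rw [Fintype.linearIndependent_iff]
      rintro c hc -
      simpa [h.y_ne] using hc
    · intro j m
      rw [mem_multiplesY]
      constructor
      · rintro ⟨s, hs, rfl⟩
        exact ⟨fun _ => s, fun _ => hs, by simp [mul_comm]⟩
      · rintro ⟨t, ht, rfl⟩
        exact ⟨t (), ht (), by simp [mul_comm]⟩
    · rintro M _ _ _ _ gr hM
      obtain ⟨ι, _, b, hb⟩ := hM.gen
      refine ⟨ι, inferInstance, b, hb, ?_⟩
      refine IsLinear.of_shortExact h𝒜 s (LinearMap.id : (ι → R) →ₗ[R] _) ((modY y).compLeft ι)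
        Function.injective_id ?_ (fun j c => mem_syzModY) (fun j r hr t ht => syz_smul_mem h𝒜 hr ht)
        (hN.pi h𝒜 ι) (hP (hM.syzModY h𝒜 h hb))
      intro j t
      simp only [LinearMap.id_coe, id_eq, exists_eq_right, Submodule.mem_pi, compLeft_modY_eq_zero]
      constructor
      · rintro ⟨h1, h2⟩ i -
        obtain ⟨s, hs, hs'⟩ := h.of_span_y (h1.1 i) (h2 i)
        exact ⟨s, hs, hs'.symm⟩
      · intro h1
        choose s hs hst using fun i => mem_multiplesY.1 (h1 i trivial)
        refine ⟨⟨fun i => ?_, Finset.sum_eq_zero fun i _ => ?_⟩, fun i => ?_⟩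
        · rw [← hst]
          simpa [add_comm] using h𝒜.mul_mem h.y_mem (hs i)
        · rw [← hst, mul_comm, mul_smul, hM.kill 0 _ (hb.mem h𝒜 i), smul_zero]
        · rw [← hst]
          exact Ideal.mul_mem_right _ _ (Ideal.mem_span_singleton_self y)

/-- The multiples of `a` modulo `y`. -/
def multiplesAModY (𝒜 : ℕ → Submodule k R) (y a : R) (j : ℕ) : Submodule k (R ⧸ Ideal.span {y}) :=
  (multiplesY 𝒜 a j).map ((modY y).restrictScalars k)

/-- The colon ideal `(y) : a` is `(y, a)`, so this ideal can be treated as the module of relations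
of the class of `a` modulo `y`. -/
theorem IsKoszulPair.mem_syz_modY (h𝒜 : IsConnectedGraded 𝒜) (h : IsKoszulPair 𝒜 y a) {j : ℕ}
    {t : Unit → R} : t ∈ syz 𝒜 (fun _ : Unit => modY y a) j ↔
      ∃ s ∈ 𝒜 j, ∃ r ∈ 𝒜 j, t () = y * s + a * r := by
  have h0 : t () • modY y a = 0 ↔ a * t () ∈ Ideal.span {y} := by
    rw [← map_smul, modY_eq_zero, smul_eq_mul, mul_comm]
  have hmem : t ∈ syz 𝒜 (fun _ : Unit => modY y a) j ↔
      t () ∈ 𝒜 (j + 1) ∧ a * t () ∈ Ideal.span {y} := by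
    rw [mem_syz, ← h0]
    exact and_congr ⟨fun h => h (), fun h _ => h⟩ (by simp)
  rw [hmem]
  constructor
  · rintro ⟨h1, h2⟩
    exact h.colon_succ h1 h2
  · rintro ⟨s, hs, r, hr, hsr⟩
    rw [hsr]
    constructor
    · have h1 := h𝒜.mul_mem h.y_mem hs
      have h2 := h𝒜.mul_mem h.a_mem hr
      rw [add_comm] at h1 h2
      exact add_mem h1 h2
    · rw [show a * (y * s + a * r) = y * (a * s) + a * a * r by ring]
      exact add_mem (Ideal.mul_mem_right _ _ (Ideal.mem_span_singleton_self y))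
        (Ideal.mul_mem_right _ _ h.sq_mem)

/-- The relations of `a (R/y)` form `(y, a)`, and `(y, a)` is an extension of `a (R/y)` by `yR`.
Each step for one of the two modules therefore gives a step for the other. -/
theorem IsKoszulPair.isLinear_multiplesAModY [FiniteDimensional k (𝒜 1)] (h𝒜 : IsConnectedGraded 𝒜)
    (h : IsKoszulPair 𝒜 y a) : ∀ s : ℕ, IsLinear 𝒜 s (multiplesAModY 𝒜 y a) ∧
      IsLinear 𝒜 s (syz 𝒜 fun _ : Unit => modY y a)
  | 0 => ⟨trivial, trivial⟩
  | s + 1 => by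
    obtain ⟨-, hE⟩ := h.isLinear_multiplesAModY h𝒜 s
    have hD : IsLinear 𝒜 (s + 1) (multiplesAModY 𝒜 y a) := by
      refine ⟨Unit, inferInstance, fun _ => modY y a, ⟨?_, ?_⟩, hE⟩
      · rw [Fintype.linearIndependent_iff]
        rintro c hc ⟨⟩
        have h1 := h.colon_zero (algebraMap k R (c ())) ((h𝒜.zero_iff _).2 ⟨_, rfl⟩) ?_
        · by_contra hne
          have h2 : algebraMap k R ((c ())⁻¹ * c ()) * y = 0 := by rw [map_mul, h1]; simp
          rw [inv_mul_cancel₀ hne, map_one, one_mul] at h2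
          exact h.y_ne h2
        · rw [← modY_eq_zero, mul_comm, ← Algebra.smul_def]
          simpa using hc
      · intro j m
        have hsum : ∀ t : Unit → R, ∑ x, t x • modY y a = modY y (a * t ()) := fun t => by
          rw [Fintype.sum_unique, mul_comm]
          exact (map_smul (modY y) (t ()) a).symm
        constructor
        · rintro ⟨_, ⟨s, hs, rfl⟩, rfl⟩
          exact ⟨fun _ => s, fun _ => hs, hsum _⟩
        · rintro ⟨t, ht, rfl⟩
          exact ⟨_, ⟨t (), ht (), rfl⟩, (hsum t).symm⟩
    refine ⟨hD, ?_⟩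
    let F : R →ₗ[R] (Unit → R) := LinearMap.pi fun _ => LinearMap.id
    let G : (Unit → R) →ₗ[R] (R ⧸ Ideal.span {y}) := (modY y) ∘ₗ LinearMap.proj ()
    have hF : ∀ r i, F r i = r := fun _ _ => rfl
    have hG : ∀ r, G r = modY y (r ()) := fun _ => rfl
    refine IsLinear.of_shortExact h𝒜 (s + 1) F G ?_ ?_ ?_ ?_
      (h.isLinear_multiplesY_and_periodic h𝒜 (s + 1)).1 hD
    · exact fun x x' hx => congrFun hx ()
    · intro j t
      rw [h.mem_syz_modY h𝒜, hG, modY_eq_zero]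
      constructor
      · rintro ⟨⟨s, hs, r, hr, hsr⟩, h2⟩
        have h1 : t () ∈ 𝒜 (j + 1) := by
          have h1 := h𝒜.mul_mem h.y_mem hs
          have h2 := h𝒜.mul_mem h.a_mem hr
          rw [add_comm] at h1 h2
          exact hsr ▸ add_mem h1 h2
        obtain ⟨s, hs, hs'⟩ := h.of_span_y h1 h2
        exact ⟨t (), ⟨s, hs, hs'.symm⟩, rfl⟩
      · rintro ⟨_, ⟨s, hs, rfl⟩, rfl⟩
        refine ⟨⟨s, hs, 0, zero_mem _, by simp [hF]⟩, ?_⟩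
        exact Ideal.mul_mem_right _ _ (Ideal.mem_span_singleton_self y)
    · intro j c
      constructor
      · rintro ⟨_, ⟨r, hr, rfl⟩, rfl⟩
        exact ⟨fun _ => a * r, (h.mem_syz_modY h𝒜).2 ⟨0, zero_mem _, r, hr, by simp⟩, rfl⟩
      · rintro ⟨t, ht, rfl⟩
        obtain ⟨s, hs, r, hr, hsr⟩ := (h.mem_syz_modY h𝒜).1 ht
        refine ⟨a * r, ⟨r, hr, rfl⟩, ?_⟩
        rw [hG, hsr, map_add, modY_eq_zero.2 (Ideal.mul_mem_right s _ (Ideal.mem_span_singleton_self y)),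
          zero_add]
        rfl
    · exact fun j r hr t ht => syz_smul_mem h𝒜 hr ht

/-- In the presence of a Koszul pair, the irrelevant ideal has a linear resolution. -/
theorem IsKoszulPair.isLinear [FiniteDimensional k (𝒜 1)] (h𝒜 : IsConnectedGraded 𝒜)
    (h : IsKoszulPair 𝒜 y a) : ∀ s : ℕ, IsLinear 𝒜 s fun j => 𝒜 (j + 1)
  | 0 => trivial
  | s + 1 => by
    have ih := h.isLinear h𝒜 s
    let q : R →ₗ[R] (R ⧸ Ideal.span {y, a}) := (Ideal.Quotient.mkₐ R (Ideal.span {y, a})).toLinearMap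
    have hq : ∀ r, q r = 0 ↔ r ∈ Ideal.span {y, a} := fun r => Ideal.Quotient.eq_zero_iff_mem
    have hy : ∀ r, y * r ∈ Ideal.span {y, a} := fun r =>
      Ideal.mul_mem_right _ _ (Ideal.subset_span (by simp))
    have ha : ∀ r, a * r ∈ Ideal.span {y, a} := fun r =>
      Ideal.mul_mem_right _ _ (Ideal.subset_span (by simp))
    let F : (Unit → R) →ₗ[R] R := LinearMap.proj ()
    have hF : ∀ r, F r = r () := fun _ => rfl
    have hsucc : ∀ j, ∀ r ∈ 𝒜 (j + 2), q r = 0 := fun j r hr => by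
      obtain ⟨s, hs, t, ht, rfl⟩ := h.top hr
      exact (hq _).2 (add_mem (hy _) (ha _))
    -- By `top`, the quotient of the irrelevant ideal by `(y, a)` lives in a single degree. Its
    -- relations are copies of the irrelevant ideal itself, so the induction hypothesis supplies the
    -- remaining `s` steps.
    have hmD : IsLinear 𝒜 (s + 1) (fun j => (𝒜 (j + 1)).map (q.restrictScalars k)) := by
      refine IsLinear.of_concentrated h𝒜 ?_ ?_ ih
      · rintro j r hr _ ⟨m, hm, rfl⟩
        exact (map_smul q r m).symm.trans (hsucc j _ (h𝒜.mul_mem hr hm :))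
      · intro j
        rw [eq_bot_iff]
        rintro _ ⟨m, hm, rfl⟩
        exact hsucc j m hm
    refine IsLinear.of_shortExact h𝒜 (s + 1) F q ?_ ?_ ?_ ?_
      (h.isLinear_multiplesAModY h𝒜 (s + 1)).2 hmD
    · intro x x' hx
      funext i
      exact hx
    · intro j r
      rw [hq]
      constructor
      · rintro ⟨h1, h2⟩
        refine ⟨fun _ => r, (h.mem_syz_modY h𝒜).2 (h.of_span_ya h1 h2), rfl⟩
      · rintro ⟨t, ht, rfl⟩
        refine ⟨ht.1 (), ?_⟩
        obtain ⟨s, hs, r, hr, hsr⟩ := (h.mem_syz_modY h𝒜).1 ht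
        rw [hF, hsr]
        exact add_mem (hy _) (ha _)
    · exact fun j c => Iff.rfl
    · exact fun j r hr t ht => (h𝒜.mul_mem hr ht :)

end KoszulPairs

end CubicKoszul

namespace CubicKoszul

/-! ### Descent of linear resolutions along a field extension -/

section BaseChange

universe u v

variable {k k' : Type*} [Field k] [Field k'] [Algebra k k'] {R : Type u} [CommRing R] [Algebra k R]
  {R' : Type v} [CommRing R'] [Algebra k' R']
  {𝒜 : ℕ → Submodule k R} {𝒜' : ℕ → Submodule k' R'} {B : Type*} (β : Module.Basis B k k')

/-- The pieces `gr' j` arise from the pieces `gr j` by extension of scalars. Here `β` is a basis of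
the extension field. -/
structure IsGradedBaseChange {M M' : Type*} [AddCommGroup M] [Module k M] [AddCommGroup M']
    [Module k' M'] (gr : ℕ → Submodule k M) (gr' : ℕ → Submodule k' M') (ψ : M →+ M') : Prop where
  smul : ∀ (c : k) m, ψ (c • m) = algebraMap k k' c • ψ m
  mem : ∀ {j m}, m ∈ gr j → ψ m ∈ gr' j
  exists_sum : ∀ {j m'}, m' ∈ gr' j → ∃ (F : Finset B) (m : B → M), (∀ b, m b ∈ gr j) ∧
    (∀ b, b ∉ F → m b = 0) ∧ ∑ b ∈ F, β b • ψ (m b) = m'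
  eq_zero : ∀ {j} (F : Finset B) (m : B → M), (∀ b, m b ∈ gr j) → ∑ b ∈ F, β b • ψ (m b) = 0 →
    ∀ b ∈ F, m b = 0

variable {β}

theorem IsGradedBaseChange.exists_sum_pi {M M' : Type*} [AddCommGroup M] [Module k M]
    [AddCommGroup M'] [Module k' M'] {gr : ℕ → Submodule k M} {gr' : ℕ → Submodule k' M'}
    {ψ : M →+ M'} (h : IsGradedBaseChange β gr gr' ψ) {ι : Type*} [Fintype ι] {j : ℕ} {t : ι → M'}
    (ht : ∀ i, t i ∈ gr' j) : ∃ (F : Finset B) (m : B → ι → M), (∀ b i, m b i ∈ gr j) ∧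
      (∀ b, b ∉ F → m b = 0) ∧ ∀ i, ∑ b ∈ F, β b • ψ (m b i) = t i := by
  classical
  choose F m hm hF hs using fun i => h.exists_sum (ht i)
  refine ⟨Finset.univ.biUnion F, fun b i => m i b, fun b i => hm i b, ?_, ?_⟩
  · intro b hb
    funext i
    exact hF i b fun hbi => hb (Finset.mem_biUnion.2 ⟨i, Finset.mem_univ _, hbi⟩)
  · intro i
    rw [← hs i]
    symm
    refine Finset.sum_subset (Finset.subset_biUnion_of_mem F (Finset.mem_univ i)) ?_
    intro b _ hb
    rw [hF i b hb, map_zero, smul_zero]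

/-- A basis of the degree 0 part over `k` remains a basis over `k'`, and by `IsLinear.syz_of_basis`
the resolution over `k'` may start with it. Its relations over `k'` are the `β`-combinations of
relations over `k`, so the argument repeats for the modules of relations. -/
theorem IsLinear.descend (h𝒜' : IsConnectedGraded 𝒜')
    [FiniteDimensional k (𝒜 1)] (h𝒜 : IsConnectedGraded 𝒜) (φ : R →+* R')
    (hφ : IsGradedBaseChange β 𝒜 𝒜' φ.toAddMonoidHom) : ∀ {s : ℕ} {M : Type u} {M' : Type v}
    [AddCommGroup M] [Module k M] [Module R M] [IsScalarTower k R M]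
    [AddCommGroup M'] [Module k' M'] [Module R' M'] [IsScalarTower k' R' M']
    {gr : ℕ → Submodule k M} {gr' : ℕ → Submodule k' M'} (ψ : M →+ M'),
    IsGradedBaseChange β gr gr' ψ → (∀ (r : R) m, ψ (r • m) = φ r • ψ m) →
    FiniteDimensional k (gr 0) → (∀ j, ∀ r ∈ 𝒜 j, ∀ m ∈ gr 0, r • m ∈ gr j) →
    IsLinear 𝒜' s gr' → IsLinear 𝒜 s gr
  | 0 => fun _ _ _ _ _ _ => trivial
  | s + 1 => fun ψ hψ hsm hfin hgr h => by
    rename_i M M' _ _ _ _ _ _ _ _ gr gr'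
    let b := Module.finBasis k (gr 0)
    let ι := Fin (Module.finrank k (gr 0))
    -- The basis `β` need not contain `1`. A coordinate in which `1` does not vanish is enough to
    -- read an identity over `k'` back over `k`.
    obtain ⟨x₀, hx₀⟩ : ∃ x, β.repr 1 x ≠ 0 := by
      by_contra! hne
      have : β.repr 1 = 0 := Finsupp.ext hne
      simp at this
    have hbli : LinearIndependent k (fun i : ι => (b i : M)) :=
      b.linearIndependent.map' (gr 0).subtype (Submodule.ker_subtype _)
    have hsum : ∀ (F : Finset B) (t : B → ι → R), ∑ i, (∑ x ∈ F, β x • φ (t x i)) • ψ (b i) =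
        ∑ x ∈ F, β x • ψ (∑ i, t x i • (b i : M)) := by
      intro F t
      simp only [Finset.sum_smul, map_sum, Finset.smul_sum, hsm]
      rw [Finset.sum_comm]
      simp only [smul_assoc]
    have hmem : ∀ {j} (t : ι → R), (∀ i, t i ∈ 𝒜 j) → ∑ i, t i • (b i : M) ∈ gr j := fun t ht =>
      sum_mem fun i _ => hgr _ _ (ht i) _ (b i).2
    have hli : LinearIndependent k' (fun i : ι => ψ (b i)) := by
      rw [Fintype.linearIndependent_iff]
      intro c hc
      obtain ⟨F, t, ht, htF, htc⟩ := hφ.exists_sum_pi (j := 0) (t := fun i => algebraMap k' R' (c i))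
        (fun i => (h𝒜'.zero_iff _).2 ⟨_, rfl⟩)
      have h1 : ∑ x ∈ F, β x • ψ (∑ i, t x i • (b i : M)) = 0 := by
        rw [← hsum, ← hc]
        refine Finset.sum_congr rfl fun i _ => ?_
        rw [← algebraMap_smul R' (c i), ← htc]
        rfl
      have h2 := hψ.eq_zero F _ (fun x => hmem _ (ht x)) h1
      have h3 : ∀ x ∈ F, t x = 0 := by
        intro x hx
        choose d hd using fun i => (h𝒜.zero_iff _).1 (ht x i)
        have h4 := Fintype.linearIndependent_iff.1 hbli d (by
          simpa only [← hd, algebraMap_smul] using h2 x hx)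
        funext i
        simp [← hd, h4 i]
      intro i
      have h5 := htc i
      rw [Finset.sum_eq_zero fun x hx => by rw [h3 x hx]; simp] at h5
      have h6 : (algebraMap k' R' (c i)) • ψ (b i) = 0 := by rw [← h5, zero_smul]
      rw [algebraMap_smul, smul_eq_zero] at h6
      refine h6.resolve_right fun h0 => ?_
      have hz := hψ.eq_zero {x₀} (fun _ => (b i : M)) (fun _ => (b i).2) (by simp [h0]) x₀ (by simp)
      exact b.ne_zero i (Subtype.ext hz)
    have hspan : Submodule.span k' (Set.range fun i : ι => ψ (b i)) = gr' 0 := by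
      apply le_antisymm
      · rw [Submodule.span_le]
        rintro _ ⟨i, rfl⟩
        exact hψ.mem (b i).2
      · intro m' hm'
        obtain ⟨F, m, hm, -, rfl⟩ := hψ.exists_sum hm'
        refine sum_mem fun x _ => Submodule.smul_mem _ _ ?_
        have := congrArg (gr 0).subtype (b.sum_repr ⟨m x, hm x⟩)
        rw [map_sum] at this
        simp only [map_smul, Submodule.subtype_apply] at this
        rw [← this, map_sum]
        refine sum_mem fun i _ => ?_
        rw [hψ.smul]
        exact Submodule.smul_mem _ _ (Submodule.subset_span ⟨i, rfl⟩)
    obtain ⟨hgen, hlin⟩ := h.syz_of_basis h𝒜' hli hspan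
    refine ⟨ι, inferInstance, fun i => (b i : M), ⟨hbli, fun j m => ⟨fun hm => ?_, ?_⟩⟩, ?_⟩
    · classical
      obtain ⟨t', ht', htm⟩ := (hgen.mem_iff _ _).1 (hψ.mem hm)
      obtain ⟨F, t, ht, htF, htc⟩ := hφ.exists_sum_pi ht'
      simp only [← htc] at htm
      have htm := (hsum F t).symm.trans htm
      have h1 : ∑ x ∈ (β.repr 1).support, β x • ψ ((β.repr 1 x) • m) = ψ m := by
        have := β.linearCombination_repr 1
        rw [Finsupp.linearCombination_apply, Finsupp.sum] at this
        simp only [hψ.smul, smul_smul]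
        rw [← Finset.sum_smul]
        conv_rhs => rw [← one_smul k' (ψ _), ← this]
        simp [Algebra.smul_def, mul_comm]
      have h2 : ∑ x ∈ F ∪ (β.repr 1).support,
          β x • ψ ((∑ i, t x i • (b i : M)) - (β.repr 1 x) • m) = 0 := by
        simp only [map_sub, smul_sub, Finset.sum_sub_distrib]
        rw [sub_eq_zero, ← Finset.sum_subset (Finset.subset_union_left), htm, ← h1]
        · refine Finset.sum_subset Finset.subset_union_right ?_
          intro x _ hx
          rw [Finsupp.notMem_support_iff.1 hx]
          simp
        · intro x _ hx
          rw [htF x hx]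
          simp
      have h3 := hψ.eq_zero _ _ (fun x => sub_mem (hmem _ (ht x)) (Submodule.smul_mem _ _ hm)) h2 x₀
        (Finset.mem_union_right _ (Finsupp.mem_support_iff.2 hx₀))
      refine ⟨fun i => (β.repr 1 x₀)⁻¹ • t x₀ i, fun i => Submodule.smul_mem _ _ (ht _ _), ?_⟩
      simp only [smul_assoc, ← Finset.smul_sum]
      rw [sub_eq_zero.1 h3, smul_smul, inv_mul_cancel₀ hx₀, one_smul]
    · rintro ⟨t, ht, rfl⟩
      exact hmem t ht
    · refine IsLinear.descend h𝒜' h𝒜 φ hφ (φ.toAddMonoidHom.compLeft ι) ⟨?_, ?_, ?_, ?_⟩ ?_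
        (finiteDimensional_syz_zero _) (fun j r hr m hm => syz_smul_mem h𝒜 hr hm) hlin
      · intro c m
        funext i
        exact hφ.smul c (m i)
      · intro j m hm
        refine ⟨fun i => hφ.mem (hm.1 i), ?_⟩
        have := congrArg ψ hm.2
        simp only [map_sum, hsm, map_zero] at this
        exact this
      · intro j t' ht'
        obtain ⟨F, t, ht, htF, htc⟩ := hφ.exists_sum_pi ht'.1
        have h1 := ht'.2
        simp only [← htc] at h1
        have h1 := (hsum F t).symm.trans h1
        have h2 := hψ.eq_zero F _ (fun x => hmem _ (ht x)) h1
        refine ⟨F, t, fun x => ⟨ht x, ?_⟩, htF, ?_⟩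
        · by_cases hx : x ∈ F
          · exact h2 x hx
          · simp [htF x hx]
        · funext i
          rw [← htc i, Finset.sum_apply]
          rfl
      · intro j F m hm h0 x hx
        funext i
        refine hφ.eq_zero F (fun x => m x i) (fun x => (hm x).1 i) ?_ x hx
        have := congrFun h0 i
        rw [Finset.sum_apply] at this
        exact this
      · intro r m
        funext i
        exact map_mul φ r (m i)

end BaseChange

/-! ### Homogeneous components of linear equations -/

section Internal

variable {k : Type*} [Field k] {R : Type*} [CommRing R] [Algebra k R] {𝒜 : ℕ → Submodule k R}

/-- The ring is the direct sum of the pieces `𝒜 j`. -/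
structure IsInternalGrading (𝒜 : ℕ → Submodule k R) : Prop where
  exists_sum : ∀ r, ∃ (N : ℕ) (c : ℕ → R), (∀ j, c j ∈ 𝒜 j) ∧ r = ∑ j ∈ Finset.range N, c j
  eq_zero : ∀ (N : ℕ) (c : ℕ → R), (∀ j, c j ∈ 𝒜 j) → ∑ j ∈ Finset.range N, c j = 0 →
    ∀ j < N, c j = 0

theorem IsInternalGrading.exists_sum_pi (h : IsInternalGrading 𝒜) {ι : Type*} [Fintype ι]
    (v : ι → R) : ∃ (N : ℕ) (c : ℕ → ι → R), (∀ j i, c j i ∈ 𝒜 j) ∧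
      v = ∑ j ∈ Finset.range N, c j := by
  classical
  choose N c hc hv using fun i => h.exists_sum (v i)
  refine ⟨Finset.univ.sup N, fun j i => if j < N i then c i j else 0, ?_, ?_⟩
  · intro j i
    show (if j < N i then c i j else 0) ∈ 𝒜 j
    split_ifs
    exacts [hc i j, zero_mem _]
  · funext i
    rw [hv, Finset.sum_apply, ← Finset.sum_filter]
    congr 1
    ext j
    simp only [Finset.mem_range, Finset.mem_filter]
    exact ⟨fun hj => ⟨hj.trans_le (Finset.le_sup (Finset.mem_univ i)), hj⟩, fun hj => hj.2⟩

/-- Homogeneous components of a solution of a linear system with coefficients of degree `1`. -/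
theorem IsInternalGrading.sum_mul (h𝒜 : IsConnectedGraded 𝒜) (h : IsInternalGrading 𝒜) {ι : Type*}
    [Fintype ι] {x : ι → R} (hx : ∀ i, x i ∈ 𝒜 1) {N : ℕ} {c : ℕ → ι → R} (hc : ∀ j i, c j i ∈ 𝒜 j)
    (h0 : ∑ i, (∑ j ∈ Finset.range N, c j) i * x i = 0) {j : ℕ} (hj : j < N) :
    ∑ i, c j i * x i = 0 := by
  have h1 : ∀ j, ∑ i, c j i * x i ∈ 𝒜 (j + 1) := fun j =>
    sum_mem fun i _ => h𝒜.mul_mem (hc j i) (hx i)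
  -- The coefficients `x i` have degree one, so the `l`-th summand has degree `l + 1`; the family is
  -- shifted by one and starts with zero.
  have h2 := h.eq_zero (N + 1) (fun l => l.casesOn 0 fun j => ∑ i, c j i * x i) ?_ ?_ (j + 1)
    (by omega)
  · exact h2
  · rintro (_ | l)
    exacts [zero_mem _, h1 l]
  · rw [Finset.sum_range_succ']
    refine (add_zero _).trans ?_
    dsimp only
    rw [Finset.sum_comm, ← h0]
    simp only [Finset.sum_apply, Finset.sum_mul]

theorem IsInternalGrading.exists_mul (h𝒜 : IsConnectedGraded 𝒜) (h : IsInternalGrading 𝒜) {ι : Type*}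
    [Fintype ι] {x : ι → R} (hx : ∀ i, x i ∈ 𝒜 1) {j : ℕ} {r : R} (hr : r ∈ 𝒜 (j + 1))
    {v : ι → R} (hv : r = ∑ i, v i * x i) : ∃ c : ι → R, (∀ i, c i ∈ 𝒜 j) ∧ r = ∑ i, c i * x i := by
  classical
  obtain ⟨N, c, hc, rfl⟩ := h.exists_sum_pi v
  have h1 : ∀ l, ∑ i, c l i * x i ∈ 𝒜 (l + 1) := fun j =>
    sum_mem fun i _ => h𝒜.mul_mem (hc j i) (hx i)
  have h3 : (∑ l ∈ Finset.range N, ∑ i, c l i * x i) = r := by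
    rw [hv, Finset.sum_comm]
    simp only [Finset.sum_apply, Finset.sum_mul]
  by_cases hj : j < N
  · have h2 := h.eq_zero (N + 1)
      (fun l => l.casesOn 0 fun l => (∑ i, c l i * x i) - if l = j then r else 0) ?_ ?_ (j + 1)
      (by omega)
    · refine ⟨c j, hc j, ?_⟩
      exact (sub_eq_zero.1 (by simpa using h2)).symm
    · rintro (_ | l)
      · exact zero_mem _
      · refine sub_mem (h1 l) ?_
        split_ifs with hl
        exacts [hl ▸ hr, zero_mem _]
    · rw [Finset.sum_range_succ']
      simp only [Finset.sum_sub_distrib, h3]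
      simp [hj]
  -- Here `v` has no component of degree `j`, so the right hand side has none of degree `j + 1`, and
  -- `r = 0`.
  · refine ⟨0, fun i => zero_mem _, ?_⟩
    have h2 := h.eq_zero (j + 2)
      (fun l => l.casesOn 0 fun l => (if l = j then r else 0) - if l < N then ∑ i, c l i * x i else 0) ?_ ?_ (j + 1)
      (by omega)
    · simpa [hj] using h2
    · rintro (_ | l)
      · exact zero_mem _
      · refine sub_mem ?_ ?_
        · split_ifs with hl
          exacts [hl ▸ hr, zero_mem _]
        · split_ifs
          exacts [h1 l, zero_mem _]
    · rw [Finset.sum_range_succ']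
      simp only [Finset.sum_sub_distrib]
      rw [← Finset.sum_filter (fun l => l < N)]
      have : Finset.filter (fun l => l < N) (Finset.range (j + 1)) = Finset.range N := by
        ext l
        simp only [Finset.mem_filter, Finset.mem_range]
        omega
      rw [this, h3]
      simp

end Internal

end CubicKoszul

namespace CubicKoszul

/-! ### Graded quotients of the polynomial ring -/

section Quotients

variable {K : Type*} [Field K] {n : ℕ}

/-- An ideal of the polynomial ring that contains the homogeneous components of its elements. -/
def IsGradedIdeal (I : Ideal (MvPolynomial (Fin n) K)) : Prop :=
  ∀ g ∈ I, ∀ j, homogeneousComponent j g ∈ I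

theorem mem_gradedPiece {I : Ideal (MvPolynomial (Fin n) K)} {d : ℕ}
    {r : MvPolynomial (Fin n) K ⧸ I} :
    r ∈ gradedPiece I d ↔ ∃ g : MvPolynomial (Fin n) K, g.IsHomogeneous d ∧ Ideal.Quotient.mk I g = r :=
  Iff.rfl

theorem isConnectedGraded_gradedPiece (I : Ideal (MvPolynomial (Fin n) K)) :
    IsConnectedGraded (gradedPiece I) where
  zero_iff := by
    intro x
    rw [mem_gradedPiece]
    constructor
    · rintro ⟨g, hg, rfl⟩
      obtain ⟨c, rfl⟩ : ∃ c, C c = g :=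
        ⟨_, (totalDegree_eq_zero_iff_eq_C.1 ((totalDegree_zero_iff_isHomogeneous _).2 hg)).symm⟩
      exact ⟨c, rfl⟩
    · rintro ⟨c, rfl⟩
      exact ⟨C c, isHomogeneous_C _ _, rfl⟩
  mul_mem := by
    rintro i j _ _ ⟨g, hg, rfl⟩ ⟨h, hh, rfl⟩
    exact ⟨g * h, IsHomogeneous.mul hg hh, map_mul (Ideal.Quotient.mk I) g h⟩

theorem IsGradedIdeal.isInternalGrading {I : Ideal (MvPolynomial (Fin n) K)} (hI : IsGradedIdeal I) :
    IsInternalGrading (gradedPiece I) where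
  exists_sum := by
    intro r
    obtain ⟨g, rfl⟩ := Ideal.Quotient.mk_surjective r
    refine ⟨g.totalDegree + 1, fun j => Ideal.Quotient.mk I (homogeneousComponent j g),
      fun j => ⟨_, homogeneousComponent_isHomogeneous j g, rfl⟩, ?_⟩
    rw [← map_sum, sum_homogeneousComponent]
  eq_zero := by
    intro N c hc h0 j hj
    choose g hg hgc using hc
    have hgc : ∀ j, Ideal.Quotient.mk I (g j) = c j := hgc
    simp only [← hgc, ← map_sum] at h0 ⊢
    rw [Ideal.Quotient.eq_zero_iff_mem] at h0 ⊢
    have := hI _ h0 j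
    rw [map_sum] at this
    rwa [Finset.sum_eq_single j, homogeneousComponent_of_mem (hg j), if_pos rfl] at this
    · intro l _ hl
      rw [homogeneousComponent_of_mem (hg l), if_neg hl.symm]
    · intro h
      exact absurd (Finset.mem_range.2 hj) h

theorem exists_eq_sum_of_isHomogeneous_one {g : MvPolynomial (Fin n) K} (hg : g.IsHomogeneous 1) :
    ∃ c : Fin n → K, g = ∑ i, C (c i) * X i := by
  have h : g ∈ homogeneousSubmodule (Fin n) K 1 := hg
  rw [homogeneousSubmodule_one_eq_span_X, Submodule.mem_span_range_iff_exists_fun] at h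
  obtain ⟨c, rfl⟩ := h
  exact ⟨c, by simp only [smul_eq_C_mul]⟩

theorem gradedPiece_one_eq_span (I : Ideal (MvPolynomial (Fin n) K)) :
    gradedPiece I 1 = Submodule.span K (Set.range fun i => Ideal.Quotient.mk I (X i)) := by
  apply le_antisymm
  · rintro _ ⟨g, hg, rfl⟩
    obtain ⟨c, rfl⟩ := exists_eq_sum_of_isHomogeneous_one hg
    rw [map_sum]
    refine sum_mem fun i _ => ?_
    rw [← smul_eq_C_mul, map_smul]
    exact Submodule.smul_mem _ _ (Submodule.subset_span ⟨i, rfl⟩)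
  · rw [Submodule.span_le]
    rintro _ ⟨i, rfl⟩
    exact ⟨X i, isHomogeneous_X _ _, rfl⟩

instance finiteDimensional_gradedPiece_one (I : Ideal (MvPolynomial (Fin n) K)) :
    FiniteDimensional K (gradedPiece I 1) := by
  rw [gradedPiece_one_eq_span]
  exact FiniteDimensional.span_of_finite K (Set.finite_range _)

theorem gradedPiece_one_le_irrelevantIdeal {I : Ideal (MvPolynomial (Fin n) K)}
    {r : MvPolynomial (Fin n) K ⧸ I} (hr : r ∈ gradedPiece I 1) : r ∈ irrelevantIdeal I := by
  rw [gradedPiece_one_eq_span] at hr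
  exact Submodule.span_le_restrictScalars K (MvPolynomial (Fin n) K ⧸ I) _ hr

end Quotients

/-! ### From linear syzygies to a minimal free resolution -/

section Resolution

variable {K : Type*} [Field K] {n : ℕ} {I : Ideal (MvPolynomial (Fin n) K)}

/-- A graded submodule of a free module, generated by vectors of linear forms, with a linear
free resolution. -/
structure LinearStage (I : Ideal (MvPolynomial (Fin n) K)) where
  rank : ℕ
  gr : ℕ → Submodule K (Fin rank → MvPolynomial (Fin n) K ⧸ I)
  linear : ∀ s, IsLinear (gradedPiece I) s gr
  mem_one : ∀ t ∈ gr 0, ∀ i, t i ∈ gradedPiece I 1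

theorem LinearStage.exists_basis (X : LinearStage I) :
    ∃ (m : ℕ) (b : Fin m → (Fin X.rank → MvPolynomial (Fin n) K ⧸ I)),
      IsGenBasis (gradedPiece I) X.gr b ∧ ∀ s, IsLinear (gradedPiece I) s (syz (gradedPiece I) b) := by
  have h𝒜 := isConnectedGraded_gradedPiece I
  obtain ⟨ι, _, b, hb, -⟩ := X.linear 1
  let e := Fintype.equivFin ι
  have hli : LinearIndependent K (b ∘ e.symm) := hb.li.comp _ e.symm.injective
  have hspan : Submodule.span K (Set.range (b ∘ e.symm)) = X.gr 0 := by
    rw [e.symm.surjective.range_comp]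
    ext m
    rw [Submodule.mem_span_range_iff_exists_fun, hb.mem_zero_iff h𝒜]
  exact ⟨_, b ∘ e.symm, ((X.linear 1).syz_of_basis h𝒜 hli hspan).1,
    fun s => ((X.linear (s + 1)).syz_of_basis h𝒜 hli hspan).2⟩

/-- The number of generators. -/
noncomputable def LinearStage.genCard (X : LinearStage I) : ℕ := X.exists_basis.choose

/-- The generators. -/
noncomputable def LinearStage.gens (X : LinearStage I) :
    Fin X.genCard → (Fin X.rank → MvPolynomial (Fin n) K ⧸ I) := X.exists_basis.choose_spec.choose

theorem LinearStage.isGenBasis (X : LinearStage I) : IsGenBasis (gradedPiece I) X.gr X.gens :=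
  X.exists_basis.choose_spec.choose_spec.1

/-- The module of relations among the generators. -/
noncomputable def LinearStage.next (X : LinearStage I) : LinearStage I where
  rank := X.genCard
  gr := syz (gradedPiece I) X.gens
  linear := X.exists_basis.choose_spec.choose_spec.2
  mem_one := fun _ ht i => ht.1 i

/-- The irrelevant ideal. -/
noncomputable def LinearStage.zero (h : ∀ s, IsLinear (gradedPiece I) s fun j => gradedPiece I (j + 1)) :
    LinearStage I where
  rank := 1
  gr := fun j => Submodule.pi Set.univ fun _ => gradedPiece I (j + 1)
  linear := fun s => (h s).pi (isConnectedGraded_gradedPiece I) (Fin 1)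
  mem_one := fun _ ht i => ht i trivial

/-- The stages of the resolution of the residue field. -/
noncomputable def LinearStage.seq (h : ∀ s, IsLinear (gradedPiece I) s fun j => gradedPiece I (j + 1)) :
    ℕ → LinearStage I
  | 0 => LinearStage.zero h
  | i + 1 => (LinearStage.seq h i).next

/-- The matrix with columns `b c`. -/
noncomputable def columnMatrix {r m : ℕ} (b : Fin m → (Fin r → MvPolynomial (Fin n) K ⧸ I)) :
    Matrix (Fin r) (Fin m) (MvPolynomial (Fin n) K ⧸ I) :=
  Matrix.of fun l c => b c l

theorem mulVecLin_columnMatrix {r m : ℕ} (b : Fin m → (Fin r → MvPolynomial (Fin n) K ⧸ I))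
    (v : Fin m → MvPolynomial (Fin n) K ⧸ I) :
    (columnMatrix b).mulVecLin v = ∑ c, v c • b c := by
  funext r
  simp [Matrix.mulVec, dotProduct, columnMatrix, Finset.sum_apply, mul_comm]

/-- Exactness is known for homogeneous vectors; an arbitrary vector in the kernel is split into
components. The component of degree 0 vanishes because the columns are linearly independent over
`K`. -/
theorem range_columnMatrix_eq_ker (hI : IsGradedIdeal I) {r m l : ℕ}
    {gr : ℕ → Submodule K (Fin r → MvPolynomial (Fin n) K ⧸ I)}
    {b : Fin m → (Fin r → MvPolynomial (Fin n) K ⧸ I)} {c : Fin l → (Fin m → MvPolynomial (Fin n) K ⧸ I)}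
    (hb : IsGenBasis (gradedPiece I) gr b) (hb1 : ∀ t ∈ gr 0, ∀ i, t i ∈ gradedPiece I 1)
    (hc : IsGenBasis (gradedPiece I) (syz (gradedPiece I) b) c) :
    LinearMap.range (columnMatrix c).mulVecLin = LinearMap.ker (columnMatrix b).mulVecLin := by
  have h𝒜 := isConnectedGraded_gradedPiece I
  have hint := hI.isInternalGrading
  apply le_antisymm
  · rintro _ ⟨w, rfl⟩
    rw [LinearMap.mem_ker, mulVecLin_columnMatrix, mulVecLin_columnMatrix]
    have h1 : ∀ x, ∑ l, c x l • b l = 0 := fun x => (hc.mem h𝒜 x).2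
    have h2 : ∀ l, (∑ x, w x • c x) l = ∑ x, w x * c x l := fun l => by
      rw [Finset.sum_apply]; rfl
    simp only [h2, Finset.sum_smul]
    rw [Finset.sum_comm]
    simp only [mul_smul, ← Finset.smul_sum]
    exact Finset.sum_eq_zero fun c _ => by rw [h1, smul_zero]
  · intro v hv
    rw [LinearMap.mem_ker, mulVecLin_columnMatrix] at hv
    obtain ⟨N, d, hd, rfl⟩ := hint.exists_sum_pi v
    have h1 : ∀ j < N, ∑ l, d j l • b l = 0 := by
      intro j hj
      funext r
      have := congrFun hv r
      rw [Finset.sum_apply] at this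
      have h2 := hint.sum_mul h𝒜 (x := fun l => b l r) (fun l => hb1 _ (hb.mem h𝒜 l) r) hd this hj
      rw [Finset.sum_apply]
      exact h2
    refine sum_mem fun j hj => ?_
    have hj := h1 j (Finset.mem_range.1 hj)
    cases j with
    | zero => rw [hb.eq_zero h𝒜 (hd 0) hj]; exact zero_mem _
    | succ j =>
      obtain ⟨t, ht, htc⟩ := (hc.mem_iff j _).1 ⟨hd (j + 1), hj⟩
      exact ⟨t, (mulVecLin_columnMatrix _ _).trans htc⟩

theorem mem_range_columnMatrix_iff {m : ℕ} {b : Fin m → (Fin 1 → MvPolynomial (Fin n) K ⧸ I)}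
    (hb : IsGenBasis (gradedPiece I)
      (fun j => Submodule.pi Set.univ fun _ => gradedPiece I (j + 1)) b)
    (v : Fin 1 → MvPolynomial (Fin n) K ⧸ I) :
    v ∈ LinearMap.range (columnMatrix b).mulVecLin ↔ ∀ j, v j ∈ irrelevantIdeal I := by
  have h𝒜 := isConnectedGraded_gradedPiece I
  constructor
  · rintro ⟨w, rfl⟩ j
    rw [mulVecLin_columnMatrix, Finset.sum_apply]
    exact sum_mem fun c _ =>
      Ideal.mul_mem_left _ _ (gradedPiece_one_le_irrelevantIdeal (hb.mem h𝒜 c j trivial))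
  · intro hv
    let e : (MvPolynomial (Fin n) K ⧸ I) →ₗ[MvPolynomial (Fin n) K ⧸ I]
      (Fin 1 → MvPolynomial (Fin n) K ⧸ I) := LinearMap.pi fun _ => LinearMap.id
    have hle : irrelevantIdeal I ≤ (LinearMap.range (columnMatrix b).mulVecLin).comap e := by
      refine Ideal.span_le.2 ?_
      rintro _ ⟨i, rfl⟩
      obtain ⟨t, ht, hti⟩ := (hb.mem_iff 0
        (fun _ => Ideal.Quotient.mk I (X i))).1 fun _ _ => ⟨X i, isHomogeneous_X _ _, rfl⟩
      exact ⟨t, (mulVecLin_columnMatrix _ _).trans hti⟩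
    have h1 : e (v 0) = v := by
      funext j
      rw [Subsingleton.elim j 0]
      rfl
    have h2 := hle (hv 0)
    rw [Submodule.mem_comap, h1] at h2
    exact h2

/-- If the irrelevant ideal has a linear resolution, the algebra is Koszul. -/
theorem isKoszul_of_isLinear (hI : IsGradedIdeal I)
    (h : ∀ s, IsLinear (gradedPiece I) s fun j => gradedPiece I (j + 1)) : IsKoszul I := by
  have h𝒜 := isConnectedGraded_gradedPiece I
  have hmem : ∀ i c r, (LinearStage.seq h i).gens c r ∈ gradedPiece I 1 := fun i c r =>
    (LinearStage.seq h i).mem_one _ ((LinearStage.seq h i).isGenBasis.mem h𝒜 c) r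
  refine ⟨{
    rank := fun i => (LinearStage.seq h i).rank
    deg := fun i _ => i
    d := fun i => columnMatrix (LinearStage.seq h i).gens
    rank_zero := rfl
    deg_zero := fun _ => rfl
    homogeneous := fun i r c => Or.inr ⟨1, rfl, (hmem i c r)⟩
    minimal := fun i r c => gradedPiece_one_le_irrelevantIdeal (hmem i c r)
    exact_zero := mem_range_columnMatrix_iff (LinearStage.zero h).isGenBasis
    exact_succ := fun i => range_columnMatrix_eq_ker hI (LinearStage.seq h i).isGenBasis
      (LinearStage.seq h i).mem_one (LinearStage.seq h i).next.isGenBasis }, fun i j => rfl⟩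

end Resolution

end CubicKoszul

namespace CubicKoszul

/-! ### Macaulay duality and the trilinear form of a cubic -/

section InverseSystems

variable {K : Type*} [Field K] {n : ℕ}

theorem diffOp_mul_apply (g h f : MvPolynomial (Fin n) K) :
    diffOp K n (g * h) f = diffOp K n g (diffOp K n h f) := by
  rw [map_mul, Module.End.mul_apply]

theorem diffOp_X_apply (i : Fin n) (f : MvPolynomial (Fin n) K) :
    diffOp K n (X i) f = pderiv i f := by rw [diffOp_X]; rfl

theorem diffOp_C_apply (c : K) (f : MvPolynomial (Fin n) K) : diffOp K n (C c) f = c • f := by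
  rw [← algebraMap_eq, AlgHom.commutes]; rfl

theorem mem_inverseSystemIdeal {f g : MvPolynomial (Fin n) K} :
    g ∈ inverseSystemIdeal f ↔ diffOp K n g f = 0 := Iff.rfl

theorem homogeneousSubmodule_add (d e : ℕ) : homogeneousSubmodule (Fin n) K (d + e) =
    homogeneousSubmodule (Fin n) K d * homogeneousSubmodule (Fin n) K e := by
  rw [← homogeneousSubmodule_one_pow _ (d + e), ← homogeneousSubmodule_one_pow _ d,
    ← homogeneousSubmodule_one_pow _ e, pow_add]

theorem diffOp_isHomogeneous {d : ℕ} : ∀ {e : ℕ} {g f : MvPolynomial (Fin n) K}, g.IsHomogeneous d →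
    f.IsHomogeneous (e + d) → (diffOp K n g f).IsHomogeneous e := by
  have h1 : ∀ {e : ℕ} {g f : MvPolynomial (Fin n) K}, g.IsHomogeneous 1 →
      f.IsHomogeneous (e + 1) → (diffOp K n g f).IsHomogeneous e := by
    intro e g f hg hf
    obtain ⟨c, rfl⟩ := exists_eq_sum_of_isHomogeneous_one hg
    rw [map_sum, LinearMap.sum_apply]
    refine IsHomogeneous.sum _ _ _ fun i _ => ?_
    rw [diffOp_mul_apply, diffOp_C_apply, diffOp_X_apply, smul_eq_C_mul]
    exact (IsHomogeneous.pderiv hf).C_mul _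
  induction d with
  | zero =>
    intro e g f hg hf
    obtain ⟨c, rfl⟩ : ∃ c, C c = g :=
      ⟨_, (totalDegree_eq_zero_iff_eq_C.1 ((totalDegree_zero_iff_isHomogeneous _).2 hg)).symm⟩
    rw [diffOp_C_apply, smul_eq_C_mul]
    exact hf.C_mul _
  | succ d ih =>
    intro e g f hg hf
    have hg : g ∈ homogeneousSubmodule (Fin n) K (d + 1) := hg
    rw [homogeneousSubmodule_add] at hg
    refine Submodule.mul_induction_on hg ?_ ?_
    · intro a ha b hb
      rw [diffOp_mul_apply]
      exact ih ha (h1 hb hf)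
    · intro a b ha hb
      rw [map_add, LinearMap.add_apply]
      exact ha.add hb

theorem diffOp_eq_zero_of_lt {d e : ℕ} (hde : e < d) {g f : MvPolynomial (Fin n) K}
    (hg : g.IsHomogeneous d) (hf : f.IsHomogeneous e) : diffOp K n g f = 0 := by
  obtain ⟨l, rfl⟩ := Nat.exists_eq_add_of_lt hde
  have hg : g ∈ homogeneousSubmodule (Fin n) K (e + l + 1) := hg
  -- A factor of degree `e` turns `f` into a constant, which the factor of degree one kills.
  rw [show e + l + 1 = l + (1 + e) by ring, homogeneousSubmodule_add] at hg
  refine Submodule.mul_induction_on hg ?_ ?_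
  · intro a _ b hb
    rw [homogeneousSubmodule_add] at hb
    have : diffOp K n b f = 0 := by
      refine Submodule.mul_induction_on hb ?_ ?_
      · intro a ha b hb
        have h1 : (diffOp K n b f).IsHomogeneous 0 := diffOp_isHomogeneous hb (by simpa using hf)
        obtain ⟨c, hc⟩ : ∃ c, C c = diffOp K n b f :=
          ⟨_, (totalDegree_eq_zero_iff_eq_C.1 ((totalDegree_zero_iff_isHomogeneous _).2 h1)).symm⟩
        obtain ⟨c', rfl⟩ := exists_eq_sum_of_isHomogeneous_one ha
        rw [diffOp_mul_apply, ← hc, map_sum, LinearMap.sum_apply]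
        refine Finset.sum_eq_zero fun i _ => ?_
        rw [diffOp_mul_apply, diffOp_X_apply, pderiv_C, map_zero]
      · intro a b ha hb
        rw [map_add, LinearMap.add_apply, ha, hb, add_zero]
    rw [diffOp_mul_apply, this, map_zero]
  · intro a b ha hb
    rw [map_add, LinearMap.add_apply, ha, hb, add_zero]

/-- The components of `g` of degree at most `d` send `f` to forms of pairwise different degrees, so
these vanish separately; components of larger degree kill `f` anyway. -/
theorem isGradedIdeal_inverseSystemIdeal {d : ℕ} {f : MvPolynomial (Fin n) K}
    (hf : f.IsHomogeneous d) : IsGradedIdeal (inverseSystemIdeal f) := by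
  intro g hg j
  rw [mem_inverseSystemIdeal] at hg ⊢
  by_cases hj : d < j
  · exact diffOp_eq_zero_of_lt hj (homogeneousComponent_isHomogeneous j g) hf
  have hdeg : ∀ i ≤ d, (diffOp K n (homogeneousComponent i g) f).IsHomogeneous (d - i) := fun i hi =>
    diffOp_isHomogeneous (homogeneousComponent_isHomogeneous i g) (by rwa [Nat.sub_add_cancel hi])
  have h0 := congrArg (homogeneousComponent (d - j)) hg
  rw [← sum_homogeneousComponent g, map_sum, LinearMap.sum_apply, map_sum, map_zero] at h0
  by_cases hjg : j < g.totalDegree + 1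
  · rw [Finset.sum_eq_single j] at h0
    · rwa [homogeneousComponent_of_mem (hdeg j (by omega)), if_pos rfl] at h0
    · intro i _ hij
      by_cases hi : d < i
      · rw [diffOp_eq_zero_of_lt hi (homogeneousComponent_isHomogeneous i g) hf, map_zero]
      · rw [homogeneousComponent_of_mem (hdeg i (by omega)), if_neg (by omega)]
    · intro h
      exact absurd (Finset.mem_range.2 hjg) h
  · rw [homogeneousComponent_eq_zero _ _ (by omega), map_zero, LinearMap.zero_apply]

theorem diffOp_map {L : Type*} [Field L] (φ : K →+* L) (g f : MvPolynomial (Fin n) K) :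
    diffOp L n (map φ g) (map φ f) = map φ (diffOp K n g f) := by
  induction g using MvPolynomial.induction_on generalizing f with
  | C a => rw [map_C, diffOp_C_apply, diffOp_C_apply, smul_eq_C_mul, smul_eq_C_mul, map_mul, map_C]
  | add p q hp hq => simp only [map_add, LinearMap.add_apply, hp, hq]
  | mul_X p i hp =>
    rw [map_mul, map_X, diffOp_mul_apply, diffOp_mul_apply, diffOp_X_apply, diffOp_X_apply,
      pderiv_map, hp]

/-- The linear form with coefficients `u`. -/
noncomputable def linForm : (Fin n → K) →ₗ[K] MvPolynomial (Fin n) K :=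
  Fintype.linearCombination K X

theorem linForm_apply (u : Fin n → K) : linForm u = ∑ i, C (u i) * X i := by
  simp only [linForm, Fintype.linearCombination_apply, smul_eq_C_mul]

theorem isHomogeneous_linForm (u : Fin n → K) : (linForm u).IsHomogeneous 1 := by
  rw [linForm_apply]
  exact IsHomogeneous.sum _ _ _ fun i _ => (isHomogeneous_X _ _).C_mul _

theorem exists_linForm_eq {g : MvPolynomial (Fin n) K} (hg : g.IsHomogeneous 1) :
    ∃ u, linForm u = g := by
  obtain ⟨c, rfl⟩ := exists_eq_sum_of_isHomogeneous_one hg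
  exact ⟨c, linForm_apply c⟩

theorem linForm_single [DecidableEq (Fin n)] (i : Fin n) :
    linForm (Pi.single i 1) = (X i : MvPolynomial (Fin n) K) := by
  rw [linForm_apply, Finset.sum_eq_single i] <;> simp +contextual

/-- The functional `g ↦ (g(∂) f)(0)`. -/
noncomputable def trace (f : MvPolynomial (Fin n) K) : MvPolynomial (Fin n) K →ₗ[K] K :=
  lcoeff K 0 ∘ₗ LinearMap.applyₗ f ∘ₗ (diffOp K n).toLinearMap

theorem trace_apply (f g : MvPolynomial (Fin n) K) : trace f g = coeff 0 (diffOp K n g f) := rfl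

/-- The symmetric trilinear form `(u, v, w) ↦ ∂_u ∂_v ∂_w f` at the origin. -/
noncomputable def triForm (f : MvPolynomial (Fin n) K) :
    (Fin n → K) →ₗ[K] (Fin n → K) →ₗ[K] (Fin n → K) →ₗ[K] K :=
  ((LinearMap.mul K (MvPolynomial (Fin n) K)).compl₁₂ linForm linForm).compr₂
    (((LinearMap.mul K (MvPolynomial (Fin n) K)).compl₂ linForm).compr₂ (trace f))

theorem triForm_apply (f : MvPolynomial (Fin n) K) (u v w : Fin n → K) :
    triForm f u v w = trace f (linForm u * linForm v * linForm w) := rfl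

theorem triForm_swap₁ (f : MvPolynomial (Fin n) K) (u v w : Fin n → K) :
    triForm f u v w = triForm f v u w := by
  rw [triForm_apply, triForm_apply, mul_comm (linForm u)]

theorem triForm_swap₂ (f : MvPolynomial (Fin n) K) (u v w : Fin n → K) :
    triForm f u v w = triForm f u w v := by
  rw [triForm_apply, triForm_apply, mul_right_comm]

/-- In characteristic zero a form is detected by all operators of its own degree: by induction all
its partial derivatives vanish, and then Euler's formula makes it zero. -/
theorem diffOp_eq_zero_of_trace {f : MvPolynomial (Fin n) K} [CharZero K] {d e : ℕ}
    (hf : f.IsHomogeneous (e + d)) {g : MvPolynomial (Fin n) K} (hg : g.IsHomogeneous d)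
    (h : ∀ h : MvPolynomial (Fin n) K, h.IsHomogeneous e → trace f (h * g) = 0) :
    diffOp K n g f = 0 := by
  have key : ∀ (e : ℕ) (p : MvPolynomial (Fin n) K), p.IsHomogeneous e →
      (∀ h : MvPolynomial (Fin n) K, h.IsHomogeneous e → coeff 0 (diffOp K n h p) = 0) → p = 0 := by
    intro e
    induction e with
    | zero =>
      intro p hp h
      have := h 1 (isHomogeneous_one _ _)
      rw [map_one, Module.End.one_apply] at this
      rw [totalDegree_eq_zero_iff_eq_C.1 ((totalDegree_zero_iff_isHomogeneous _).2 hp), this, C_0]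
    | succ e ih =>
      intro p hp h
      have h1 : ∀ i, pderiv i p = 0 := by
        intro i
        refine ih _ (IsHomogeneous.pderiv hp) fun q hq => ?_
        rw [← diffOp_X_apply, ← diffOp_mul_apply]
        exact h _ (hq.mul (isHomogeneous_X _ _))
      have h2 := hp.sum_X_mul_pderiv
      simp only [h1, mul_zero, Finset.sum_const_zero] at h2
      exact (smul_eq_zero.1 h2.symm).resolve_left (by omega)
  refine key e _ (diffOp_isHomogeneous hg hf) fun h' hh' => ?_
  rw [← diffOp_mul_apply]
  exact h h' hh'

end InverseSystems

end CubicKoszul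

namespace CubicKoszul

/-! ### Koszul pairs in the algebra of a cubic -/

section KoszulPairOfForm

variable {k : Type*} [Field k] [CharZero k] {n : ℕ} {f : MvPolynomial (Fin n) k}

/-- The class of a linear form in the algebra attached to `f`. -/
noncomputable def linClass (f : MvPolynomial (Fin n) k) :
    (Fin n → k) →ₗ[k] (MvPolynomial (Fin n) k ⧸ inverseSystemIdeal f) :=
  (Ideal.Quotient.mkₐ k (inverseSystemIdeal f)).toLinearMap ∘ₗ linForm

omit [CharZero k] in
theorem linClass_mem (u : Fin n → k) : linClass f u ∈ gradedPiece (inverseSystemIdeal f) 1 :=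
  ⟨linForm u, isHomogeneous_linForm u, rfl⟩

omit [CharZero k] in
theorem exists_linClass_eq {r} (hr : r ∈ gradedPiece (inverseSystemIdeal f) 1) :
    ∃ u, linClass f u = r := by
  obtain ⟨g, hg, rfl⟩ := hr
  obtain ⟨u, rfl⟩ := exists_linForm_eq hg
  exact ⟨u, rfl⟩

/-- The functional induced by `trace f` on the algebra attached to `f`. -/
noncomputable def quotTrace (f : MvPolynomial (Fin n) k) :
    (MvPolynomial (Fin n) k ⧸ inverseSystemIdeal f) →ₗ[k] k :=
  ((inverseSystemIdeal f).restrictScalars k).liftQ (trace f) (by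
    intro g hg
    rw [LinearMap.mem_ker, trace_apply, mem_inverseSystemIdeal.1 hg, coeff_zero]) ∘ₗ
  (Submodule.Quotient.restrictScalarsEquiv k (inverseSystemIdeal f)).symm.toLinearMap

omit [CharZero k] in
theorem quotTrace_mul (u v w : Fin n → k) :
    quotTrace f (linClass f u * linClass f v * linClass f w) = triForm f u v w := rfl

theorem eq_zero_of_quotTrace (hf : f.IsHomogeneous 3) {r}
    (hr : r ∈ gradedPiece (inverseSystemIdeal f) 3) (h : quotTrace f r = 0) : r = 0 := by
  obtain ⟨g, hg, rfl⟩ := hr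
  refine Ideal.Quotient.eq_zero_iff_mem.2 (diffOp_eq_zero_of_trace (e := 0) hf hg ?_)
  intro p hp
  obtain ⟨c, rfl⟩ : ∃ c, C c = p :=
    ⟨_, (totalDegree_eq_zero_iff_eq_C.1 ((totalDegree_zero_iff_isHomogeneous _).2 hp)).symm⟩
  rw [← smul_eq_C_mul, map_smul]
  exact (congrArg (c • ·) h).trans (smul_zero c)

theorem eq_zero_of_quotTrace_mul (hf : f.IsHomogeneous 3) {r}
    (hr : r ∈ gradedPiece (inverseSystemIdeal f) 2) (h : ∀ u, quotTrace f (linClass f u * r) = 0) :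
    r = 0 := by
  obtain ⟨g, hg, rfl⟩ := hr
  refine Ideal.Quotient.eq_zero_iff_mem.2 (diffOp_eq_zero_of_trace (e := 1) hf hg ?_)
  intro p hp
  obtain ⟨u, rfl⟩ := exists_linForm_eq hp
  exact h u

omit [CharZero k] in
theorem eq_zero_of_mem_gradedPiece (hf : f.IsHomogeneous 3) {j : ℕ} (hj : 3 < j) {r}
    (hr : r ∈ gradedPiece (inverseSystemIdeal f) j) : r = 0 := by
  obtain ⟨g, hg, rfl⟩ := hr
  exact Ideal.Quotient.eq_zero_iff_mem.2 (diffOp_eq_zero_of_lt hj hg hf)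

omit [CharZero k] in
theorem mem_gradedPiece_succ {I : Ideal (MvPolynomial (Fin n) k)} {j : ℕ} {r}
    (hr : r ∈ gradedPiece I (j + 1)) : ∃ s : Fin n → _, (∀ i, s i ∈ gradedPiece I j) ∧
      r = ∑ i, s i * Ideal.Quotient.mk I (X i) := by
  obtain ⟨g, hg, rfl⟩ := hr
  have hg : g ∈ homogeneousSubmodule (Fin n) k (j + 1) := hg
  rw [homogeneousSubmodule_add] at hg
  refine Submodule.mul_induction_on hg ?_ ?_
  · intro a ha b hb
    obtain ⟨u, rfl⟩ := exists_linForm_eq hb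
    refine ⟨fun i => Ideal.Quotient.mk I (C (u i) * a), fun i => ⟨_, ha.C_mul _, rfl⟩, ?_⟩
    show Ideal.Quotient.mk I _ = _
    simp only [← map_mul, ← map_sum]
    congr 1
    rw [linForm_apply, Finset.mul_sum]
    exact Finset.sum_congr rfl fun i _ => by ring
  · rintro a b ⟨s, hs, hsa⟩ ⟨t, ht, htb⟩
    refine ⟨s + t, fun i => add_mem (hs i) (ht i), ?_⟩
    rw [map_add, hsa, htb, ← Finset.sum_add_distrib]
    exact Finset.sum_congr rfl fun i _ => (add_mul _ _ _).symm

/-- Duality between the pieces of degree `1` and `2`. -/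
theorem mem_of_forall_quotTrace_mul (hf : f.IsHomogeneous 3)
    {U : Submodule k (MvPolynomial (Fin n) k ⧸ inverseSystemIdeal f)}
    (hU : U ≤ gradedPiece (inverseSystemIdeal f) 2) {r}
    (hr : r ∈ gradedPiece (inverseSystemIdeal f) 2)
    (h : ∀ u, (∀ x ∈ U, quotTrace f (linClass f u * x) = 0) → quotTrace f (linClass f u * r) = 0) :
    r ∈ U := by
  classical
  -- `ρ x` lists the pairings of `x` with the classes of the variables. A functional that separates
  -- `ρ r` from the image of `U` is the pairing with a linear form.
  let ρ : (MvPolynomial (Fin n) k ⧸ inverseSystemIdeal f) →ₗ[k] (Fin n → k) :=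
    LinearMap.pi fun i => quotTrace f ∘ₗ LinearMap.mulLeft k (linClass f (Pi.single i 1))
  have hρ : ∀ u x, ∑ i, u i * ρ x i = quotTrace f (linClass f u * x) := by
    intro u x
    have hu : u = ∑ i, u i • (Pi.single i 1 : Fin n → k) := by
      funext j
      simp [Finset.sum_apply, Pi.single_apply]
    conv_rhs => rw [hu]
    simp only [map_sum, map_smul, Finset.sum_mul, smul_mul_assoc, smul_eq_mul]
    rfl
  by_contra hrU
  have hnot : ρ r ∉ U.map ρ := by
    rintro ⟨x, hx, hxr⟩
    apply hrU
    have : x = r := by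
      rw [← sub_eq_zero]
      refine eq_zero_of_quotTrace_mul hf (sub_mem (hU hx) hr) fun u => ?_
      rw [← hρ, map_sub, hxr, sub_self]
      simp
    exact this ▸ hx
  obtain ⟨φ, hφ, hφU⟩ := Submodule.exists_le_ker_of_notMem hnot
  have hφ' : ∀ w : Fin n → k, ∑ i, φ (Pi.single i 1) * w i = φ w := by
    intro w
    have hw : w = ∑ i, w i • (Pi.single i 1 : Fin n → k) := by
      funext j
      simp [Finset.sum_apply, Pi.single_apply]
    conv_rhs => rw [hw]
    simp only [map_sum, map_smul, smul_eq_mul, mul_comm]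
  refine hφ ?_
  rw [← hφ', hρ]
  refine h _ fun x hx => ?_
  rw [← hρ, hφ']
  exact LinearMap.mem_ker.1 (hφU ⟨x, hx, rfl⟩)

omit [CharZero k] in
theorem linClass_eq_zero
    (hnd : ∀ u, (∀ v w, triForm f u v w = 0) → u = 0) {u : Fin n → k} (hu : linClass f u = 0) :
    u = 0 := by
  refine hnd u fun v w => ?_
  rw [← quotTrace_mul, hu, zero_mul, zero_mul, map_zero]

theorem linClass_mul_eq_zero_iff (hf : f.IsHomogeneous 3) {u v : Fin n → k} :
    linClass f u * linClass f v = 0 ↔ ∀ w, triForm f u v w = 0 := by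
  constructor
  · intro h w
    rw [← quotTrace_mul, h, zero_mul, map_zero]
  · intro h
    refine eq_zero_of_quotTrace_mul hf ((isConnectedGraded_gradedPiece _).mul_mem
      (linClass_mem u) (linClass_mem v)) fun w => ?_
    rw [mul_comm, quotTrace_mul, h]

/-- A sufficient criterion for a Koszul pair in terms of the trilinear form. -/
theorem isKoszulPair_of_triForm (hf : f.IsHomogeneous 3)
    (hnd : ∀ u, (∀ v w, triForm f u v w = 0) → u = 0) {p q : Fin n → k} (hp : p ≠ 0)
    (h1 : ∀ u, (∀ l, (∀ v, triForm f p l v = 0) → ∀ v, triForm f u l v = 0) → ∃ c : k, u = c • p)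
    (h2 : ∃ l, l ≠ 0 ∧ ∀ v, triForm f p l v = 0)
    (h3 : ∀ l, (∀ v, triForm f p l v = 0) → triForm f q q l = 0)
    (h4 : ∀ l, (∀ v, triForm f p l v = 0) → (∀ v, triForm f q l v = 0) → l = 0)
    (h5 : ∀ u, (∀ l, (∀ v, triForm f p l v = 0) → triForm f u q l = 0) →
      ∃ c d : k, u = c • p + d • q) :
    IsKoszulPair (gradedPiece (inverseSystemIdeal f)) (linClass f p) (linClass f q) := by
  have h𝒜 := isConnectedGraded_gradedPiece (inverseSystemIdeal f)
  have hint := (isGradedIdeal_inverseSystemIdeal hf).isInternalGrading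
  have hmulsub : ∀ y ∈ gradedPiece (inverseSystemIdeal f) 1,
      (gradedPiece (inverseSystemIdeal f) 1).map (LinearMap.mulLeft k y) ≤
        gradedPiece (inverseSystemIdeal f) 2 := by
    rintro y hy _ ⟨s, hs, rfl⟩
    exact h𝒜.mul_mem hy hs
  have hqp : ∀ c : k, q ≠ c • p := by
    rintro c rfl
    obtain ⟨l, hl, hl'⟩ := h2
    refine hl (h4 l hl' fun v => ?_)
    simp [hl']
  -- By duality, a defect of `y R₁ + a R₁` in `R₂` would be a linear form killed by both `y` and
  -- `a`, which `h4` excludes.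
  have htop2 : ∀ {r}, r ∈ gradedPiece (inverseSystemIdeal f) 2 →
      ∃ s ∈ gradedPiece (inverseSystemIdeal f) 1, ∃ t ∈ gradedPiece (inverseSystemIdeal f) 1,
        r = linClass f p * s + linClass f q * t := by
    intro r hr
    have := mem_of_forall_quotTrace_mul hf
      (sup_le (hmulsub _ (linClass_mem p)) (hmulsub _ (linClass_mem q))) hr ?_
    · obtain ⟨_, ⟨s, hs, rfl⟩, _, ⟨t, ht, rfl⟩, hst⟩ := Submodule.mem_sup.1 this
      exact ⟨s, hs, t, ht, hst.symm⟩
    · intro u hu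
      have hu0 : u = 0 := by
        refine h4 u (fun v => ?_) (fun v => ?_)
        · rw [triForm_swap₁, ← quotTrace_mul, mul_assoc]
          exact hu _ (Submodule.mem_sup_left ⟨_, linClass_mem v, rfl⟩)
        · rw [triForm_swap₁, ← quotTrace_mul, mul_assoc]
          exact hu _ (Submodule.mem_sup_right ⟨_, linClass_mem v, rfl⟩)
      rw [hu0, map_zero, zero_mul, map_zero]
  have htop : ∀ {j r}, r ∈ gradedPiece (inverseSystemIdeal f) (j + 2) →
      ∃ s ∈ gradedPiece (inverseSystemIdeal f) (j + 1),
      ∃ t ∈ gradedPiece (inverseSystemIdeal f) (j + 1),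
        r = linClass f p * s + linClass f q * t := by
    intro j
    induction j with
    | zero => exact htop2
    | succ j ih =>
      intro r hr
      obtain ⟨x, hx, rfl⟩ := mem_gradedPiece_succ hr
      choose s hs t ht hst using fun i => ih (hx i)
      refine ⟨∑ i, s i * Ideal.Quotient.mk _ (X i), sum_mem fun i _ => h𝒜.mul_mem (hs i)
        ⟨_, isHomogeneous_X _ i, rfl⟩, ∑ i, t i * Ideal.Quotient.mk _ (X i), sum_mem fun i _ =>
        h𝒜.mul_mem (ht i) ⟨_, isHomogeneous_X _ i, rfl⟩, ?_⟩
      rw [Finset.mul_sum, Finset.mul_sum, ← Finset.sum_add_distrib]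
      refine Finset.sum_congr rfl fun i _ => ?_
      rw [hst i]
      ring
  refine ⟨linClass_mem p, linClass_mem q, fun h => hp (linClass_eq_zero hnd h), ?_, ?_, ?_, ?_,
    ?_, htop, ?_, ?_, ?_⟩
  · intro j r hr hry
    obtain ⟨v, hv⟩ := Ideal.mem_span_singleton'.1 hry
    obtain ⟨c, hc, hcr⟩ := hint.exists_mul h𝒜 (ι := Unit) (x := fun _ => linClass f p)
      (fun _ => linClass_mem p) hr (v := fun _ => v) (by simp [hv])
    exact ⟨c (), hc (), by simpa [mul_comm] using hcr⟩
  · intro j r hr hry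
    obtain ⟨v, w, hvw⟩ := Ideal.mem_span_pair.1 hry
    obtain ⟨c, hc, hcr⟩ := hint.exists_mul h𝒜 (x := ![linClass f p, linClass f q])
      (by
        intro i
        fin_cases i
        exacts [linClass_mem p, linClass_mem q]) hr (v := ![v, w]) (by simp [hvw])
    exact ⟨c 0, hc 0, c 1, hc 1, by simpa [mul_comm] using hcr⟩
  · have := mem_of_forall_quotTrace_mul hf (hmulsub _ (linClass_mem p))
      (h𝒜.mul_mem (linClass_mem q) (linClass_mem q) :) ?_
    · obtain ⟨s, -, hs⟩ := this
      exact Ideal.mem_span_singleton'.2 ⟨s, by rw [← hs, mul_comm]; rfl⟩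
    · intro u hu
      rw [← mul_assoc, quotTrace_mul, triForm_swap₁, triForm_swap₂]
      refine h3 u fun v => ?_
      rw [triForm_swap₁, ← quotTrace_mul, mul_assoc]
      exact hu _ ⟨_, linClass_mem v, rfl⟩
  · intro c hc hac
    obtain ⟨c, rfl⟩ := (h𝒜.zero_iff _).1 hc
    by_contra hne
    have hc0 : c ≠ 0 := by
      rintro rfl
      exact hne (map_zero _)
    obtain ⟨v, hv⟩ := Ideal.mem_span_singleton'.1 hac
    -- For nonzero `c` the class of `q` lies in `(y)`, and by degree it is a scalar multiple of the
    -- class of `p`, contrary to `hqp`.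
    obtain ⟨d, hd, hdr⟩ := hint.exists_mul h𝒜 (j := 0) (ι := Unit) (x := fun _ => linClass f p)
      (fun _ => linClass_mem p) (r := linClass f q) (linClass_mem q)
      (v := fun _ => algebraMap k _ c⁻¹ * v) (by
        simp only [Finset.univ_unique, Finset.sum_const, Finset.card_singleton, one_smul]
        rw [mul_assoc, hv, mul_comm, mul_assoc, ← map_mul, mul_inv_cancel₀ hc0, map_one, mul_one])
    obtain ⟨d', hd'⟩ := (h𝒜.zero_iff _).1 (hd ())
    refine hqp d' (sub_eq_zero.1 (linClass_eq_zero hnd ?_))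
    have hd2 : d' • linClass f p = linClass f p * d () := by
      rw [← hd', mul_comm]
      exact Algebra.smul_def d' (linClass f p)
    rw [map_sub, map_smul, hd2, hdr]
    simp [mul_comm]
  · rintro (_ | j) r hr har
    · obtain ⟨c, rfl⟩ := exists_linClass_eq hr
      obtain ⟨v, hv⟩ := Ideal.mem_span_singleton'.1 har
      obtain ⟨α, β, rfl⟩ := h5 c fun l hl => by
        rw [← quotTrace_mul, mul_comm (linClass f c), ← hv, mul_assoc,
          (linClass_mul_eq_zero_iff hf).2 hl, mul_zero, map_zero]
      refine ⟨algebraMap k _ α, (h𝒜.zero_iff _).2 ⟨_, rfl⟩, algebraMap k _ β,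
        (h𝒜.zero_iff _).2 ⟨_, rfl⟩, ?_⟩
      have hs : ∀ (a : k) (x : _ ⧸ inverseSystemIdeal f), a • x = x * algebraMap k _ a :=
        fun a x => (Algebra.smul_def a x).trans (mul_comm _ _)
      rw [map_add, map_smul, map_smul, hs, hs]
    · exact htop hr
  · intro j r hr hyr
    -- The degree of `r` is `j + 1`. Degree 1 is trivial, degree 2 is dual to `h1`, the piece of
    -- degree 3 is spanned by one product with a linear form `l` killed by `y`, and higher pieces
    -- vanish.
    rcases j with _ | _ | _ | j
    · exact Submodule.subset_span ⟨1, (h𝒜.zero_iff _).2 ⟨1, map_one _⟩, r, hr, hyr, one_mul _⟩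
    · refine mem_of_forall_quotTrace_mul hf ?_ hr ?_
      · rw [Submodule.span_le]
        rintro _ ⟨s, hs, l, hl, -, rfl⟩
        exact h𝒜.mul_mem hs hl
      · intro u hu
        obtain ⟨c, rfl⟩ := h1 u fun l hl v => by
          rw [triForm_swap₂, ← quotTrace_mul, mul_assoc]
          exact hu _ (Submodule.subset_span ⟨_, linClass_mem v, _, linClass_mem l,
            (linClass_mul_eq_zero_iff hf).2 hl, rfl⟩)
        rw [map_smul, smul_mul_assoc, hyr, smul_zero, map_zero]
    · obtain ⟨l, hl0, hl⟩ := h2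
      obtain ⟨v, w, hvw⟩ : ∃ v w, triForm f l v w ≠ 0 := by
        by_contra! h
        exact hl0 (hnd l h)
      have hmem : linClass f v * linClass f w * linClass f l ∈ gradedPiece (inverseSystemIdeal f) 3 :=
        h𝒜.mul_mem (h𝒜.mul_mem (linClass_mem v) (linClass_mem w)) (linClass_mem l)
      have htr : quotTrace f (linClass f v * linClass f w * linClass f l) = triForm f l v w := by
        rw [quotTrace_mul, triForm_swap₂, triForm_swap₁]
      have : r = (quotTrace f r / triForm f l v w) • (linClass f v * linClass f w * linClass f l) := by
        rw [← sub_eq_zero]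
        refine eq_zero_of_quotTrace hf (sub_mem hr (Submodule.smul_mem _ _ hmem)) ?_
        rw [map_sub, map_smul, htr, smul_eq_mul, div_mul_cancel₀ _ hvw, sub_self]
      rw [this]
      refine Submodule.smul_mem _ _ (Submodule.subset_span ⟨_, h𝒜.mul_mem (linClass_mem v)
        (linClass_mem w), _, linClass_mem l, (linClass_mul_eq_zero_iff hf).2 hl, rfl⟩)
    · rw [eq_zero_of_mem_gradedPiece hf (by omega) hr]
      exact zero_mem _
  · intro l hl hyl hal
    obtain ⟨u, rfl⟩ := exists_linClass_eq hl
    rw [h4 u ((linClass_mul_eq_zero_iff hf).1 hyl) ((linClass_mul_eq_zero_iff hf).1 hal), map_zero]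
  · intro j m hm hym ham
    -- The degree of `m` is `j + 2`. Degree 2 is dual to `h5`; in degree 3 the element is a multiple
    -- of a nonzero product `a l v` with `y l = 0`; higher pieces vanish.
    rcases j with _ | _ | j
    · have := mem_of_forall_quotTrace_mul hf (U := (gradedPiece (inverseSystemIdeal f) 1 ⊓
        LinearMap.ker (LinearMap.mulLeft k (linClass f p))).map (LinearMap.mulLeft k (linClass f q)))
        ?_ hm ?_
      · obtain ⟨m', ⟨h6, h7⟩, h8⟩ := this
        exact ⟨m', h6, h7, h8.symm⟩
      · exact (Submodule.map_mono inf_le_left).trans (hmulsub _ (linClass_mem q))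
      · intro u hu
        obtain ⟨c, d, rfl⟩ := h5 u fun l hl => by
          rw [← quotTrace_mul, mul_assoc]
          exact hu _ ⟨_, ⟨linClass_mem l, (linClass_mul_eq_zero_iff hf).2 hl⟩, rfl⟩
        rw [map_add, map_smul, map_smul, add_mul, smul_mul_assoc, smul_mul_assoc, hym, ham]
        simp
    · obtain ⟨l, hl0, hl⟩ := h2
      obtain ⟨v, hv⟩ : ∃ v, triForm f q l v ≠ 0 := by
        by_contra! h
        exact hl0 (h4 l hl h)
      have hmem : linClass f q * linClass f l * linClass f v ∈ gradedPiece (inverseSystemIdeal f) 3 :=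
        h𝒜.mul_mem (h𝒜.mul_mem (linClass_mem q) (linClass_mem l)) (linClass_mem v)
      refine ⟨(quotTrace f m / triForm f q l v) • (linClass f l * linClass f v),
        Submodule.smul_mem _ _ (h𝒜.mul_mem (linClass_mem l) (linClass_mem v)), ?_, ?_⟩
      · rw [mul_smul_comm, ← mul_assoc, (linClass_mul_eq_zero_iff hf).2 hl, zero_mul, smul_zero]
      · rw [mul_smul_comm, ← mul_assoc, ← sub_eq_zero]
        refine eq_zero_of_quotTrace hf (sub_mem hm (Submodule.smul_mem _ _ hmem)) ?_
        rw [map_sub, map_smul, quotTrace_mul, smul_eq_mul, div_mul_cancel₀ _ hv, sub_self]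
    · rw [eq_zero_of_mem_gradedPiece hf (by omega) hm]
      exact ⟨0, zero_mem _, by simp, by simp⟩

end KoszulPairOfForm

end CubicKoszul

namespace CubicKoszul

open Module

/-! ### Symmetric bilinear forms of small rank -/

section BilinearForms

variable {k V : Type*} [Field k] [AddCommGroup V] [Module k V]

/-- All `2 × 2` minors of the bilinear form `S` vanish. -/
def IsRankLEOne (S : V →ₗ[k] V →ₗ[k] k) : Prop :=
  ∀ v w v' w', S v w * S v' w' = S v w' * S v' w

theorem isRankLEOne_of_finrank_ker [FiniteDimensional k V] {S : V →ₗ[k] V →ₗ[k] k}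
    (h : finrank k V ≤ finrank k (LinearMap.ker S) + 1) : IsRankLEOne S := by
  obtain ⟨M, hM⟩ := (LinearMap.ker S).exists_isCompl
  have h1 := Submodule.finrank_add_eq_of_isCompl hM
  obtain ⟨m, hm⟩ := finrank_le_one_iff.1 (show finrank k M ≤ 1 by omega)
  have key : ∀ v, ∃ c : k, S v = c • S m := by
    intro v
    obtain ⟨l, hl, m', hm', rfl⟩ :=
      Submodule.mem_sup.1 (hM.sup_eq_top.symm ▸ Submodule.mem_top : v ∈ _)
    obtain ⟨c, hc⟩ := hm ⟨m', hm'⟩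
    refine ⟨c, ?_⟩
    rw [map_add, LinearMap.mem_ker.1 hl, zero_add, ← map_smul]
    exact congrArg (fun x => S (x : M)) hc.symm
  intro v w v' w'
  obtain ⟨c, hc⟩ := key v
  obtain ⟨d, hd⟩ := key v'
  simp only [hc, hd, LinearMap.smul_apply, smul_eq_mul]
  ring

/-- An eigenvector of `A⁻¹ B`. Applied to bilinear forms, it produces a degenerate member of a
pencil. -/
theorem exists_eq_smul_of_injective [IsAlgClosed k] {M M' : Type*} [AddCommGroup M] [Module k M]
    [FiniteDimensional k M] [Nontrivial M] [AddCommGroup M'] [Module k M'] [FiniteDimensional k M']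
    (h : finrank k M = finrank k M') (A B : M →ₗ[k] M') (hA : Function.Injective A) :
    ∃ t : k, ∃ m, m ≠ 0 ∧ B m = t • A m := by
  let e := LinearEquiv.ofInjectiveOfFinrankEq A hA h
  obtain ⟨t, ht⟩ := Module.End.exists_eigenvalue (e.symm.toLinearMap ∘ₗ B : Module.End k M)
  obtain ⟨m, hm⟩ := ht.exists_hasEigenvector
  refine ⟨t, m, hm.2, ?_⟩
  have := congrArg e hm.apply_eq_smul
  rw [map_smul] at this
  exact (e.apply_symm_apply (B m)).symm.trans this

/-- A quadratic polynomial of nonzero discriminant has a simple root; the second condition says that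
half its derivative does not vanish there. For `γ = 0` the polynomial is linear, and the
discriminant condition makes `β` nonzero. -/
theorem exists_binary_root [IsAlgClosed k] [CharZero k] {α β γ : k} (h : β ^ 2 ≠ α * γ) :
    ∃ c, α + 2 * β * c + γ * c ^ 2 = 0 ∧ β + γ * c ≠ 0 := by
  by_cases hγ : γ = 0
  · subst hγ
    have hβ : β ≠ 0 := by
      rintro rfl
      simp at h
    refine ⟨-α / (2 * β), ?_, by simpa using hβ⟩
    field_simp
    ring
  · obtain ⟨s, hs⟩ := IsAlgClosed.exists_pow_nat_eq (β ^ 2 - α * γ) (n := 2) (by norm_num)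
    refine ⟨(-β + s) / γ, ?_, ?_⟩
    · field_simp
      linear_combination hs
    · rw [mul_div_cancel₀ _ hγ]
      intro h0
      have : s = 0 := by linear_combination h0
      rw [this] at hs
      exact h (by linear_combination -hs)

/-- A complement of the radical has dimension at least two, so it contains a nonzero isotropic
vector; being outside the radical, this vector is not killed by `S`. -/
theorem exists_isotropic [IsAlgClosed k] [CharZero k] [FiniteDimensional k V]
    {S : V →ₗ[k] V →ₗ[k] k} (hs : ∀ v w, S v w = S w v)
    (h : finrank k (LinearMap.ker S) + 2 ≤ finrank k V) : ∃ e, S e e = 0 ∧ S e ≠ 0 := by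
  obtain ⟨M, hM⟩ := (LinearMap.ker S).exists_isCompl
  have h1 := Submodule.finrank_add_eq_of_isCompl hM
  have : 1 < finrank k M := by omega
  obtain ⟨g, hg⟩ := (finrank_pos_iff_exists_ne_zero (R := k) (M := M)).1 (by omega)
  obtain ⟨g', hgg'⟩ := exists_linearIndependent_pair_of_one_lt_finrank this hg
  have key : ∀ e ∈ M, e ≠ 0 → S e ≠ 0 := by
    intro e he he0 hSe
    exact he0 (Submodule.disjoint_def.1 hM.disjoint e hSe he)
  by_cases hγ : S g' g' = 0
  · exact ⟨g', hγ, key _ g'.2 fun h0 => hgg'.ne_zero 1 (Subtype.ext h0)⟩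
  · obtain ⟨s, hs'⟩ := IsAlgClosed.exists_pow_nat_eq (S g g' ^ 2 - S g g * S g' g') (n := 2)
      (by norm_num)
    refine ⟨g + ((-S g g' + s) / S g' g') • g', ?_, key _ (add_mem g.2 (M.smul_mem _ g'.2)) ?_⟩
    · simp only [map_add, map_smul, LinearMap.add_apply, LinearMap.smul_apply, smul_eq_mul]
      rw [hs g' g]
      field_simp
      linear_combination hs'
    · intro h0
      have := LinearIndependent.pair_iff.1 hgg' 1 ((-S g g' + s) / S g' g') (Subtype.ext (by
        simpa using h0))
      exact one_ne_zero this.1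

end BilinearForms

/-! ### Transversal pairs and their dimension counts -/

section TrilinearForms

variable {k V : Type*} [Field k] [CharZero k] [IsAlgClosed k] [AddCommGroup V] [Module k V]
  [FiniteDimensional k V] {T : V →ₗ[k] V →ₗ[k] V →ₗ[k] k}

omit [CharZero k] [IsAlgClosed k] in
theorem finrank_ker_add_two_le (hB : ∀ p, IsRankLEOne (T p) → p = 0) {p : V} (hp : p ≠ 0) :
    finrank k (LinearMap.ker (T p)) + 2 ≤ finrank k V := by
  by_contra h
  exact hp (hB p (isRankLEOne_of_finrank_ker (by omega)))

-- Both `T p` and `T u` descend to the quotient by the kernel of `T p`, which is a plane on which `T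
-- p` is nondegenerate. Some `T (u - t p)` degenerates there, so it has rank at most one, and `u = t
-- p`.
omit [CharZero k] in
theorem exists_eq_smul_of_ker_le (hs₂ : ∀ u v w, T u v w = T u w v)
    (hB : ∀ p, IsRankLEOne (T p) → p = 0) {p : V}
    (hp : finrank k (LinearMap.ker (T p)) + 2 = finrank k V) {u : V}
    (hu : LinearMap.ker (T p) ≤ LinearMap.ker (T u)) : ∃ c : k, u = c • p := by
  obtain ⟨M, hM⟩ := (LinearMap.ker (T p)).exists_isCompl
  have h1 := Submodule.finrank_add_eq_of_isCompl hM
  have : Nontrivial M := nontrivial_of_finrank_pos (R := k) (by omega)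
  have hext : ∀ x y : V, LinearMap.ker (T p) ≤ LinearMap.ker (T x) → (∀ m ∈ M, T x y m = 0) →
      T x y = 0 := by
    intro x y hx hxy
    ext v
    obtain ⟨l, hl, m, hm, rfl⟩ := Submodule.mem_sup.1 (hM.sup_eq_top.symm ▸ Submodule.mem_top : v ∈ _)
    rw [map_add, hxy m hm, hs₂, LinearMap.mem_ker.1 (hx hl)]
    simp
  obtain ⟨t, m, hm, hmt⟩ := exists_eq_smul_of_injective (M := M) (M' := Dual k M)
    (Subspace.dual_finrank_eq).symm ((T p).domRestrict₁₂ M M) ((T u).domRestrict₁₂ M M) (by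
      rw [← LinearMap.ker_eq_bot, LinearMap.ker_eq_bot']
      intro m hm
      have : T p m = 0 := hext p m le_rfl fun m' hm' => LinearMap.congr_fun hm ⟨m', hm'⟩
      exact Subtype.ext (Submodule.disjoint_def.1 hM.disjoint _ this m.2))
  refine ⟨t, sub_eq_zero.1 (hB _ (isRankLEOne_of_finrank_ker ?_))⟩
  have hle : LinearMap.ker (T p) ≤ LinearMap.ker (T (u - t • p)) := by
    intro l hl
    have h2 := LinearMap.mem_ker.1 (hu hl)
    rw [LinearMap.mem_ker] at hl ⊢
    rw [map_sub, map_smul, LinearMap.sub_apply, LinearMap.smul_apply, hl, h2]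
    simp
  have hlt : LinearMap.ker (T p) < LinearMap.ker (T (u - t • p)) := by
    refine lt_of_le_of_ne hle fun h => ?_
    have : (m : V) ∈ LinearMap.ker (T (u - t • p)) := by
      refine hext _ _ hle fun m' hm' => ?_
      have := LinearMap.congr_fun hmt ⟨m', hm'⟩
      simp only [LinearMap.domRestrict₁₂_apply, LinearMap.smul_apply, smul_eq_mul] at this
      simp [this]
    rw [← h] at this
    exact hm (Subtype.ext (Submodule.disjoint_def.1 hM.disjoint _ this m.2))
  have := Submodule.finrank_lt_finrank_of_lt hlt
  omega

/-- The vectors `p`, `q` satisfy the conditions that yield a Koszul pair. -/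
structure IsTransversalPair (T : V →ₗ[k] V →ₗ[k] V →ₗ[k] k) (p q : V) : Prop where
  ne_zero : p ≠ 0
  finrank_ker : finrank k (LinearMap.ker (T p)) + 2 = finrank k V
  isotropic : ∀ l ∈ LinearMap.ker (T p), T q q l = 0
  injective : ∀ l ∈ LinearMap.ker (T p), T q l = 0 → l = 0

-- Let `L` be the kernel of `T p`, of codimension two. Since `l ↦ T q l` is injective on `L`, the
-- transposed map from `V` to the dual of `L` is onto, so its kernel is a plane. This plane contains
-- the independent vectors `p` and `q`.
omit [CharZero k] [IsAlgClosed k] in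
theorem IsTransversalPair.exists_eq_add (hs₁ : ∀ u v w, T u v w = T v u w)
    (hs₂ : ∀ u v w, T u v w = T u w v) {p q : V} (h : IsTransversalPair T p q)
    (h2 : LinearMap.ker (T p) ≠ ⊥)
    {u : V} (hu : ∀ l ∈ LinearMap.ker (T p), T u q l = 0) : ∃ c d : k, u = c • p + d • q := by
  set L := LinearMap.ker (T p)
  let Φ : V →ₗ[k] Dual k L := (T q).domRestrict₂ L
  have hsurj : LinearMap.range Φ = ⊤ := by
    by_contra hne
    obtain ⟨x, hx, hx'⟩ := Submodule.exists_le_ker_of_lt_top _ (lt_top_iff_ne_top.2 hne)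
    obtain ⟨l, rfl⟩ := (Module.evalEquiv k L).surjective x
    suffices h4 : T q l = 0 from hx (by rw [show l = 0 from Subtype.ext (h.injective l l.2 h4), map_zero])
    ext v
    have := hx' ⟨v, rfl⟩
    rw [hs₂]
    exact this
  have h3 := Φ.finrank_range_add_finrank_ker
  rw [hsurj, finrank_top, Subspace.dual_finrank_eq, ← h.finrank_ker] at h3
  have hker : finrank k (LinearMap.ker Φ) = 2 := by
    simpa [L] using h3
  have hmem : ∀ v, v ∈ LinearMap.ker Φ ↔ ∀ l ∈ L, T v q l = 0 := by
    intro v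
    rw [LinearMap.mem_ker]
    constructor
    · intro hv l hl
      rw [hs₁]
      exact LinearMap.congr_fun hv ⟨l, hl⟩
    · intro hv
      ext l
      have := hv l l.2
      rw [hs₁] at this
      exact this
  have hp : p ∈ LinearMap.ker Φ := (hmem p).2 fun l hl => by
    rw [hs₂, LinearMap.mem_ker.1 hl, LinearMap.zero_apply]
  have hq : q ∈ LinearMap.ker Φ := (hmem q).2 h.isotropic
  have hli : LinearIndependent k ![p, q] := by
    rw [LinearIndependent.pair_iff' h.ne_zero]
    rintro c rfl
    obtain ⟨l, hl, hl0⟩ := Submodule.exists_mem_ne_zero_of_ne_bot h2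
    refine hl0 (h.injective l hl ?_)
    rw [map_smul, LinearMap.smul_apply, LinearMap.mem_ker.1 hl, smul_zero]
  have hspan : Submodule.span k {p, q} = LinearMap.ker Φ := by
    refine Submodule.eq_of_le_of_finrank_eq (Submodule.span_le.2 ?_) ?_
    · rintro x (rfl | rfl)
      exacts [hp, hq]
    · rw [hker]
      have := finrank_span_eq_card hli
      rwa [Matrix.range_cons_cons_empty, Fintype.card_fin] at this
  have : u ∈ Submodule.span k {p, q} := hspan ▸ (hmem u).2 hu
  obtain ⟨c, d, hcd⟩ := Submodule.mem_span_pair.1 this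
  exact ⟨c, d, hcd.symm⟩

end TrilinearForms

end CubicKoszul

namespace CubicKoszul

open Module

/-! ### Construction of transversal pairs in dimensions three and four -/

section TransversalPairs

variable {k V : Type*} [Field k] [CharZero k] [IsAlgClosed k] [AddCommGroup V] [Module k V]
  [FiniteDimensional k V] {T : V →ₗ[k] V →ₗ[k] V →ₗ[k] k}

/-- A pencil of forms `T p` has a singular member, say with `T p z = 0`. As its rank is at least
two, its kernel is the line through `z`, and `q` can be any isotropic vector of `T z` outside the
radical. -/
theorem exists_isTransversalPair_three (hV : finrank k V = 3)
    (hs₁ : ∀ u v w, T u v w = T v u w) (hs₂ : ∀ u v w, T u v w = T u w v)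
    (hB : ∀ p, IsRankLEOne (T p) → p = 0) : ∃ p q, IsTransversalPair T p q := by
  obtain ⟨p, z, hp, hz, hpz⟩ : ∃ p z, p ≠ 0 ∧ z ≠ 0 ∧ T p z = 0 := by
    obtain ⟨p, hp⟩ := (finrank_pos_iff_exists_ne_zero (R := k) (M := V)).1 (by omega)
    obtain ⟨p', hpp'⟩ := exists_linearIndependent_pair_of_one_lt_finrank (R := k) (by omega) hp
    by_cases hinj : Function.Injective (T p)
    · have : Nontrivial V := nontrivial_of_finrank_pos (R := k) (by omega)
      obtain ⟨t, z, hz, htz⟩ := exists_eq_smul_of_injective (M' := Dual k V)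
        (Subspace.dual_finrank_eq).symm (T p) (T p') hinj
      refine ⟨p' - t • p, z, fun h => ?_, hz, ?_⟩
      · have := LinearIndependent.pair_iff.1 hpp' (-t) 1 (by rw [← h]; module)
        exact one_ne_zero this.2
      · rw [map_sub, map_smul, LinearMap.sub_apply, htz, LinearMap.smul_apply, sub_self]
    · rw [← LinearMap.ker_eq_bot] at hinj
      obtain ⟨z, hz, hz0⟩ := Submodule.exists_mem_ne_zero_of_ne_bot hinj
      exact ⟨p, z, hp, hz0, hz⟩
  have hker1 : finrank k (LinearMap.ker (T p)) = 1 := by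
    have h1 := finrank_ker_add_two_le hB hp
    have : Nontrivial (LinearMap.ker (T p)) :=
      ⟨⟨z, hpz⟩, 0, fun h => hz (congrArg Subtype.val h)⟩
    have h2 : 0 < finrank k (LinearMap.ker (T p)) := finrank_pos
    omega
  obtain ⟨q, hqz, hq⟩ := exists_isotropic (S := T z) (hs₂ z) (finrank_ker_add_two_le hB hz)
  have hl : ∀ l ∈ LinearMap.ker (T p), ∃ c : k, c • z = l := by
    intro l hl
    obtain ⟨c, hc⟩ := exists_smul_eq_of_finrank_eq_one hker1 (x := ⟨z, hpz⟩)
      (fun h => hz (congrArg Subtype.val h)) ⟨l, hl⟩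
    exact ⟨c, congrArg Subtype.val hc⟩
  refine ⟨p, q, hp, by omega, ?_, ?_⟩
  · intro l hl'
    obtain ⟨c, rfl⟩ := hl l hl'
    rw [map_smul, hs₂, hs₁, hqz, smul_zero]
  · intro l hl' h
    obtain ⟨c, rfl⟩ := hl l hl'
    rw [map_smul] at h
    rcases smul_eq_zero.1 h with h | h
    · rw [h, zero_smul]
    · refine absurd ?_ hq
      ext v
      rw [hs₁, h]

-- All the forms `T l` with `l` in the kernel of `T p` have `p` in their radical, so they live on a
-- complement of `p`. Two independent ones span a pencil with a degenerate member there, and `w` is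
-- in its radical.
omit [CharZero k] in
theorem exists_singular_member (hs₂ : ∀ u v w, T u v w = T u w v) {p : V}
    (hL : ∀ l ∈ LinearMap.ker (T p), T l p = 0) (hV : 2 ≤ finrank k V)
    (h2 : 2 ≤ finrank k (LinearMap.ker (T p))) (hp : p ≠ 0) :
    ∃ z w, T p z = 0 ∧ z ≠ 0 ∧ T z w = 0 ∧ LinearIndependent k ![p, w] := by
  obtain ⟨z, hz⟩ := (finrank_pos_iff_exists_ne_zero (R := k) (M := LinearMap.ker (T p))).1 (by omega)
  obtain ⟨z', hzz'⟩ := exists_linearIndependent_pair_of_one_lt_finrank (R := k) (by omega) hz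
  obtain ⟨M, hM⟩ := (Submodule.span k {p}).exists_isCompl
  have h1 := Submodule.finrank_add_eq_of_isCompl hM
  rw [finrank_span_singleton hp] at h1
  have : Nontrivial M := nontrivial_of_finrank_pos (R := k) (by omega)
  have hind : ∀ m ∈ M, m ≠ 0 → LinearIndependent k ![p, m] := by
    intro m hm hm0
    rw [LinearIndependent.pair_iff' hp]
    rintro c rfl
    exact hm0 (Submodule.disjoint_def.1 hM.disjoint _
      (Submodule.smul_mem _ _ (Submodule.mem_span_singleton_self p)) hm)
  have hext : ∀ x ∈ LinearMap.ker (T p), ∀ y : V, (∀ m ∈ M, T x y m = 0) → T x y = 0 := by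
    intro x hx y hxy
    ext v
    obtain ⟨l, hl, m, hm, rfl⟩ := Submodule.mem_sup.1 (hM.sup_eq_top.symm ▸ Submodule.mem_top : v ∈ _)
    obtain ⟨c, rfl⟩ := Submodule.mem_span_singleton.1 hl
    rw [map_add, hxy m hm, hs₂, map_smul, hL x hx]
    simp
  by_cases hinj : Function.Injective ((T z).domRestrict₁₂ M M)
  · obtain ⟨t, m, hm, htm⟩ := exists_eq_smul_of_injective (M' := Dual k M)
        (Subspace.dual_finrank_eq).symm ((T z).domRestrict₁₂ M M) ((T z').domRestrict₁₂ M M) hinj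
    refine ⟨z' - t • z, m, ?_, fun h => ?_, ?_, hind m m.2 fun h => hm (Subtype.ext h)⟩
    · rw [map_sub, map_smul, LinearMap.mem_ker.1 z.2, LinearMap.mem_ker.1 z'.2]
      simp
    · have := LinearIndependent.pair_iff.1 hzz' (-t) 1 (Subtype.ext (by
        calc -t • (z : V) + (1 : k) • (z' : V) = z' - t • z := by module
          _ = 0 := h))
      exact one_ne_zero this.2
    · refine hext _ ?_ _ fun m' hm' => ?_
      · exact sub_mem z'.2 (Submodule.smul_mem _ _ z.2)
      · have := LinearMap.congr_fun htm ⟨m', hm'⟩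
        simp only [LinearMap.domRestrict₁₂_apply, LinearMap.smul_apply, smul_eq_mul] at this
        simp [this]
  · rw [← LinearMap.ker_eq_bot] at hinj
    obtain ⟨m, hm, hm0⟩ := Submodule.exists_mem_ne_zero_of_ne_bot hinj
    exact ⟨z, m, z.2, fun h => hz (Subtype.ext h), hext z z.2 m fun m' hm' =>
      LinearMap.congr_fun hm ⟨m', hm'⟩, hind m m.2 fun h => hm0 (Subtype.ext h)⟩

theorem exists_hyperbolic_pair {S : V →ₗ[k] V →ₗ[k] k} (hs : ∀ v w, S v w = S w v)
    (h : finrank k (LinearMap.ker S) + 2 ≤ finrank k V) :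
    ∃ e₁ e₂, S e₁ e₁ = 0 ∧ S e₂ e₂ = 0 ∧ S e₁ e₂ = 1 := by
  obtain ⟨e, he, he0⟩ := exists_isotropic hs h
  obtain ⟨g, hg⟩ : ∃ g, S e g ≠ 0 := by
    by_contra! h0
    exact he0 (LinearMap.ext h0)
  refine ⟨e, (S e g)⁻¹ • (g - (S g g / (2 * S e g)) • e), he, ?_, ?_⟩
  · simp only [map_smul, map_sub, LinearMap.smul_apply, LinearMap.sub_apply, smul_eq_mul, he, hs g e]
    field_simp
    ring
  · simp only [map_smul, map_sub, smul_eq_mul, he]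
    field_simp
    ring

omit [FiniteDimensional k V] in
/-- A base point of a pencil of quadrics, on a line of a singular member. -/
theorem isTransversalPair_of_line (hs₁ : ∀ u v w, T u v w = T v u w)
    (hs₂ : ∀ u v w, T u v w = T u w v) {p w z z' e₁ e₂ : V} (hp : p ≠ 0)
    (hker : finrank k (LinearMap.ker (T p)) + 2 = finrank k V)
    (hL : ∀ l ∈ LinearMap.ker (T p), ∃ a b : k, l = a • z + b • z') (hzw : T z w = 0)
    (h1 : T z e₁ e₁ = 0) (h12 : T z e₁ e₂ = 1)
    (hne : T z' e₁ w ^ 2 ≠ T z' e₁ e₁ * T z' w w) : ∃ q, IsTransversalPair T p q := by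
  obtain ⟨c, hc, hc'⟩ := exists_binary_root hne
  have hzw' : ∀ v, T z v w = 0 := fun v => by rw [hs₂, hzw, LinearMap.zero_apply]
  have hz'w : T z' w e₁ = T z' e₁ w := hs₂ _ _ _
  -- The line through `e₁` and `w` lies on the quadric of `z`, so `q` is a base point once it is a
  -- zero of `T z'` on this line. A simple zero is chosen, which gives transversality.
  refine ⟨e₁ + c • w, hp, hker, ?_, ?_⟩
  · intro l hl
    obtain ⟨a, b, rfl⟩ := hL l hl
    rw [hs₂, hs₁]
    simp only [map_add, map_smul, LinearMap.add_apply, LinearMap.smul_apply, smul_eq_mul, hzw, h1,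
      hzw', LinearMap.zero_apply, hz'w]
    linear_combination b * hc
  · intro l hl h
    obtain ⟨a, b, rfl⟩ := hL l hl
    -- Testing against `w` isolates `b` times the nonzero derivative; testing against `e₂` then
    -- isolates `a`.
    have h3 := LinearMap.congr_fun h w
    have h4 := LinearMap.congr_fun h e₂
    rw [hs₁] at h3 h4
    simp only [map_add, map_smul, LinearMap.add_apply, LinearMap.smul_apply, smul_eq_mul, hzw, h12,
      hzw', LinearMap.zero_apply, mul_zero, zero_add, mul_one] at h3 h4
    have hb : b = 0 := by
      rcases mul_eq_zero.1 (show b * (T z' e₁ w + T z' w w * c) = 0 by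
        linear_combination h3) with h | h
      · exact h
      · exact absurd (by linear_combination h) hc'
    simp only [hb, zero_mul, mul_zero, add_zero] at h4
    rw [h4, hb]
    simp

/-- The kernel of `T p` is a pencil of conics on `V/p`. A singular member `z` has rank exactly two:
it is a pair of lines that join the vertex `w` to `e₁` and to `e₂`. If `z'` has nonzero discriminant
on one of the lines, a simple zero there is the required base point. If both discriminants vanish,
`z'` either has `w` in its radical or yields a double line in the pencil, and (R) excludes both. -/
theorem exists_isTransversalPair_four (hV : finrank k V = 4)
    (hs₁ : ∀ u v w, T u v w = T v u w) (hs₂ : ∀ u v w, T u v w = T u w v)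
    (hB : ∀ p, IsRankLEOne (T p) → p = 0) {p : V} (hp : p ≠ 0)
    (hker : finrank k (LinearMap.ker (T p)) = 2) : ∃ q, IsTransversalPair T p q := by
  have hLp : ∀ l ∈ LinearMap.ker (T p), T l p = 0 := fun l hl => by
    ext v
    rw [hs₁, LinearMap.mem_ker.1 hl]
  obtain ⟨z, w, hz, hz0, hzw, hpw⟩ := exists_singular_member hs₂ hLp (by omega) hker.ge hp
  obtain ⟨z', hzz'⟩ := exists_linearIndependent_pair_of_one_lt_finrank (R := k)
    (M := LinearMap.ker (T p)) (x := ⟨z, hz⟩) (by omega) fun h => hz0 (congrArg Subtype.val h)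
  have hL : ∀ l ∈ LinearMap.ker (T p), ∃ a b : k, l = a • z + b • (z' : V) := by
    intro l hl
    have h1 := hzz'.span_eq_top_of_card_eq_finrank (by simp [hker])
    rw [Matrix.range_cons_cons_empty] at h1
    obtain ⟨a, b, hab⟩ := Submodule.mem_span_pair.1 (h1.symm ▸ Submodule.mem_top :
      (⟨l, hl⟩ : LinearMap.ker (T p)) ∈ _)
    exact ⟨a, b, congrArg Subtype.val hab.symm⟩
  have hkz : finrank k (LinearMap.ker (T z)) + 2 ≤ finrank k V := finrank_ker_add_two_le hB hz0
  have hspan : Submodule.span k {p, w} ≤ LinearMap.ker (T z) := by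
    rw [Submodule.span_le]
    rintro x (rfl | rfl)
    exacts [hLp z hz, hzw]
  have hfs : finrank k (Submodule.span k {p, w}) = 2 := by
    have := finrank_span_eq_card hpw
    rwa [Matrix.range_cons_cons_empty, Fintype.card_fin] at this
  have hkz2 : finrank k (LinearMap.ker (T z)) = 2 := by
    have := Submodule.finrank_mono hspan
    omega
  have hspan' := Submodule.eq_of_le_of_finrank_eq hspan (by rw [hfs, hkz2])
  obtain ⟨e₁, e₂, h1, h2, h12⟩ := exists_hyperbolic_pair (hs₂ z) hkz
  by_cases hc1 : T z' e₁ w ^ 2 = T z' e₁ e₁ * T z' w w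
  swap
  · exact isTransversalPair_of_line hs₁ hs₂ hp (by omega) hL hzw h1 h12 hc1
  by_cases hc2 : T z' e₂ w ^ 2 = T z' e₂ e₂ * T z' w w
  swap
  · exact isTransversalPair_of_line hs₁ hs₂ hp (by omega) hL hzw h2 ((hs₂ _ _ _).trans h12) hc2
  exfalso
  have h21 : T z e₂ e₁ = 1 := (hs₂ _ _ _).trans h12
  have hexp : ∀ v, ∃ a b c d : k, v = a • p + b • w + c • e₁ + d • e₂ := by
    have hli : LinearIndependent k ![p, w, e₁, e₂] := by
      rw [Fintype.linearIndependent_iff]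
      intro g hg
      simp only [Fin.sum_univ_four, Matrix.cons_val] at hg
      have h3 := congrArg (fun v => T z v e₁) hg
      have h4 := congrArg (fun v => T z v e₂) hg
      simp only [map_add, map_smul, hLp z hz, hzw, LinearMap.add_apply, LinearMap.smul_apply, h1,
        h12, h21, h2, smul_eq_mul, map_zero, LinearMap.zero_apply, mul_zero, zero_add, mul_one,
        add_zero] at h3 h4
      rw [h3, h4, zero_smul, zero_smul, add_zero, add_zero] at hg
      have h5 := LinearIndependent.pair_iff.1 hpw _ _ hg
      intro i
      fin_cases i
      exacts [h5.1, h5.2, h4, h3]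
    intro v
    have h3 := hli.span_eq_top_of_card_eq_finrank (by simp [hV])
    have hv : v ∈ Submodule.span k (Set.range ![p, w, e₁, e₂]) := h3 ▸ Submodule.mem_top
    obtain ⟨g, hg⟩ := (Submodule.mem_span_range_iff_exists_fun k).1 hv
    exact ⟨g 0, g 1, g 2, g 3, by simpa [Fin.sum_univ_four] using hg.symm⟩
  have hz'p : T z' p = 0 := hLp z' z'.2
  have hz'p' : ∀ v, T z' v p = 0 := fun v => by rw [hs₂, hz'p, LinearMap.zero_apply]
  have hzp' : ∀ v, T z v p = 0 := fun v => by rw [hs₂, hLp z hz, LinearMap.zero_apply]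
  have hzw' : ∀ v, T z v w = 0 := fun v => by rw [hs₂, hzw, LinearMap.zero_apply]
  -- If `T z'` vanishes at the vertex, the vanishing discriminants put `w` in its radical. Then the
  -- radical of `T z` is contained in that of `T z'`, and `z'` is a multiple of `z`.
  by_cases hγ : T z' w w = 0
  · rw [hγ, mul_zero] at hc1 hc2
    have hw : T z' w = 0 := by
      ext v
      obtain ⟨a, b, c, d, rfl⟩ := hexp v
      rw [hs₂]
      simp [hz'p, hγ, (pow_eq_zero_iff two_ne_zero).1 hc1, (pow_eq_zero_iff two_ne_zero).1 hc2]
    obtain ⟨c, hc⟩ := exists_eq_smul_of_ker_le hs₂ hB (p := z) (u := z') (by omega) (by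
      rw [← hspan', Submodule.span_le]
      rintro x (rfl | rfl)
      exacts [hz'p, hw])
    have := LinearIndependent.pair_iff.1 hzz' (-c) 1 (Subtype.ext (by
      push_cast
      rw [hc]
      module))
    exact one_ne_zero this.2
  -- The multiple of `z` only affects the mixed entry at `e₁`, `e₂` and is chosen to make it fit;
  -- the diagonal entries fit by the vanishing discriminants. The result is the square of a linear
  -- form.
  · have key : ∀ x y, T (T z' w w • (z' : V) - (T z' w w * T z' e₁ e₂ - T z' e₁ w * T z' e₂ w) • z) x y =
        T z' x w * T z' y w := by
      intro x y
      obtain ⟨a, b, c, d, rfl⟩ := hexp x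
      obtain ⟨a', b', c', d', rfl⟩ := hexp y
      simp only [map_add, map_smul, map_sub, LinearMap.add_apply, LinearMap.smul_apply,
        LinearMap.sub_apply, smul_eq_mul, hz'p, hz'p', hLp z hz, hzp', hzw, hzw', h1, h2, h12, h21,
        LinearMap.zero_apply, hs₂ z' w e₁, hs₂ z' w e₂, hs₂ z' e₂ e₁]
      linear_combination -(c * c') * hc1 - (d * d') * hc2
    have h0 := hB (T z' w w • (z' : V) - (T z' w w * T z' e₁ e₂ - T z' e₁ w * T z' e₂ w) • z)
        fun v w v' w' => by
      simp only [key]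
      ring
    have := LinearIndependent.pair_iff.1 hzz'
      (-(T z' w w * T z' e₁ e₂ - T z' e₁ w * T z' e₂ w)) (T z' w w) (Subtype.ext (by
      push_cast
      rw [← h0]
      module))
    exact hγ this.2

end TransversalPairs

end CubicKoszul

namespace CubicKoszul

/-! ### The Segre ring and zeros of bilinear maps -/

open Module

/-- An additive retraction that is linear over the subring turns a representation of an element of
`R` by generators of `I` with coefficients in `S` into one with coefficients in `R`. -/
theorem comap_map_eq_of_retract {R S : Type*} [CommRing R] [CommRing S] (i : R →+* S) (ρ : S →+ R)
    (h1 : ∀ r, ρ (i r) = r) (h2 : ∀ r s, ρ (i r * s) = r * ρ s) (I : Ideal R) :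
    (I.map i).comap i = I := by
  refine le_antisymm (fun x hx => ?_) Ideal.le_comap_map
  have key : ∀ y ∈ I.map i, ∀ a, ρ (a * y) ∈ I := by
    intro y hy
    refine Submodule.span_induction (p := fun y _ => ∀ a, ρ (a * y) ∈ I) ?_ ?_ ?_ ?_ hy
    · rintro _ ⟨b, hb, rfl⟩ a
      rw [mul_comm, h2]
      exact I.mul_mem_right _ hb
    · intro a
      rw [mul_zero, map_zero]
      exact I.zero_mem
    · intro x y _ _ hx hy a
      rw [mul_add, map_add]
      exact I.add_mem (hx a) (hy a)
    · intro c x _ hx a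
      rw [smul_eq_mul, ← mul_assoc]
      exact hx _
  simpa [h1] using key _ hx 1

/-- By the previous lemma, extension embeds the ideals of `R` in those of `S`, so ascending chains
stop. -/
theorem isNoetherianRing_of_retract {R S : Type*} [CommRing R] [CommRing S] [IsNoetherianRing S]
    (i : R →+* S) (ρ : S →+ R) (h1 : ∀ r, ρ (i r) = r) (h2 : ∀ r s, ρ (i r * s) = r * ρ s) :
    IsNoetherianRing R := by
  have hmono : StrictMono fun I : Ideal R => I.map i :=
    Monotone.strictMono_of_injective (fun _ _ h => Ideal.map_mono h)
      (Function.LeftInverse.injective (comap_map_eq_of_retract i ρ h1 h2))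
  exact isNoetherian_iff'.2 hmono.wellFoundedGT

section Segre

variable (k : Type*) [Field k] (a b : ℕ)

/-- The weight `1` on the first and `-1` on the second group of variables. -/
def segreWeight : Fin (a + 1) ⊕ Fin (b + 1) → ℤ := Sum.elim 1 (-1)

/-- The polynomials all of whose monomials have the same degree in the two groups of variables. -/
noncomputable def segreRing : Subalgebra k (MvPolynomial (Fin (a + 1) ⊕ Fin (b + 1)) k) where
  carrier := {g | IsWeightedHomogeneous (segreWeight a b) g 0}
  mul_mem' hx hy := by simpa using hx.mul hy
  add_mem' hx hy := (weightedHomogeneousSubmodule k (segreWeight a b) 0).add_mem hx hy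
  algebraMap_mem' r := isWeightedHomogeneous_C _ r

/-- The projection onto the Segre ring. -/
noncomputable def segreProj :
    MvPolynomial (Fin (a + 1) ⊕ Fin (b + 1)) k →+ segreRing k a b where
  toFun g := ⟨weightedHomogeneousComponent (segreWeight a b) 0 g,
    weightedHomogeneousComponent_isWeightedHomogeneous _ _⟩
  map_zero' := Subtype.ext (map_zero _)
  map_add' x y := Subtype.ext (map_add _ x y)

variable {k a b}

theorem segreProj_coe (r : segreRing k a b) : segreProj k a b r = r :=
  Subtype.ext (by
    classical
    exact (weightedHomogeneousComponent_of_mem (m := 0) (n := 0) r.2).trans (if_pos rfl))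

attribute [local instance] MvPolynomial.weightedGradedAlgebra in
theorem segreProj_mul (r : segreRing k a b) (s) :
    segreProj k a b (r * s) = r * segreProj k a b s :=
  Subtype.ext (by
    have := DirectSum.coe_decompose_mul_of_left_mem_zero
      (weightedHomogeneousSubmodule k (segreWeight a b)) (b := s) (j := 0) r.2
    rw [← DirectSum.Decomposition.decompose'_eq] at this
    simp only [weightedDecomposition.decompose'_apply] at this
    exact this)

instance : IsNoetherianRing (segreRing k a b) :=
  isNoetherianRing_of_retract (segreRing k a b).val.toRingHom (segreProj k a b) segreProj_coe
    segreProj_mul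

/-- A nonconstant monomial of bidegree `(d, d)` involves variables of both groups, so it vanishes as
soon as one group is set to zero. -/
theorem eval_eq_constantCoeff {g : MvPolynomial (Fin (a + 1) ⊕ Fin (b + 1)) k}
    (hg : g ∈ segreRing k a b) {x : Fin (a + 1) ⊕ Fin (b + 1) → k}
    (hx : (∀ i, x (Sum.inl i) = 0) ∨ ∀ j, x (Sum.inr j) = 0) : eval x g = constantCoeff g := by
  rw [eval_eq, Finset.sum_eq_single 0]
  · simp [constantCoeff_eq]
  · intro d hd hd0
    have hw : ∑ i, (d (Sum.inl i) : ℤ) = ∑ j, (d (Sum.inr j) : ℤ) := by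
      have := hg (mem_support_iff.1 hd)
      rw [Finsupp.weight_apply, Finsupp.sum_fintype _ _ (by simp), Fintype.sum_sum_type] at this
      simp only [segreWeight, Sum.elim_inl, Sum.elim_inr, Pi.one_apply, Pi.neg_apply,
        nsmul_eq_mul, mul_one, mul_neg, Finset.sum_neg_distrib] at this
      omega
    have hne : ¬((∀ i, d (Sum.inl i) = 0) ∨ ∀ j, d (Sum.inr j) = 0) := by
      intro h
      have hz : ∑ i, (d (Sum.inl i) : ℤ) = 0 ∧ ∑ j, (d (Sum.inr j) : ℤ) = 0 := by
        rcases h with h | h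
        · exact ⟨by simp [h], by rw [← hw]; simp [h]⟩
        · exact ⟨by rw [hw]; simp [h], by simp [h]⟩
      rw [Finset.sum_eq_zero_iff_of_nonneg (by simp), Finset.sum_eq_zero_iff_of_nonneg (by simp)] at hz
      refine hd0 (Finsupp.ext ?_)
      rintro (i | j)
      · exact_mod_cast hz.1 i (Finset.mem_univ _)
      · exact_mod_cast hz.2 j (Finset.mem_univ _)
    push Not at hne
    obtain ⟨⟨i, hi⟩, ⟨j, hj⟩⟩ := hne
    refine mul_eq_zero_of_right _ ?_
    rcases hx with hx | hx
    · exact Finset.prod_eq_zero (Finsupp.mem_support_iff.2 hi) (by rw [hx, zero_pow hi])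
    · exact Finset.prod_eq_zero (Finsupp.mem_support_iff.2 hj) (by rw [hx, zero_pow hj])
  · intro h
    simp [notMem_support_iff.1 h]

/-- The product of a variable of the first and one of the second group. -/
noncomputable def segreMonomial (i : Fin (a + 1)) (j : Fin (b + 1)) : segreRing k a b :=
  ⟨X (Sum.inl i) * X (Sum.inr j), by
    have := (isWeightedHomogeneous_X k (segreWeight a b) (Sum.inl i)).mul
      (isWeightedHomogeneous_X k (segreWeight a b) (Sum.inr j))
    rwa [show segreWeight a b (Sum.inl i) + segreWeight a b (Sum.inr j) = 0 by
      simp [segreWeight]] at this⟩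

theorem coe_segreMonomial (i : Fin (a + 1)) (j : Fin (b + 1)) :
    ((segreMonomial i j : segreRing k a b) : MvPolynomial (Fin (a + 1) ⊕ Fin (b + 1)) k) =
      X (Sum.inl i) * X (Sum.inr j) := rfl

/-- An order of the variables. -/
def segreOrder : Fin (a + 1) ⊕ Fin (b + 1) → ℕ :=
  Sum.elim (Fin.cases (a + b) fun i => i) (Fin.cases (a + b) fun j => a + j)

/-- Setting the first `t` variables to zero. -/
noncomputable def segreKill (t : ℕ) : segreRing k a b →ₐ[k]
    MvPolynomial (Fin (a + 1) ⊕ Fin (b + 1)) k :=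
  (aeval fun j => if segreOrder j < t then 0 else X j).comp (segreRing k a b).val

/-- A variable of order `t` times a variable of index 0 of the other group survives the first `t`
steps and dies in the next one. The two variables of index 0 share the last place `a + b`, which
makes `a + b + 1` steps in all. -/
theorem ker_segreKill_lt {t : ℕ} (ht : t ≤ a + b) :
    RingHom.ker (segreKill t : segreRing k a b →ₐ[k] _) < RingHom.ker (segreKill (t + 1)) := by
  have hle : RingHom.ker (segreKill t : segreRing k a b →ₐ[k] _) ≤
      RingHom.ker (segreKill (t + 1)) := by
    intro g hg
    have h : (segreKill (t + 1) : segreRing k a b →ₐ[k] _) =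
        (aeval fun j => if segreOrder j < t + 1 then 0 else X j).comp (segreKill t) := by
      rw [segreKill, segreKill, ← AlgHom.comp_assoc]
      congr 1
      ext1 j
      by_cases h1 : segreOrder j < t
      · simp [h1, h1.le]
      · simp [h1]
    rw [RingHom.mem_ker] at hg ⊢
    rw [h, AlgHom.comp_apply, hg, map_zero]
  refine lt_of_le_of_ne hle fun heq => ?_
  obtain ⟨i, j, hi, hj, hij⟩ : ∃ (i : Fin (a + 1)) (j : Fin (b + 1)),
      t ≤ segreOrder (a := a) (b := b) (Sum.inl i) ∧ t ≤ segreOrder (a := a) (b := b) (Sum.inr j) ∧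
      (segreOrder (a := a) (b := b) (Sum.inl i) = t ∨ segreOrder (a := a) (b := b) (Sum.inr j) = t) := by
    rcases lt_or_ge t a with h | h
    · exact ⟨Fin.succ ⟨t, h⟩, 0, by simp [segreOrder], by simpa [segreOrder] using ht,
        by simp [segreOrder]⟩
    rcases lt_or_ge t (a + b) with h' | h'
    · exact ⟨0, Fin.succ ⟨t - a, by omega⟩, by simpa [segreOrder] using ht,
        by simp [segreOrder]; omega, by simp [segreOrder]; omega⟩
    · exact ⟨0, 0, by simpa [segreOrder] using ht, by simpa [segreOrder] using ht,
        by simp [segreOrder]; omega⟩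
  let x : segreRing k a b := segreMonomial i j
  have hx : x ∈ RingHom.ker (segreKill (t + 1) : segreRing k a b →ₐ[k] _) := by
    rw [RingHom.mem_ker]
    rcases hij with h | h <;> simp [segreKill, x, h, coe_segreMonomial]
  rw [← heq, RingHom.mem_ker] at hx
  simp [segreKill, x, not_lt.2 hi, not_lt.2 hj, coe_segreMonomial] at hx

theorem le_height_ker_segreKill {t : ℕ} (ht : t ≤ a + b + 1) :
    (t : ℕ∞) ≤ (RingHom.ker (segreKill t : segreRing k a b →ₐ[k] _)).height := by
  induction t with
  | zero => simp
  | succ t ih =>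
    have h1 : (RingHom.ker (segreKill t : segreRing k a b →ₐ[k] _)).IsPrime :=
      RingHom.ker_isPrime _
    have h2 : (RingHom.ker (segreKill (t + 1) : segreRing k a b →ₐ[k] _)).IsPrime :=
      RingHom.ker_isPrime _
    have := Ideal.height_add_one_le_of_lt_of_isPrime (ker_segreKill_lt (k := k) (a := a) (b := b)
      (t := t) (by omega))
    push_cast
    exact (add_le_add_left (ih (by omega)) 1).trans this

/-- A bilinear map to a space of small dimension has a nontrivial zero. -/
theorem exists_bilinear_eq_zero [IsAlgClosed k] {c : ℕ} (hc : c ≤ a + b)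
    (Φ : (Fin (a + 1) → k) →ₗ[k] (Fin (b + 1) → k) →ₗ[k] (Fin c → k)) :
    ∃ u v, u ≠ 0 ∧ v ≠ 0 ∧ Φ u v = 0 := by
  classical
  by_contra! hΦ
  let F : Fin c → segreRing k a b := fun l => ∑ i, ∑ j, algebraMap k _ (Φ (Pi.single i 1) (Pi.single j 1) l) *
    segreMonomial i j
  have hF : ∀ x l, eval x (F l : MvPolynomial (Fin (a + 1) ⊕ Fin (b + 1)) k) =
      Φ (x ∘ Sum.inl) (x ∘ Sum.inr) l := by
    intro x l
    have hu : ∀ {m : ℕ} (u : Fin m → k), u = ∑ i, u i • (Pi.single i 1 : Fin m → k) := by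
      intro m u
      funext j
      simp [Finset.sum_apply, Pi.single_apply]
    conv_rhs => rw [hu (x ∘ Sum.inl), hu (x ∘ Sum.inr)]
    simp only [F, map_sum, map_smul, LinearMap.sum_apply, LinearMap.smul_apply, Finset.sum_apply,
      Pi.smul_apply, smul_eq_mul, AddSubmonoidClass.coe_finsetSum, MulMemClass.coe_mul, map_mul,
      Function.comp_apply, eval_X, Finset.mul_sum, coe_segreMonomial]
    rw [Finset.sum_comm]
    refine Finset.sum_congr rfl fun j _ => Finset.sum_congr rfl fun i _ => ?_
    have : eval x ((algebraMap k (segreRing k a b) (Φ (Pi.single i 1) (Pi.single j 1) l) :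
        segreRing k a b) : MvPolynomial (Fin (a + 1) ⊕ Fin (b + 1)) k) =
        Φ (Pi.single i 1) (Pi.single j 1) l := eval_C _
    rw [this]
    ring
  let I : Ideal (segreRing k a b) := Ideal.span (Set.range F)
  let Q := RingHom.ker (segreKill (a + b + 1) : segreRing k a b →ₐ[k] _)
  have hQ : ∀ g : segreRing k a b, g ∈ Q ↔ constantCoeff (g : MvPolynomial (Fin (a + 1) ⊕ Fin (b + 1)) k) = 0 := by
    intro g
    have hlt : ∀ j, segreOrder (a := a) (b := b) j < a + b + 1 := by
      rintro (i | j)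
      · refine Fin.cases ?_ (fun i => ?_) i
        · simp [segreOrder]
        · simp [segreOrder]; omega
      · refine Fin.cases ?_ (fun j => ?_) j
        · simp [segreOrder]
        · simp [segreOrder]
    have : segreKill (a + b + 1) g = C (constantCoeff (g : MvPolynomial (Fin (a + 1) ⊕ Fin (b + 1)) k)) := by
      simp only [segreKill, hlt, if_true, AlgHom.comp_apply, Subalgebra.val_apply]
      rw [show (fun _ => 0 : Fin (a + 1) ⊕ Fin (b + 1) → MvPolynomial (Fin (a + 1) ⊕ Fin (b + 1)) k)
        = 0 from rfl, aeval_zero]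
      rfl
    rw [RingHom.mem_ker, this, C_eq_zero]
  -- Without nontrivial zeros, the irrelevant ideal `Q` is minimal over an ideal with `c`
  -- generators. Krull's theorem bounds its height by `c`, whereas the chain of kernels gives at
  -- least `a + b + 1`.
  have hmin : Q ∈ I.minimalPrimes := by
    refine ⟨⟨RingHom.ker_isPrime _, ?_⟩, ?_⟩
    · rw [Ideal.span_le]
      rintro _ ⟨l, rfl⟩
      refine (hQ _).2 ?_
      rw [← eval_zero, hF]
      simp
    · rintro P ⟨hP, hIP⟩ - g hg
      have hrad : (g : MvPolynomial (Fin (a + 1) ⊕ Fin (b + 1)) k) ∈ (I.map (segreRing k a b).val.toRingHom).radical := by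
        rw [← vanishingIdeal_zeroLocus_eq_radical (K := k), mem_vanishingIdeal_iff]
        intro x hx
        rw [mem_zeroLocus_iff] at hx
        have h0 : Φ (x ∘ Sum.inl) (x ∘ Sum.inr) = 0 := by
          funext l
          rw [← hF]
          exact hx _ (Ideal.mem_map_of_mem _ (Ideal.subset_span ⟨l, rfl⟩))
        have h1 : (∀ i, x (Sum.inl i) = 0) ∨ ∀ j, x (Sum.inr j) = 0 := by
          by_contra! h
          obtain ⟨⟨i, hi⟩, j, hj⟩ := h
          exact hΦ _ _ (fun h => hi (congrFun h i)) (fun h => hj (congrFun h j)) h0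
        exact (eval_eq_constantCoeff g.2 h1).trans ((hQ g).1 hg)
      obtain ⟨N, hN⟩ := hrad
      refine hP.mem_of_pow_mem N (hIP ?_)
      -- The Nullstellensatz puts a power of `g` in the extension of `I` to the polynomial ring; the
      -- retraction brings it back to `I`.
      rw [← comap_map_eq_of_retract (segreRing k a b).val.toRingHom (segreProj k a b) segreProj_coe
        segreProj_mul I]
      simpa using hN
  have h1 : Q.height ≤ I.spanRank.toENat := Ideal.height_le_spanRank_toENat_of_mem_minimalPrimes _ _ hmin
  have h2 : I.spanRank.toENat ≤ c := by
    refine (Cardinal.toENat.monotone' (Submodule.spanRank_span_le_card _)).trans ?_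
    have : (Set.range F).encard ≤ c := by
      rw [← Set.image_univ]
      exact (Set.encard_image_le _ _).trans (by simp)
    exact this
  have h3 := (le_height_ker_segreKill (k := k) (a := a) (b := b) le_rfl).trans (h1.trans h2)
  norm_cast at h3
  omega

end Segre

end CubicKoszul

namespace CubicKoszul

open Module

/-! ### Webs of quadrics, and transversal pairs in general -/

section ExistsTransversalPair

variable {k : Type*} [Field k] [CharZero k] [IsAlgClosed k]

omit [CharZero k] [IsAlgClosed k] in
theorem eq_sum_smul_single {m : ℕ} (u : Fin m → k) :
    u = ∑ i, u i • (Pi.single i 1 : Fin m → k) := by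
  funext j
  simp [Finset.sum_apply, Pi.single_apply]

/-- A web of symmetric forms in four variables contains one of rank at most two. -/
theorem exists_eq_mul_add_mul
    {T : (Fin 4 → k) →ₗ[k] (Fin 4 → k) →ₗ[k] (Fin 4 → k) →ₗ[k] k}
    (hs₂ : ∀ u v w, T u v w = T u w v) (hT : ∀ p, T p = 0 → p = 0) :
    ∃ p, p ≠ 0 ∧ ∃ φ ψ : (Fin 4 → k) →ₗ[k] k, ∀ x y, T p x y = φ x * ψ y + φ y * ψ x := by
  let H : (Fin 4 → k) →ₗ[k] (Sym2 (Fin 4) → k) :=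
    { toFun := fun p => Sym2.lift ⟨fun i j => T p (Pi.single i 1) (Pi.single j 1), fun i j => hs₂ _ _ _⟩
      map_add' := fun p q => by
        funext s
        induction s with | _ i j => simp
      map_smul' := fun c p => by
        funext s
        induction s with | _ i j => simp }
  let Φ : (Fin 4 → k) →ₗ[k] (Fin 4 → k) →ₗ[k] (Sym2 (Fin 4) → k) :=
    LinearMap.mk₂ k (fun u v => Sym2.lift ⟨fun i j => u i * v j + u j * v i, fun i j => add_comm _ _⟩)
      (by
        intro u u' v
        funext s
        induction s with | _ i j => simp; ring)
      (by
        intro c u v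
        funext s
        induction s with | _ i j => simp; ring)
      (by
        intro u u' v
        funext s
        induction s with | _ i j => simp; ring)
      (by
        intro c u v
        funext s
        induction s with | _ i j => simp; ring)
  have hext : ∀ p (φ ψ : (Fin 4 → k) →ₗ[k] k), (∀ i j, T p (Pi.single i 1) (Pi.single j 1) =
      φ (Pi.single i 1) * ψ (Pi.single j 1) + φ (Pi.single j 1) * ψ (Pi.single i 1)) →
      ∀ x y, T p x y = φ x * ψ y + φ y * ψ x := by
    intro p φ ψ h x y
    have : T p = (LinearMap.mul k k).compl₁₂ φ ψ + ((LinearMap.mul k k).compl₁₂ φ ψ).flip := by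
      refine LinearMap.pi_ext' fun i => LinearMap.ext_ring (LinearMap.pi_ext' fun j => LinearMap.ext_ring ?_)
      simpa using h i j
    rw [this]
    simp
  have hH : Function.Injective H := by
    rw [← LinearMap.ker_eq_bot, LinearMap.ker_eq_bot']
    intro p hp
    refine hT p ?_
    refine LinearMap.ext fun x => LinearMap.ext fun y => ?_
    rw [hext p 0 0 fun i j => by simpa [H] using congrFun hp s(i, j)]
    simp
  -- Symmetric forms in four variables have dimension 10 and the web has dimension 4. The quotient
  -- has dimension `6 = 3 + 3`, just small enough for `exists_bilinear_eq_zero`: some nonzero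
  -- product of two linear forms lies in the web.
  have hfin : finrank k ((Sym2 (Fin 4) → k) ⧸ LinearMap.range H) = 6 := by
    have h1 := Submodule.finrank_quotient_add_finrank (LinearMap.range H)
    rw [LinearMap.finrank_range_of_inj hH, finrank_fintype_fun_eq_card, finrank_fintype_fun_eq_card,
      Sym2.card] at h1
    simp [Nat.choose] at h1
    omega
  let e := (finBasisOfFinrankEq _ _ hfin).equivFun
  obtain ⟨u, v, hu, hv, huv⟩ := exists_bilinear_eq_zero (a := 3) (b := 3) (by norm_num)
    (Φ.compr₂ (e.toLinearMap ∘ₗ (LinearMap.range H).mkQ))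
  have h2 : Φ u v ∈ LinearMap.range H := by
    rw [← Submodule.Quotient.mk_eq_zero]
    exact e.map_eq_zero_iff.1 huv
  obtain ⟨p, hp⟩ := h2
  refine ⟨p, ?_, Fintype.linearCombination k u, Fintype.linearCombination k v, hext p _ _ fun i j => ?_⟩
  -- Otherwise the symmetrised product of `u` and `v` would vanish: at an index with `u i ≠ 0`,
  -- first `2 u i v i = 0` gives `v i = 0`, and then all of `v` vanishes.
  · rintro rfl
    rw [map_zero] at hp
    have h3 : ∀ i j, u i * v j + u j * v i = 0 := fun i j => (congrFun hp s(i, j)).symm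
    obtain ⟨i, hi⟩ := Function.ne_iff.1 hu
    obtain ⟨j, hj⟩ := Function.ne_iff.1 hv
    have h4 : v i = 0 := by
      have := h3 i i
      rw [← two_mul, mul_eq_zero, mul_eq_zero] at this
      simpa [show u i ≠ 0 from hi] using this
    have := h3 i j
    rw [h4, mul_zero, add_zero, mul_eq_zero] at this
    exact this.elim hi hj
  · simpa [H, Φ, Fintype.linearCombination_apply_single] using congrFun hp s(i, j)

theorem exists_isTransversalPair {n : ℕ} (hn : n = 3 ∨ n = 4)
    {T : (Fin n → k) →ₗ[k] (Fin n → k) →ₗ[k] (Fin n → k) →ₗ[k] k}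
    (hs₁ : ∀ u v w, T u v w = T v u w) (hs₂ : ∀ u v w, T u v w = T u w v)
    (hB : ∀ p, IsRankLEOne (T p) → p = 0) : ∃ p q, IsTransversalPair T p q := by
  rcases hn with rfl | rfl
  · exact exists_isTransversalPair_three (by simp) hs₁ hs₂ hB
  · obtain ⟨p, hp, φ, ψ, h⟩ := exists_eq_mul_add_mul hs₂ fun p hp => hB p (by
      intro v w v' w'
      simp [hp])
    refine ⟨p, exists_isTransversalPair_four (by simp) hs₁ hs₂ hB hp ?_⟩
    have h1 := finrank_ker_add_two_le hB hp
    have h2 := (φ.prod ψ).finrank_range_add_finrank_ker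
    have h3 := (LinearMap.range (φ.prod ψ)).finrank_le
    have h4 : LinearMap.ker (φ.prod ψ) ≤ LinearMap.ker (T p) := by
      intro x hx
      obtain ⟨hx1, hx2⟩ := Prod.ext_iff.1 (LinearMap.mem_ker.1 hx)
      refine LinearMap.mem_ker.2 (LinearMap.ext fun y => ?_)
      rw [h]
      simp_all
    have h5 := Submodule.finrank_mono h4
    simp at h1 h2 h3
    omega

theorem exists_isKoszulPair {n : ℕ} (hn : n = 3 ∨ n = 4) {f : MvPolynomial (Fin n) k}
    (hf : f.IsHomogeneous 3) (hB : ∀ p, IsRankLEOne (triForm f p) → p = 0) :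
    ∃ y a, IsKoszulPair (gradedPiece (inverseSystemIdeal f)) y a := by
  have hs₁ := triForm_swap₁ f
  have hs₂ := triForm_swap₂ f
  obtain ⟨p, q, h⟩ := exists_isTransversalPair hn hs₁ hs₂ hB
  have h2 : LinearMap.ker (triForm f p) ≠ ⊥ := by
    intro h0
    have := h.finrank_ker
    rw [h0, finrank_bot, finrank_fin_fun] at this
    omega
  have hmem : ∀ l, (∀ v, triForm f p l v = 0) → l ∈ LinearMap.ker (triForm f p) := fun l hl =>
    LinearMap.ext hl
  refine ⟨_, _, isKoszulPair_of_triForm (p := p) (q := q) hf ?_ h.ne_zero ?_ ?_ ?_ ?_ ?_⟩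
  · intro u hu
    refine hB u fun v w v' w' => ?_
    simp [hu]
  · intro u hu
    exact exists_eq_smul_of_ker_le hs₂ hB h.finrank_ker fun l hl =>
      LinearMap.ext (hu l (LinearMap.congr_fun hl))
  · obtain ⟨l, hl, hl0⟩ := Submodule.exists_mem_ne_zero_of_ne_bot h2
    exact ⟨l, hl0, LinearMap.congr_fun hl⟩
  · exact fun l hl => h.isotropic l (hmem l hl)
  · exact fun l hl hq => h.injective l (hmem l hl) (LinearMap.ext hq)
  · exact fun u hu => h.exists_eq_add hs₁ hs₂ h2 fun l hl => hu l (LinearMap.congr_fun hl)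

end ExistsTransversalPair

end CubicKoszul

namespace CubicKoszul

/-! ### Koszulness over the ground field -/

section BaseChange

variable {K : Type*} [Field K] {n : ℕ} {k : Type*} [Field k] [Algebra K k] {B : Type*}
  (β : Module.Basis B K k)

theorem exists_sum_C_mul_map {g' : MvPolynomial (Fin n) k} {j : ℕ} (hg' : g'.IsHomogeneous j) :
    ∃ (F : Finset B) (g : B → MvPolynomial (Fin n) K), (∀ b, (g b).IsHomogeneous j) ∧
      (∀ b, b ∉ F → g b = 0) ∧ ∑ b ∈ F, C (β b) * map (algebraMap K k) (g b) = g' := by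
  classical
  refine ⟨g'.support.biUnion fun m => (β.repr (coeff m g')).support,
    fun b => ∑ m ∈ g'.support, monomial m (β.repr (coeff m g') b), ?_, ?_, ?_⟩
  · exact fun b => IsHomogeneous.sum _ _ _ fun m hm =>
      isHomogeneous_monomial _ (hg'.degree_eq_sum_deg_support hm).symm
  · intro b hb
    refine Finset.sum_eq_zero fun m hm => ?_
    rw [Finset.mem_biUnion] at hb
    rw [Finsupp.notMem_support_iff.1 fun h => hb ⟨m, hm, h⟩, monomial_zero]
  · simp only [map_sum, map_monomial, Finset.mul_sum, C_mul_monomial]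
    rw [Finset.sum_comm]
    conv_rhs => rw [g'.as_sum]
    refine Finset.sum_congr rfl fun m hm => ?_
    rw [← map_sum (monomial m : k →ₗ[k] MvPolynomial (Fin n) k)]
    congr 1
    conv_rhs => rw [← β.linearCombination_repr (coeff m g')]
    rw [Finsupp.linearCombination_apply, Finsupp.sum]
    refine (Finset.sum_subset (Finset.subset_biUnion_of_mem _ hm) fun b _ hb => ?_).symm.trans ?_
    · rw [Finsupp.notMem_support_iff.1 hb, map_zero, mul_zero]
    · exact Finset.sum_congr rfl fun b _ => by rw [Algebra.smul_def, mul_comm]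

theorem eq_zero_of_sum_C_mul_map {F : Finset B} {g : B → MvPolynomial (Fin n) K}
    (h : ∑ b ∈ F, C (β b) * map (algebraMap K k) (g b) = 0) : ∀ b ∈ F, g b = 0 := by
  intro b hb
  ext m
  have h1 := congrArg (coeff m) h
  simp only [coeff_sum, coeff_C_mul, coeff_map, coeff_zero] at h1
  rw [coeff_zero]
  refine linearIndependent_iff'.1 β.linearIndependent F (fun b => coeff m (g b)) ?_ b hb
  rw [← h1]
  exact Finset.sum_congr rfl fun b _ => by rw [Algebra.smul_def, mul_comm]

variable (k) in
/-- Extension of scalars for the algebra attached to `f`. -/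
noncomputable def quotBaseChange (f : MvPolynomial (Fin n) K) :
    (MvPolynomial (Fin n) K ⧸ inverseSystemIdeal f) →+*
      (MvPolynomial (Fin n) k ⧸ inverseSystemIdeal (map (algebraMap K k) f)) :=
  Ideal.quotientMap _ (map (algebraMap K k)) (by
    intro g hg
    rw [Ideal.mem_comap, mem_inverseSystemIdeal, diffOp_map, mem_inverseSystemIdeal.1 hg, map_zero])

theorem quotBaseChange_mk (f g : MvPolynomial (Fin n) K) :
    quotBaseChange k f (Ideal.Quotient.mk _ g) = Ideal.Quotient.mk _ (map (algebraMap K k) g) := rfl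

theorem isGradedBaseChange_quotBaseChange (f : MvPolynomial (Fin n) K) :
    IsGradedBaseChange β (gradedPiece (inverseSystemIdeal f))
      (gradedPiece (inverseSystemIdeal (map (algebraMap K k) f)))
      (quotBaseChange k f).toAddMonoidHom where
  smul := by
    intro c m
    obtain ⟨g, rfl⟩ := Ideal.Quotient.mk_surjective m
    show quotBaseChange k f (Ideal.Quotient.mk _ (c • g)) =
      Ideal.Quotient.mk _ (algebraMap K k c • map (algebraMap K k) g)
    rw [quotBaseChange_mk, smul_eq_C_mul, smul_eq_C_mul, map_mul, map_C]
  mem := by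
    rintro j _ ⟨g, hg, rfl⟩
    exact ⟨map (algebraMap K k) g, IsHomogeneous.map hg _, rfl⟩
  exists_sum := by
    rintro j _ ⟨g', hg', rfl⟩
    obtain ⟨F, g, hg, hgF, h⟩ := exists_sum_C_mul_map β hg'
    refine ⟨F, fun b => Ideal.Quotient.mk _ (g b), fun b => ⟨g b, hg b, rfl⟩, fun b hb => ?_, ?_⟩
    · show Ideal.Quotient.mk _ (g b) = 0
      rw [hgF b hb, map_zero]
    · rw [← h, AlgHom.toLinearMap_apply, map_sum]
      refine Finset.sum_congr rfl fun b _ => ?_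
      rw [← smul_eq_C_mul]
      rfl
  eq_zero := by
    intro j F m hm h0 b hb
    choose g hg hgm using hm
    have hgm : ∀ b, Ideal.Quotient.mk _ (g b) = m b := hgm
    rw [← hgm, Ideal.Quotient.eq_zero_iff_mem, mem_inverseSystemIdeal]
    refine eq_zero_of_sum_C_mul_map β (F := F) (g := fun b => diffOp K n (g b) f) ?_ b hb
    have h1 : Ideal.Quotient.mk (inverseSystemIdeal (map (algebraMap K k) f))
        (∑ b ∈ F, β b • map (algebraMap K k) (g b)) = 0 := by
      rw [← h0, map_sum]
      refine Finset.sum_congr rfl fun b _ => ?_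
      rw [← hgm]
      rfl
    rw [Ideal.Quotient.eq_zero_iff_mem, mem_inverseSystemIdeal, map_sum, LinearMap.sum_apply] at h1
    rw [← h1]
    refine Finset.sum_congr rfl fun b _ => ?_
    rw [map_smul, LinearMap.smul_apply, diffOp_map, smul_eq_C_mul]

theorem isKoszul_of_isRankLEOne [CharZero K] [IsAlgClosed k] (hn : n = 3 ∨ n = 4)
    {f : MvPolynomial (Fin n) K} (hf : f.IsHomogeneous 3)
    (hB : ∀ p, IsRankLEOne (triForm (map (algebraMap K k) f) p) → p = 0) :
    IsKoszul (inverseSystemIdeal f) := by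
  have : CharZero k := charZero_of_injective_algebraMap (algebraMap K k).injective
  have h𝒜 := isConnectedGraded_gradedPiece (inverseSystemIdeal f)
  obtain ⟨y, a, hya⟩ := exists_isKoszulPair hn (hf.map (algebraMap K k)) hB
  have h𝒜' := isConnectedGraded_gradedPiece (inverseSystemIdeal (map (algebraMap K k) f))
  refine isKoszul_of_isLinear (isGradedIdeal_inverseSystemIdeal hf) fun s => ?_
  have hφ := isGradedBaseChange_quotBaseChange (Module.Basis.ofVectorSpace K k) f
  refine IsLinear.descend h𝒜' h𝒜 (quotBaseChange k f) hφ (gr := fun j => gradedPiece _ (j + 1))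
    (gr' := fun j => gradedPiece _ (j + 1)) (quotBaseChange k f).toAddMonoidHom
    ⟨hφ.smul, hφ.mem, hφ.exists_sum, hφ.eq_zero⟩ ?_ ?_ ?_ (hya.isLinear h𝒜' s)
  · exact fun r m => map_mul (quotBaseChange k f) r m
  · exact finiteDimensional_gradedPiece_one _
  · intro j r hr m hm
    exact (h𝒜.mul_mem hr hm :)

end BaseChange

end CubicKoszul

namespace CubicKoszul

open Module

/-! ### Height of ideals generated by quadrics -/

section Height

variable {K : Type*} [Field K] {n : ℕ}

theorem height_ker_constantCoeff :
    (RingHom.ker (constantCoeff : MvPolynomial (Fin n) K →+* K)).height = n := by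
  let κ : ℕ → (MvPolynomial (Fin n) K →ₐ[K] MvPolynomial (Fin n) K) := fun t =>
    aeval fun j => if (j : ℕ) < t then 0 else X j
  have hpr : ∀ t, (RingHom.ker (κ t)).IsPrime := fun t => RingHom.ker_isPrime _
  have hlt : ∀ t, t < n → RingHom.ker (κ t) < RingHom.ker (κ (t + 1)) := by
    intro t ht
    refine lt_of_le_of_ne (fun g hg => ?_) fun heq => ?_
    · have h : κ (t + 1) = (κ (t + 1)).comp (κ t) := by
        ext1 j
        by_cases h1 : (j : ℕ) < t
        · simp [κ, h1, h1.le]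
        · simp [κ, h1]
      rw [RingHom.mem_ker] at hg ⊢
      rw [h, AlgHom.comp_apply, hg, map_zero]
    · have h1 : (X ⟨t, ht⟩ : MvPolynomial (Fin n) K) ∈ RingHom.ker (κ (t + 1)) := by
        simp [RingHom.mem_ker, κ]
      rw [← heq] at h1
      simp [RingHom.mem_ker, κ] at h1
  have hle : ∀ t, t ≤ n → (t : ℕ∞) ≤ (RingHom.ker (κ t)).height := by
    intro t
    induction t with
    | zero => simp
    | succ t ih =>
      intro ht
      have h1 := hpr t
      have h2 := hpr (t + 1)
      push_cast
      exact (add_le_add_left (ih (by omega)) 1).trans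
        (Ideal.height_add_one_le_of_lt_of_isPrime (hlt t (by omega)))
  have hker : RingHom.ker (κ n) = RingHom.ker (constantCoeff : MvPolynomial (Fin n) K →+* K) := by
    have : κ n = aeval 0 := by
      ext1 j
      simp [κ]
    ext g
    rw [RingHom.mem_ker, RingHom.mem_ker, this, aeval_zero]
    exact C_eq_zero
  have hn := hle n le_rfl
  rw [hker] at hn
  have hprime : (RingHom.ker (constantCoeff : MvPolynomial (Fin n) K →+* K)).IsPrime :=
    RingHom.ker_isPrime _
  refine le_antisymm ?_ hn
  have h3 := Ideal.height_le_ringKrullDim_of_isPrime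
    (I := RingHom.ker (constantCoeff : MvPolynomial (Fin n) K →+* K))
  rw [MvPolynomial.ringKrullDim_of_isNoetherianRing, ringKrullDim_eq_zero_of_field, zero_add,
    Nat.card_fin] at h3
  exact_mod_cast h3

theorem aeval_C_mul_X {k : Type*} [Field k] [Algebra K k] (p : Fin n → k)
    {q : MvPolynomial (Fin n) K} {d : ℕ} (hq : q.IsHomogeneous d) :
    aeval (fun i => Polynomial.C (p i) * Polynomial.X) q =
      Polynomial.C (aeval p q) * Polynomial.X ^ d := by
  conv_lhs => rw [q.as_sum]
  conv_rhs => rw [q.as_sum]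
  rw [map_sum, map_sum, map_sum, Finset.sum_mul]
  refine Finset.sum_congr rfl fun m hm => ?_
  simp only [aeval_monomial, Finsupp.prod, mul_pow, Finset.prod_mul_distrib,
    Finset.prod_pow_eq_pow_sum, map_mul, map_prod, map_pow]
  rw [hq.degree_eq_sum_deg_support hm, mul_assoc]
  rfl

/-- An ideal generated by quadrics has height `n` if and
only if it has no nontrivial geometric zero. -/
theorem height_eq_iff_forall_zero {k : Type*} [Field k] [Algebra K k] [IsAlgClosed k]
    {Q : Set (MvPolynomial (Fin n) K)} (hQ : ∀ q ∈ Q, q.IsHomogeneous 2) :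
    (Ideal.span Q).height = n ↔ ∀ p : Fin n → k, (∀ q ∈ Q, aeval p q = 0) → p = 0 := by
  have hprime : (RingHom.ker (constantCoeff : MvPolynomial (Fin n) K →+* K)).IsPrime :=
    RingHom.ker_isPrime _
  have hle : Ideal.span Q ≤ RingHom.ker (constantCoeff : MvPolynomial (Fin n) K →+* K) := by
    rw [Ideal.span_le]
    intro q hq
    exact (hQ q hq).coeff_eq_zero (by simp)
  constructor
  · intro h p hp
    by_contra hp0
    obtain ⟨i, hi⟩ := Function.ne_iff.1 hp0
    -- Restriction to the line through `p`. Its kernel is a prime containing `Q` and strictly inside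
    -- the irrelevant ideal, so its height is less than `n`.
    let θ : MvPolynomial (Fin n) K →ₐ[K] Polynomial k :=
      aeval fun i => Polynomial.C (p i) * Polynomial.X
    have hθ : ∀ {q : MvPolynomial (Fin n) K} {d}, q.IsHomogeneous d →
        θ q = Polynomial.C (aeval p q) * Polynomial.X ^ d := aeval_C_mul_X p
    have hP : (RingHom.ker θ).IsPrime := RingHom.ker_isPrime _
    have h1 : Ideal.span Q ≤ RingHom.ker θ := by
      rw [Ideal.span_le]
      intro q hq
      rw [SetLike.mem_coe, RingHom.mem_ker, hθ (hQ q hq), hp q hq, map_zero, zero_mul]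
    have h2 : RingHom.ker θ < RingHom.ker (constantCoeff : MvPolynomial (Fin n) K →+* K) := by
      refine lt_of_le_of_ne (fun g hg => ?_) fun heq => ?_
      · have h3 : (algebraMap K k).comp constantCoeff =
            (Polynomial.evalRingHom 0).comp (θ : MvPolynomial (Fin n) K →+* Polynomial k) := by
          ext j
          · simp [θ]
          · simp [θ]
        have h4 := RingHom.congr_fun h3 g
        rw [RingHom.comp_apply, RingHom.comp_apply, RingHom.coe_coe, RingHom.mem_ker.1 hg,
          map_zero] at h4
        exact (map_eq_zero _).1 h4
      · have : (X i : MvPolynomial (Fin n) K) ∈ RingHom.ker θ := by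
          rw [heq]
          simp [RingHom.mem_ker]
        rw [RingHom.mem_ker, hθ (isHomogeneous_X _ i), aeval_X] at this
        simp at this
        exact hi this
    have h3 := Ideal.height_add_one_le_of_lt_of_isPrime h2
    have h4 := Ideal.height_mono h1
    rw [height_ker_constantCoeff] at h3
    rw [h] at h4
    have h5 := (add_le_add_left h4 1).trans h3
    norm_cast at h5
    omega
  · intro h
    have hrad : (Ideal.span Q).radical =
        RingHom.ker (constantCoeff : MvPolynomial (Fin n) K →+* K) := by
      refine le_antisymm (hprime.radical_le_iff.2 hle) ?_
      rw [← vanishingIdeal_zeroLocus_eq_radical (K := k)]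
      intro g hg
      rw [mem_vanishingIdeal_iff]
      intro x hx
      rw [mem_zeroLocus_iff] at hx
      rw [h x fun q hq => hx q (Ideal.subset_span hq), aeval_zero]
      exact congrArg (algebraMap K k) (RingHom.mem_ker.1 hg) |>.trans (map_zero _)
    rw [Ideal.height_eq_inf_minimalPrimes, ← Ideal.radical_minimalPrimes, hrad,
      Ideal.minimalPrimes_eq_subsingleton_self]
    simpa using height_ker_constantCoeff

end Height

/-! ### The Hessian at a point and its 2-minors -/

section Hessian

variable {K : Type*} [Field K] {n : ℕ}

theorem isHomogeneous_hessian {f : MvPolynomial (Fin n) K} (hf : f.IsHomogeneous 3) (i j : Fin n) :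
    (hessian f i j).IsHomogeneous 1 :=
  IsHomogeneous.pderiv (IsHomogeneous.pderiv hf)

theorem coeff_diffOp_linForm {g : MvPolynomial (Fin n) K} (hg : g.IsHomogeneous 1)
    (p : Fin n → K) : coeff 0 (diffOp K n (linForm p) g) = eval p g := by
  classical
  obtain ⟨c, rfl⟩ := exists_linForm_eq hg
  have h1 : ∀ i, coeff 0 (pderiv i (linForm c)) = c i := by
    intro i
    rw [linForm_apply, map_sum, coeff_sum, Finset.sum_eq_single i]
    · simp
    · intro j _ hj
      simp [pderiv_X_of_ne hj]
    · simp
  conv_rhs => rw [linForm_apply]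
  conv_lhs => rw [linForm_apply p]
  rw [map_sum, map_sum, LinearMap.sum_apply, coeff_sum]
  refine Finset.sum_congr rfl fun i _ => ?_
  rw [diffOp_mul_apply, diffOp_C_apply, diffOp_X_apply, coeff_smul, h1, map_mul, eval_C, eval_X,
    smul_eq_mul, mul_comm]

theorem eval_hessian {f : MvPolynomial (Fin n) K} (hf : f.IsHomogeneous 3) (p : Fin n → K)
    (i j : Fin n) : eval p (hessian f i j) = triForm f p (Pi.single i 1) (Pi.single j 1) := by
  rw [triForm_apply, linForm_single, linForm_single, trace_apply, diffOp_mul_apply, diffOp_mul_apply,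
    diffOp_X_apply, diffOp_X_apply, ← coeff_diffOp_linForm (isHomogeneous_hessian hf i j)]
  rfl

theorem linearMap_eq_zero_of_single {M : Type*} [AddCommGroup M] [Module K M]
    (L : (Fin n → K) →ₗ[K] M) (h : ∀ i, L (Pi.single i 1) = 0) (v) : L v = 0 := by
  rw [show L = 0 from LinearMap.pi_ext' fun i => LinearMap.ext_ring (by simpa using h i),
    LinearMap.zero_apply]

/-- The identity is linear in each of its four arguments, so it extends from the standard basis one
argument at a time. -/
theorem isRankLEOne_of_single {S : (Fin n → K) →ₗ[K] (Fin n → K) →ₗ[K] K}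
    (h : ∀ i j i' j', S (Pi.single i 1) (Pi.single j 1) * S (Pi.single i' 1) (Pi.single j' 1) =
      S (Pi.single i 1) (Pi.single j' 1) * S (Pi.single i' 1) (Pi.single j 1)) : IsRankLEOne S := by
  have h1 : ∀ i i' w w', S (Pi.single i 1) w * S (Pi.single i' 1) w' =
      S (Pi.single i 1) w' * S (Pi.single i' 1) w := by
    intro i i' w w'
    have h2 : ∀ j, S (Pi.single i 1) (Pi.single j 1) * S (Pi.single i' 1) w' =
        S (Pi.single i 1) w' * S (Pi.single i' 1) (Pi.single j 1) := by
      intro j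
      have := linearMap_eq_zero_of_single (S (Pi.single i 1) (Pi.single j 1) • S (Pi.single i' 1) -
        S (Pi.single i' 1) (Pi.single j 1) • S (Pi.single i 1)) (fun j' => by
          simp only [LinearMap.sub_apply, LinearMap.smul_apply, smul_eq_mul]
          linear_combination h i j i' j') w'
      simp only [LinearMap.sub_apply, LinearMap.smul_apply, smul_eq_mul] at this
      linear_combination this
    have := linearMap_eq_zero_of_single (S (Pi.single i' 1) w' • S (Pi.single i 1) -
      S (Pi.single i 1) w' • S (Pi.single i' 1)) (fun j => by
        simp only [LinearMap.sub_apply, LinearMap.smul_apply, smul_eq_mul]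
        linear_combination h2 j) w
    simp only [LinearMap.sub_apply, LinearMap.smul_apply, smul_eq_mul] at this
    linear_combination this
  intro v w v' w'
  have h2 : ∀ i, S (Pi.single i 1) w * S v' w' = S (Pi.single i 1) w' * S v' w := by
    intro i
    have := linearMap_eq_zero_of_single (S (Pi.single i 1) w • S.flip w' -
      S (Pi.single i 1) w' • S.flip w) (fun i' => by
        simp only [LinearMap.sub_apply, LinearMap.smul_apply, smul_eq_mul, LinearMap.flip_apply]
        linear_combination h1 i i' w w') v'
    simp only [LinearMap.sub_apply, LinearMap.smul_apply, smul_eq_mul, LinearMap.flip_apply] at this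
    linear_combination this
  have := linearMap_eq_zero_of_single (S v' w' • S.flip w - S v' w • S.flip w') (fun i => by
    simp only [LinearMap.sub_apply, LinearMap.smul_apply, smul_eq_mul, LinearMap.flip_apply]
    linear_combination h2 i) v
  simp only [LinearMap.sub_apply, LinearMap.smul_apply, smul_eq_mul, LinearMap.flip_apply] at this
  linear_combination this

theorem exists_orderEmbedding {i i' : Fin n} (h : i < i') :
    ∃ e : Fin 2 ↪o Fin n, e 0 = i ∧ e 1 = i' :=
  ⟨OrderEmbedding.ofStrictMono ![i, i'] (by
    rw [Fin.strictMono_iff_lt_succ]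
    intro a
    fin_cases a
    exact h), rfl, rfl⟩

theorem isRankLEOne_iff_minors {k : Type*} [Field k] [Algebra K k] {f : MvPolynomial (Fin n) K}
    (hf : f.IsHomogeneous 3) (p : Fin n → k) :
    IsRankLEOne (triForm (map (algebraMap K k) f) p) ↔
      ∀ q ∈ Set.range fun e : (Fin 2 ↪o Fin n) × (Fin 2 ↪o Fin n) =>
        ((hessian f).submatrix e.1 e.2).det, aeval p q = 0 := by
  have hent : ∀ i j, aeval p (hessian f i j) =
      triForm (map (algebraMap K k) f) p (Pi.single i 1) (Pi.single j 1) := by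
    intro i j
    rw [← eval_hessian (hf.map _), hessian, hessian, Matrix.of_apply, Matrix.of_apply, pderiv_map,
      pderiv_map, eval_map]
    rfl
  constructor
  · rintro h _ ⟨⟨e, e'⟩, rfl⟩
    simp only [Matrix.det_fin_two, Matrix.submatrix_apply, map_sub, map_mul, hent]
    rw [h, sub_self]
  · intro h
    have h1 : ∀ i i' j j', i < i' → j < j' → aeval p (hessian f i j) * aeval p (hessian f i' j') =
        aeval p (hessian f i j') * aeval p (hessian f i' j) := by
      intro i i' j j' hi hj
      obtain ⟨e, rfl, rfl⟩ := exists_orderEmbedding hi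
      obtain ⟨e', rfl, rfl⟩ := exists_orderEmbedding hj
      have := h _ ⟨(e, e'), rfl⟩
      simp only [Matrix.det_fin_two, Matrix.submatrix_apply, map_sub, map_mul] at this
      exact sub_eq_zero.1 this
    refine isRankLEOne_of_single fun i j i' j' => ?_
    simp only [← hent]
    -- Minors are indexed by increasing pairs only; exchanging rows or columns changes the sign, and
    -- for equal indices there is nothing to prove.
    rcases lt_trichotomy i i' with hi | rfl | hi <;> rcases lt_trichotomy j j' with hj | rfl | hj
    · exact h1 _ _ _ _ hi hj
    · rfl
    · exact (h1 _ _ _ _ hi hj).symm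
    · exact mul_comm _ _
    · rfl
    · exact mul_comm _ _
    · linear_combination -h1 _ _ _ _ hi hj
    · rfl
    · linear_combination h1 _ _ _ _ hi hj

theorem height_minorsIdeal_eq_iff {k : Type*} [Field k] [Algebra K k] [IsAlgClosed k]
    {f : MvPolynomial (Fin n) K} (hf : f.IsHomogeneous 3) :
    (minorsIdeal 2 (hessian f)).height = n ↔
      ∀ p, IsRankLEOne (triForm (map (algebraMap K k) f) p) → p = 0 := by
  rw [minorsIdeal, height_eq_iff_forall_zero (k := k)]
  · exact forall_congr' fun p => by rw [isRankLEOne_iff_minors hf]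
  · rintro _ ⟨⟨e, e'⟩, rfl⟩
    simp only [Matrix.det_fin_two, Matrix.submatrix_apply]
    exact ((isHomogeneous_hessian hf _ _).mul (isHomogeneous_hessian hf _ _)).sub
      ((isHomogeneous_hessian hf _ _).mul (isHomogeneous_hessian hf _ _))

end Hessian

end CubicKoszul

namespace CubicKoszul

open Module

/-! ### Zeros of the quadrics in the ideal of a quadratic or Koszul algebra -/

section QuadricsInTheIdeal

variable {K : Type*} [Field K] {n : ℕ} {k : Type*} [Field k] [Algebra K k]

theorem exists_sum_of_mem_inverseSystemIdeal_map {B : Type*} (β : Basis B K k)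
    {f : MvPolynomial (Fin n) K} {g' : MvPolynomial (Fin n) k} {j : ℕ} (hg' : g'.IsHomogeneous j)
    (h : g' ∈ inverseSystemIdeal (map (algebraMap K k) f)) :
    ∃ (F : Finset B) (g : B → MvPolynomial (Fin n) K), (∀ b, (g b).IsHomogeneous j) ∧
      (∀ b ∈ F, g b ∈ inverseSystemIdeal f) ∧
      ∑ b ∈ F, C (β b) * map (algebraMap K k) (g b) = g' := by
  obtain ⟨F, g, hg, -, rfl⟩ := exists_sum_C_mul_map β hg'
  refine ⟨F, g, hg, ?_, rfl⟩
  refine eq_zero_of_sum_C_mul_map β (F := F) (g := fun b => diffOp K n (g b) f) ?_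
  rw [mem_inverseSystemIdeal, map_sum, LinearMap.sum_apply] at h
  rw [← h]
  refine Finset.sum_congr rfl fun b _ => ?_
  rw [diffOp_mul_apply, diffOp_C_apply, diffOp_map, smul_eq_C_mul]

variable {f : MvPolynomial (Fin n) K}

theorem X_pow_four_mem_inverseSystemIdeal (hf : f.IsHomogeneous 3) (i : Fin n) :
    X i ^ 4 ∈ inverseSystemIdeal f :=
  diffOp_eq_zero_of_lt (by norm_num) (isHomogeneous_X_pow i 4) hf

/-- A common zero of the quadrics is a zero of the whole ideal, which contains the fourth powers of
the variables. -/
theorem IsQuadratic.eq_zero (hf : f.IsHomogeneous 3) (h : IsQuadratic (inverseSystemIdeal f))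
    {l : Fin n → k} (hl : ∀ g ∈ inverseSystemIdeal f, g.IsHomogeneous 2 → aeval l g = 0) :
    l = 0 := by
  obtain ⟨Q, hQ, hI⟩ := h
  have hle : inverseSystemIdeal f ≤ RingHom.ker (aeval l : MvPolynomial (Fin n) K →ₐ[K] k) := by
    rw [hI, Ideal.span_le]
    exact fun q hq => hl q (hI ▸ Ideal.subset_span hq) (hQ q hq)
  funext i
  have := hle (X_pow_four_mem_inverseSystemIdeal hf i)
  rw [RingHom.mem_ker, map_pow, aeval_X] at this
  simpa using this

theorem homogeneousComponent_add_mul {d e : ℕ} {c g : MvPolynomial (Fin n) K}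
    (hc : c.IsHomogeneous d) :
    homogeneousComponent (d + e) (c * g) = c * homogeneousComponent e g := by
  classical
  conv_lhs => rw [← sum_homogeneousComponent g, Finset.mul_sum, map_sum]
  have h : ∀ i, homogeneousComponent (d + e) (c * homogeneousComponent i g) =
      if i = e then c * homogeneousComponent i g else 0 := by
    intro i
    rw [homogeneousComponent_of_mem (hc.mul (homogeneousComponent_isHomogeneous i g))]
    simp [eq_comm]
  simp only [h, Finset.sum_ite_eq', Finset.mem_range]
  split_ifs with h1
  · rfl
  · rw [homogeneousComponent_eq_zero _ _ (by omega), mul_zero]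

theorem exists_eq_sum_X_mul {g : MvPolynomial (Fin n) K} (hg : constantCoeff g = 0) :
    ∃ h : Fin n → MvPolynomial (Fin n) K, g = ∑ i, X i * h i := by
  have : g ∈ Ideal.span (Set.range (X : Fin n → MvPolynomial (Fin n) K)) := by
    rw [← Set.image_univ, mem_ideal_span_X_image]
    intro m hm
    have hm0 : m ≠ 0 := by
      rintro rfl
      exact mem_support_iff.1 hm hg
    obtain ⟨i, hi⟩ := Finsupp.ne_iff.1 hm0
    exact ⟨i, Set.mem_univ _, hi⟩
  obtain ⟨h, hh⟩ := Ideal.mem_span_range_iff_exists_fun.1 this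
  exact ⟨h, by simpa only [mul_comm] using hh.symm⟩

/-- If `K[x]/I` is Koszul, then `I` is generated in degrees `1` and `2` up to `(x₁, …, xₙ) I`. -/
theorem IsKoszul.exists_eq_add {I : Ideal (MvPolynomial (Fin n) K)} (hI : IsGradedIdeal I)
    (hI1 : I ≠ ⊤) (h : IsKoszul I) {g} (hg : g ∈ I) :
    ∃ q ∈ Ideal.span {h | h ∈ I ∧ (h.IsHomogeneous 1 ∨ h.IsHomogeneous 2)},
      ∃ t : Fin n → MvPolynomial (Fin n) K, (∀ i, t i ∈ I) ∧ g = q + ∑ i, X i * t i := by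
  obtain ⟨F, hF⟩ := h
  set J := Ideal.span {h | h ∈ I ∧ (h.IsHomogeneous 1 ∨ h.IsHomogeneous 2)}
  have hd : ∀ i r c, F.d i r c ∈ gradedPiece I 1 := by
    intro i r c
    rcases F.homogeneous i r c with h | ⟨e, he, h⟩
    · rw [h]
      exact zero_mem _
    · rw [hF, hF] at he
      obtain rfl : e = 1 := by omega
      exact h
  choose c hc hcd using hd
  have hcd : ∀ i r l, Ideal.Quotient.mk I (c i r l) = F.d i r l := hcd
  let r₀ : Fin (F.rank 0) := ⟨0, by rw [F.rank_zero]; exact one_pos⟩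
  have hsub : ∀ r, r = r₀ := by
    intro r
    have := F.rank_zero
    ext
    show (r : ℕ) = 0
    omega
  have hmv : ∀ i (v : Fin (F.rank (i + 1)) → _) r,
      (F.d i).mulVecLin v r = ∑ j, F.d i r j * v j := fun _ _ _ => rfl
  -- Exactness at `R`, in degree one: modulo a linear form in `I`, each variable is a combination
  -- with constant coefficients of the linear entries of the first matrix.
  have hX : ∀ i : Fin n, ∃ a : Fin (F.rank 1) → MvPolynomial (Fin n) K,
      X i - ∑ j, c 0 r₀ j * a j ∈ J := by
    intro i
    obtain ⟨w, hw⟩ := (F.exact_zero fun _ => Ideal.Quotient.mk I (X i)).2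
      fun _ => Ideal.subset_span ⟨i, rfl⟩
    choose W hW using fun j => Ideal.Quotient.mk_surjective (w j)
    have h1 : X i - ∑ j, c 0 r₀ j * W j ∈ I := by
      rw [← Ideal.Quotient.eq_zero_iff_mem, map_sub, map_sum, sub_eq_zero]
      refine (congrFun hw r₀).symm.trans ((hmv _ _ _).trans (Finset.sum_congr rfl fun j _ => ?_))
      rw [map_mul, hcd, hW]
    have h2 := hI _ h1 1
    refine ⟨fun j => homogeneousComponent 0 (W j), Ideal.subset_span ⟨?_, Or.inl ?_⟩⟩
    · rw [map_sub, map_sum, homogeneousComponent_of_mem (isHomogeneous_X K i), if_pos rfl] at h2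
      convert h2 using 3 with j
      exact (homogeneousComponent_add_mul (e := 0) (hc 0 r₀ j)).symm
    · exact (isHomogeneous_X _ _).sub (IsHomogeneous.sum _ _ _ fun j _ =>
        (hc 0 r₀ j).mul (homogeneousComponent_isHomogeneous 0 _))
  choose a ha using hX
  have hcst : constantCoeff g = 0 := by
    by_contra hne
    refine hI1 (Ideal.eq_top_of_isUnit_mem _ (hI g hg 0) ?_)
    rw [homogeneousComponent_zero]
    exact (Ne.isUnit hne).map C
  obtain ⟨G, hG⟩ := exists_eq_sum_X_mul hcst
  let b : Fin (F.rank 1) → MvPolynomial (Fin n) K := fun j => ∑ i, a i j * G i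
  have h1 : g - ∑ j, c 0 r₀ j * b j ∈ J := by
    have : g - ∑ j, c 0 r₀ j * b j = ∑ i, (X i - ∑ j, c 0 r₀ j * a i j) * G i := by
      simp only [sub_mul, Finset.sum_sub_distrib, b, Finset.mul_sum, Finset.sum_mul, mul_assoc]
      rw [Finset.sum_comm, ← hG]
    rw [this]
    exact sum_mem fun i _ => J.mul_mem_right _ (ha i)
  have hJI : J ≤ I := Ideal.span_le.2 fun x hx => hx.1
  have h2 : ∑ j, c 0 r₀ j * b j ∈ I := by
    have := sub_mem hg (hJI h1)
    rwa [sub_sub_cancel] at this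
  -- Now `b` reduces to a relation among the entries of the first matrix, so modulo `I` it comes
  -- from the second matrix.
  obtain ⟨e, he⟩ : (fun j => Ideal.Quotient.mk I (b j)) ∈ LinearMap.range (F.d 1).mulVecLin := by
    rw [F.exact_succ 0]
    refine LinearMap.mem_ker.2 (funext fun r => ?_)
    rw [hsub r]
    rw [← Ideal.Quotient.eq_zero_iff_mem, map_sum] at h2
    refine (hmv _ _ _).trans (Eq.trans (Finset.sum_congr rfl fun j _ => ?_) h2)
    rw [map_mul, hcd]
  choose E hE using fun l => Ideal.Quotient.mk_surjective (e l)
  have ht : ∀ j, b j - ∑ l, c 1 j l * E l ∈ I := by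
    intro j
    rw [← Ideal.Quotient.eq_zero_iff_mem, map_sub, sub_eq_zero,
      map_sum (Ideal.Quotient.mk I) (fun l => c 1 j l * E l)]
    refine (congrFun he j).symm.trans ((hmv _ _ _).trans (Finset.sum_congr rfl fun l _ => ?_))
    rw [map_mul, hcd, hE]
  -- The product of the two matrices of linear forms is zero modulo `I`, so its entries are quadrics
  -- in `I`. What remains of `g` is a combination of linear forms with coefficients in `I`.
  have hq : ∀ l, ∑ j, c 0 r₀ j * c 1 j l ∈ J := by
    intro l
    refine Ideal.subset_span ⟨?_, Or.inr (IsHomogeneous.sum _ _ _ fun j _ =>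
      (hc 0 r₀ j).mul (hc 1 j l))⟩
    have h3 : (F.d 1).mulVecLin (Pi.single l 1) ∈ LinearMap.ker (F.d 0).mulVecLin := by
      rw [← F.exact_succ 0]
      exact ⟨_, rfl⟩
    rw [← Ideal.Quotient.eq_zero_iff_mem, map_sum]
    refine Eq.trans (Finset.sum_congr rfl fun j _ => ?_) (congrFun (LinearMap.mem_ker.1 h3) r₀)
    rw [map_mul, hcd, hcd]
    simp
  choose u hu using fun j => exists_linForm_eq (hc 0 r₀ j)
  refine ⟨(g - ∑ j, c 0 r₀ j * b j) + ∑ l, (∑ j, c 0 r₀ j * c 1 j l) * E l,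
    add_mem h1 (sum_mem fun l _ => J.mul_mem_right _ (hq l)),
    fun i => ∑ j, C (u j i) * (b j - ∑ l, c 1 j l * E l),
    fun i => sum_mem fun j _ => I.mul_mem_left _ (ht j), ?_⟩
  have h4 : ∑ i, X i * ∑ j, C (u j i) * (b j - ∑ l, c 1 j l * E l) =
      ∑ j, c 0 r₀ j * (b j - ∑ l, c 1 j l * E l) := by
    simp only [Finset.mul_sum]
    rw [Finset.sum_comm]
    refine Finset.sum_congr rfl fun j _ => ?_
    rw [← hu j, linForm_apply, Finset.sum_mul]
    exact Finset.sum_congr rfl fun i _ => by ring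
  rw [h4]
  simp only [mul_sub, Finset.sum_sub_distrib, Finset.mul_sum, Finset.sum_mul, mul_assoc]
  rw [Finset.sum_comm]
  ring

theorem inverseSystemIdeal_ne_top (hf0 : f ≠ 0) : inverseSystemIdeal f ≠ ⊤ := by
  rw [Ideal.ne_top_iff_one, mem_inverseSystemIdeal, map_one, Module.End.one_apply]
  exact hf0

/-- On the line through `l` the elements of `I` of degree 1 and 2 vanish. By
`IsKoszul.exists_eq_add`, every other element of `I` then restricts to a polynomial divisible by
arbitrary powers of the parameter, but the fourth power of a variable does not. -/
theorem IsKoszul.eq_zero (hf : f.IsHomogeneous 3) (hf0 : f ≠ 0)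
    (h : IsKoszul (inverseSystemIdeal f)) {l : Fin n → k}
    (hl : ∀ g ∈ inverseSystemIdeal f, g.IsHomogeneous 2 → aeval l g = 0) : l = 0 := by
  by_contra hl0
  obtain ⟨i₀, hi₀⟩ := Function.ne_iff.1 hl0
  have hi₀ : l i₀ ≠ 0 := hi₀
  let θ : MvPolynomial (Fin n) K →ₐ[K] Polynomial k :=
    aeval fun i => Polynomial.C (l i) * Polynomial.X
  have hθ : ∀ {q : MvPolynomial (Fin n) K} {d}, q.IsHomogeneous d →
      θ q = Polynomial.C (aeval l q) * Polynomial.X ^ d := aeval_C_mul_X l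
  have hJ : Ideal.span {h | h ∈ inverseSystemIdeal f ∧ (h.IsHomogeneous 1 ∨ h.IsHomogeneous 2)} ≤
      RingHom.ker θ := by
    rw [Ideal.span_le]
    rintro q ⟨hq, hq1 | hq2⟩
    -- A linear form in `I` becomes a quadric in `I` after multiplication by a variable that does
    -- not vanish at `l`.
    · have h1 := hl _ (Ideal.mul_mem_left _ (X i₀) hq) ((isHomogeneous_X _ _).mul hq1)
      rw [map_mul, aeval_X] at h1
      rw [SetLike.mem_coe, RingHom.mem_ker, hθ hq1, (mul_eq_zero.1 h1).resolve_left hi₀, map_zero,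
        zero_mul]
    · rw [SetLike.mem_coe, RingHom.mem_ker, hθ hq2, hl q hq hq2, map_zero, zero_mul]
  have key : ∀ s, ∀ g ∈ inverseSystemIdeal f, Polynomial.X ^ s ∣ θ g := by
    intro s
    induction s with
    | zero => simp
    | succ s ih =>
      intro g hg
      obtain ⟨q, hq, t, ht, rfl⟩ := h.exists_eq_add (isGradedIdeal_inverseSystemIdeal hf)
        (inverseSystemIdeal_ne_top hf0) hg
      rw [map_add, RingHom.mem_ker.1 (hJ hq), zero_add, map_sum]
      refine Finset.dvd_sum fun i _ => ?_
      rw [map_mul, pow_succ', show θ (X i) = Polynomial.C (l i) * Polynomial.X from aeval_X _ _,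
        mul_assoc]
      exact Dvd.dvd.mul_left (mul_dvd_mul_left _ (ih _ (ht i))) _
  have h5 := key 5 _ (X_pow_four_mem_inverseSystemIdeal hf i₀)
  rw [map_pow, show θ (X i₀) = Polynomial.C (l i₀) * Polynomial.X from aeval_X _ _, mul_pow,
    Polynomial.X_pow_dvd_iff] at h5
  have := h5 4 (by norm_num)
  rw [← Polynomial.C_pow, Polynomial.coeff_C_mul, Polynomial.coeff_X_pow_self, mul_one] at this
  exact hi₀ (pow_eq_zero_iff (by norm_num) |>.1 this)

theorem isGradedIdeal_span {Q : Set (MvPolynomial (Fin n) K)} {d : ℕ}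
    (hQ : ∀ q ∈ Q, q.IsHomogeneous d) : IsGradedIdeal (Ideal.span Q) := by
  intro g hg
  have key : ∀ a j, homogeneousComponent j (a * g) ∈ Ideal.span Q := by
    refine Submodule.span_induction
      (p := fun g _ => ∀ a j, homogeneousComponent j (a * g) ∈ Ideal.span Q) ?_ ?_ ?_ ?_ hg
    · intro q hq a j
      rw [mul_comm]
      by_cases hj : d ≤ j
      · obtain ⟨e, rfl⟩ := Nat.exists_eq_add_of_le hj
        rw [homogeneousComponent_add_mul (hQ q hq)]
        exact Ideal.mul_mem_right _ _ (Ideal.subset_span hq)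
      · rw [← sum_homogeneousComponent a, Finset.mul_sum, map_sum]
        refine sum_mem fun i _ => ?_
        rw [homogeneousComponent_of_mem ((hQ q hq).mul (homogeneousComponent_isHomogeneous i a)),
          if_neg (by omega)]
        exact zero_mem _
    · intro a j
      rw [mul_zero, map_zero]
      exact zero_mem _
    · intro x y _ _ hx hy a j
      rw [mul_add, map_add]
      exact add_mem (hx a j) (hy a j)
    · intro c x _ hx a j
      rw [smul_eq_mul, ← mul_assoc]
      exact hx _ j
  intro j
  simpa using key 1 j

/-- Graded Nakayama lemma: modulo quadrics, an element of `I` is a combination of variables with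
coefficients in `I`, whose relevant components have smaller degree. -/
theorem IsKoszul.isQuadratic (hf : f.IsHomogeneous 3) (hf0 : f ≠ 0)
    (h : IsKoszul (inverseSystemIdeal f))
    (hlin : ∀ g ∈ inverseSystemIdeal f, g.IsHomogeneous 1 → g = 0) :
    IsQuadratic (inverseSystemIdeal f) := by
  set I := inverseSystemIdeal f
  let Q := {h | h ∈ I ∧ h.IsHomogeneous 2}
  refine ⟨Q, fun q hq => hq.2, le_antisymm ?_ (Ideal.span_le.2 fun q hq => hq.1)⟩
  have hQ : IsGradedIdeal (Ideal.span Q) := isGradedIdeal_span fun q hq => hq.2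
  have hJ : Ideal.span {h | h ∈ I ∧ (h.IsHomogeneous 1 ∨ h.IsHomogeneous 2)} ≤ Ideal.span Q := by
    rw [Ideal.span_le]
    rintro q ⟨hq, hq1 | hq2⟩
    · rw [hlin q hq hq1]
      exact zero_mem _
    · exact Ideal.subset_span ⟨hq, hq2⟩
  have key : ∀ d, ∀ g ∈ I, homogeneousComponent d g ∈ Ideal.span Q := by
    intro d
    induction d with
    | zero =>
      intro g hg
      obtain ⟨q, hq, t, ht, rfl⟩ := h.exists_eq_add (isGradedIdeal_inverseSystemIdeal hf)
        (inverseSystemIdeal_ne_top hf0) hg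
      rw [map_add]
      refine add_mem (hQ _ (hJ hq) _) ?_
      rw [homogeneousComponent_zero, ← constantCoeff_eq, map_sum]
      simp
    | succ d ih =>
      intro g hg
      obtain ⟨q, hq, t, ht, rfl⟩ := h.exists_eq_add (isGradedIdeal_inverseSystemIdeal hf)
        (inverseSystemIdeal_ne_top hf0) hg
      rw [map_add, map_sum]
      refine add_mem (hQ _ (hJ hq) _) (sum_mem fun i _ => ?_)
      rw [add_comm d, homogeneousComponent_add_mul (isHomogeneous_X _ i)]
      exact Ideal.mul_mem_left _ _ (ih _ (ht i))
  intro g hg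
  rw [← sum_homogeneousComponent g]
  exact sum_mem fun d _ => key d g hg

end QuadricsInTheIdeal

end CubicKoszul

namespace CubicKoszul

open Module

/-! ### Points with a Hessian of rank at most one -/

section RankOne

variable {k : Type*} [Field k] [CharZero k] {n : ℕ} {f : MvPolynomial (Fin n) k}

omit [CharZero k] in
theorem trace_mul_eq_mul_eval {p : Fin n → k} {c : k} {φ : (Fin n → k) →ₗ[k] k}
    (h : ∀ x y, triForm f p x y = c * (φ x * φ y)) {g : MvPolynomial (Fin n) k}
    (hg : g.IsHomogeneous 2) :
    trace f (linForm p * g) = c * eval (fun i => φ (Pi.single i 1)) g := by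
  have hφ : ∀ x, eval (fun i => φ (Pi.single i 1)) (linForm x) = φ x := by
    intro x
    conv_rhs => rw [eq_sum_smul_single x]
    simp [linForm_apply]
  have hg : g ∈ homogeneousSubmodule (Fin n) k (1 + 1) := hg
  rw [homogeneousSubmodule_add] at hg
  refine Submodule.mul_induction_on hg ?_ ?_
  · intro a ha b hb
    obtain ⟨x, rfl⟩ := exists_linForm_eq ha
    obtain ⟨y, rfl⟩ := exists_linForm_eq hb
    rw [← mul_assoc, ← triForm_apply, h, map_mul, hφ, hφ]
  · intro a b ha hb
    rw [mul_add, map_add, ha, hb, map_add, mul_add]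

omit [CharZero k] in
theorem exists_ne_zero_of_isRankLEOne {V : Type*} [AddCommGroup V] [Module k V]
    {S : V →ₗ[k] V →ₗ[k] k} (hs : ∀ v w, S v w = S w v) (h : IsRankLEOne S) (hS : S ≠ 0) :
    ∃ x₀, S x₀ x₀ ≠ 0 ∧ ∀ x y, S x y = (S x₀ x₀)⁻¹ * (S x₀ x * S x₀ y) := by
  obtain ⟨v, w, hvw⟩ : ∃ v w, S v w ≠ 0 := by
    by_contra! h0
    exact hS (LinearMap.ext fun v => LinearMap.ext fun w => h0 v w)
  have hv : S v v ≠ 0 := by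
    intro h0
    have := h v v w w
    rw [h0, zero_mul, hs w v] at this
    exact hvw (mul_self_eq_zero.1 this.symm)
  refine ⟨v, hv, fun x y => ?_⟩
  have := h v v x y
  rw [hs x v] at this
  rw [← mul_right_inj' hv, this, ← mul_assoc, mul_inv_cancel₀ hv, one_mul, mul_comm]

-- If `T p = c φ ⊗ φ` is nonzero, then `g(∂) ∂_p f = c g(φ)` for all quadrics `g`, so the
-- coefficients of `φ` are a common zero of the quadrics in the ideal.
omit [CharZero k] in
theorem triForm_eq_zero_of_isRankLEOne
    (hA : ∀ l : Fin n → k, (∀ g ∈ inverseSystemIdeal f, g.IsHomogeneous 2 → eval l g = 0) → l = 0)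
    {p : Fin n → k} (hp : IsRankLEOne (triForm f p)) : triForm f p = 0 := by
  by_contra hne
  obtain ⟨x₀, hx₀, h⟩ := exists_ne_zero_of_isRankLEOne (triForm_swap₂ f p) hp hne
  have hl := hA (fun i => triForm f p x₀ (Pi.single i 1)) fun g hg hg2 => by
    have h1 := trace_mul_eq_mul_eval h hg2
    rw [trace_apply, diffOp_mul_apply, mem_inverseSystemIdeal.1 hg, map_zero, coeff_zero] at h1
    exact (mul_eq_zero.1 h1.symm).resolve_left (inv_ne_zero hx₀)
  exact hx₀ (linearMap_eq_zero_of_single (triForm f p x₀) (fun i => congrFun hl i) x₀)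

theorem eq_zero_of_triForm_eq_zero (hf : f.IsHomogeneous 3) (h : triForm f = 0) : f = 0 := by
  have := diffOp_eq_zero_of_trace (d := 0) (e := 3) hf (isHomogeneous_one _ _) ?_
  · simpa using this
  · intro g hg
    have hg : g ∈ homogeneousSubmodule (Fin n) k (2 + 1) := hg
    rw [homogeneousSubmodule_add] at hg
    rw [mul_one]
    refine Submodule.mul_induction_on hg ?_ ?_
    · intro a ha b hb
      have ha : a ∈ homogeneousSubmodule (Fin n) k (1 + 1) := ha
      rw [homogeneousSubmodule_add] at ha
      obtain ⟨z, rfl⟩ := exists_linForm_eq hb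
      refine Submodule.mul_induction_on ha ?_ ?_
      · intro a ha b hb
        obtain ⟨x, rfl⟩ := exists_linForm_eq ha
        obtain ⟨y, rfl⟩ := exists_linForm_eq hb
        rw [← triForm_apply, h]
        simp
      · intro a b ha hb
        rw [add_mul, map_add, ha, hb, add_zero]
    · intro a b ha hb
      rw [map_add, ha, hb, add_zero]

omit [CharZero k] in
theorem diffOp_linForm_apply (w : Fin n → k) (g : MvPolynomial (Fin n) k) :
    diffOp k n (linForm w) g = ∑ i, C (w i) * pderiv i g := by
  rw [linForm_apply, map_sum, LinearMap.sum_apply]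
  refine Finset.sum_congr rfl fun i _ => ?_
  rw [diffOp_mul_apply, diffOp_X_apply, diffOp_C_apply, smul_eq_C_mul]

-- Chain rule: column `i₀` of the substitution is the direction of the derivative.
omit [CharZero k] in
theorem pderiv_linSubst {A : Matrix (Fin n) (Fin n) k} {i₀ : Fin n} {u : Fin n → k}
    (hA : ∀ i, A i i₀ = u i) (g : MvPolynomial (Fin n) k) :
    pderiv i₀ (linSubst A g) = linSubst A (diffOp k n (linForm u) g) := by
  classical
  rw [diffOp_linForm_apply]
  unfold linSubst
  induction g using MvPolynomial.induction_on with
  | C a => simp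
  | add p q hp hq => simp only [map_add, hp, hq, mul_add, Finset.sum_add_distrib]
  | mul_X p i hp =>
    have h1 : pderiv i₀ (∑ j, C (A i j) * X j : MvPolynomial (Fin n) k) = C (u i) := by
      rw [map_sum, Finset.sum_eq_single i₀]
      · simp [hA]
      · intro j _ hj
        simp [pderiv_X_of_ne hj]
      · simp
    have h2 : ∑ j, C (u j) * pderiv j (p * X i) = (∑ j, C (u j) * pderiv j p) * X i + p * C (u i) := by
      simp only [pderiv_mul, mul_add, Finset.sum_add_distrib, Finset.sum_mul, mul_assoc]
      congr 1
      rw [Finset.sum_eq_single i]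
      · simp [mul_comm]
      · intro j _ hj
        simp [pderiv_X_of_ne hj.symm]
      · simp
    rw [map_mul, pderiv_mul, hp, bind₁_X_right, h1, h2, map_add, map_mul, map_mul, bind₁_X_right,
      bind₁_C_right]

/-- A cubic with a linear form in its ideal is a cone. -/
theorem isCone_of_diffOp_linForm_eq_zero {u : Fin n → k} (hu : u ≠ 0)
    (h : diffOp k n (linForm u) f = 0) : IsCone f := by
  classical
  obtain ⟨i₀, hi₀⟩ := Function.ne_iff.1 hu
  -- The coordinate `x_{i₀}` now runs in the direction `u`, along which `f` has derivative zero; in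
  -- characteristic zero it cannot occur. The determinant is `u i₀`, which is nonzero by choice of
  -- `i₀`.
  let A : Matrix (Fin n) (Fin n) k := (1 : Matrix (Fin n) (Fin n) k).updateCol i₀ u
  have hA : A.det = u i₀ := by
    rw [← Matrix.cramer_apply, Matrix.cramer_one]
    rfl
  refine ⟨Matrix.GeneralLinearGroup.mkOfDetNeZero A (by rw [hA]; exact hi₀), i₀, ?_⟩
  have hder : pderiv i₀ (linSubst A f) = 0 := by
    rw [pderiv_linSubst fun i => (Matrix.updateCol_self : A i i₀ = u i), h]
    exact map_zero _
  intro hmem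
  obtain ⟨m, hm, hmi⟩ := (mem_vars_iff_mem_support i₀).1 hmem
  have h1 := congrArg (coeff (m - Finsupp.single i₀ 1)) hder
  rw [coeff_pderiv, tsub_add_cancel_of_le (by
    rw [Finsupp.single_le_iff]
    exact Nat.one_le_iff_ne_zero.2 (Finsupp.mem_support_iff.1 hmi)), coeff_zero, mul_eq_zero] at h1
  refine h1.elim (mem_support_iff.1 hm) fun h2 => ?_
  exact Nat.cast_add_one_ne_zero _ h2

/-- If `T p = 0`, every form `T q` lives on a plane `M` complementary to `p`, so one that
degenerates on `M` has rank at most one and is zero by hypothesis. But the pencil of the `T m` with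
`m ∈ M` has a degenerate member, and `T m = 0` for a nonzero `m` makes every `T q` degenerate, so `T
= 0`. -/
theorem eq_zero_of_triForm_eq_zero_three [IsAlgClosed k] {V : Type*} [AddCommGroup V] [Module k V]
    [FiniteDimensional k V] (hV : finrank k V = 3) {T : V →ₗ[k] V →ₗ[k] V →ₗ[k] k}
    (hs₁ : ∀ u v w, T u v w = T v u w) (hs₂ : ∀ u v w, T u v w = T u w v) (hT : T ≠ 0)
    (h : ∀ p, IsRankLEOne (T p) → T p = 0) : ∀ p, T p = 0 → p = 0 := by
  by_contra! hne
  obtain ⟨p, hp, hp0⟩ := hne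
  have hpk : ∀ v, p ∈ LinearMap.ker (T v) := fun v => by
    rw [LinearMap.mem_ker]
    ext w
    rw [hs₁, hp]
    rfl
  obtain ⟨M, hM⟩ := (Submodule.span k {p}).exists_isCompl
  have h1 := Submodule.finrank_add_eq_of_isCompl hM
  rw [finrank_span_singleton hp0] at h1
  have hM2 : finrank k M = 2 := by omega
  have hker : ∀ q, ∀ m ∈ M, m ≠ 0 → T q m = 0 → T q = 0 := by
    intro q m hm hm0 hqm
    refine h q (isRankLEOne_of_finrank_ker ?_)
    have hli : LinearIndependent k ![p, m] := by
      rw [LinearIndependent.pair_iff' hp0]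
      rintro c rfl
      exact hm0 (Submodule.disjoint_def.1 hM.disjoint _
        (Submodule.smul_mem _ _ (Submodule.mem_span_singleton_self p)) hm)
    have h2 := finrank_span_eq_card hli
    rw [Matrix.range_cons_cons_empty, Fintype.card_fin] at h2
    have h3 : Submodule.span k {p, m} ≤ LinearMap.ker (T q) := by
      rw [Submodule.span_le]
      rintro x (rfl | rfl)
      exacts [hpk q, hqm]
    have := Submodule.finrank_mono h3
    omega
  have hfin : ∀ m ∈ M, m ≠ 0 → T m ≠ 0 := by
    intro m hm hm0 hTm
    refine hT (LinearMap.ext fun q => hker q m hm hm0 ?_)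
    ext w
    rw [hs₁, hTm]
    rfl
  have hM0 : Nontrivial M := nontrivial_of_finrank_pos (R := k) (by omega)
  obtain ⟨m₁, hm₁⟩ := exists_ne (0 : M)
  obtain ⟨m₂, hm₁₂⟩ := exists_linearIndependent_pair_of_one_lt_finrank (R := k) (by omega) hm₁
  have hm₁' : (m₁ : V) ≠ 0 := fun h => hm₁ (Subtype.ext h)
  have hext : ∀ x y : V, (∀ m ∈ M, T x y m = 0) → T x y = 0 := by
    intro x y hxy
    ext v
    obtain ⟨l, hl, m, hm, rfl⟩ := Submodule.mem_sup.1 (hM.sup_eq_top.symm ▸ Submodule.mem_top : v ∈ _)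
    obtain ⟨c, rfl⟩ := Submodule.mem_span_singleton.1 hl
    rw [map_add, hxy m hm, hs₂, map_smul, LinearMap.mem_ker.1 (hpk x)]
    simp
  obtain ⟨t, m, hm, htm⟩ := exists_eq_smul_of_injective (M' := Dual k M)
    (Subspace.dual_finrank_eq).symm ((T m₁).domRestrict₁₂ M M) ((T m₂).domRestrict₁₂ M M) (by
      rw [← LinearMap.ker_eq_bot, LinearMap.ker_eq_bot']
      intro m hm
      by_contra hm0
      exact hfin m₁ m₁.2 hm₁' (hker _ m m.2 (fun h => hm0 (Subtype.ext h))
        (hext _ _ fun m' hm' => LinearMap.congr_fun hm ⟨m', hm'⟩)))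
  refine hfin (m₂ - t • m₁ : M) (m₂ - t • m₁ : M).2 (fun h0 => ?_)
    (hker _ m m.2 (fun h => hm (Subtype.ext h)) (hext _ _ fun m' hm' => ?_))
  · have h0' : m₂ - t • m₁ = 0 := Subtype.ext h0
    have := LinearIndependent.pair_iff.1 hm₁₂ (-t) 1 (by rw [← h0']; module)
    exact one_ne_zero this.2
  · have := LinearMap.congr_fun htm ⟨m', hm'⟩
    simp only [LinearMap.domRestrict₁₂_apply, LinearMap.smul_apply, smul_eq_mul] at this
    simp [this]

end RankOne

/-! ### Equivalence of the conditions (1), (2), (3) -/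

section Equivalence

variable {K : Type*} [Field K] [CharZero K] {n : ℕ} {f : MvPolynomial (Fin n) K}
  {k : Type*} [Field k] [Algebra K k] [IsAlgClosed k]

theorem eq_zero_of_isRankLEOne (hn : n = 3 ∨ n = 4) (hf : f.IsHomogeneous 3) (hf0 : f ≠ 0)
    (hcone : n = 4 → ¬ IsCone f)
    (hA : ∀ l : Fin n → k,
      (∀ g ∈ inverseSystemIdeal f, g.IsHomogeneous 2 → aeval l g = 0) → l = 0)
    {p : Fin n → k} (hp : IsRankLEOne (triForm (map (algebraMap K k) f) p)) : p = 0 := by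
  have : CharZero k := charZero_of_injective_algebraMap (algebraMap K k).injective
  have h1 : ∀ p, IsRankLEOne (triForm (map (algebraMap K k) f) p) →
      triForm (map (algebraMap K k) f) p = 0 := fun p =>
    triForm_eq_zero_of_isRankLEOne fun l hl => hA l fun g hg hg2 => by
      have := hl (map (algebraMap K k) g) (by
        rw [mem_inverseSystemIdeal, diffOp_map, mem_inverseSystemIdeal.1 hg, map_zero]) (hg2.map _)
      rwa [eval_map] at this
  rcases hn with rfl | rfl
  · refine eq_zero_of_triForm_eq_zero_three (by simp) (triForm_swap₁ _) (triForm_swap₂ _)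
      (fun h0 => hf0 ?_) h1 p (h1 p hp)
    have := eq_zero_of_triForm_eq_zero (hf.map _) h0
    exact map_injective _ (algebraMap K k).injective (this.trans (map_zero _).symm)
  · have h2 : linForm p ∈ inverseSystemIdeal (map (algebraMap K k) f) := by
      refine diffOp_eq_zero_of_trace (d := 1) (e := 2) (hf.map _) (isHomogeneous_linForm p) ?_
      intro g hg
      have h3 := trace_mul_eq_mul_eval (f := map (algebraMap K k) f) (p := p) (c := 0) (φ := 0)
        (fun x y => by rw [h1 p hp]; simp) hg
      rw [mul_comm, h3, zero_mul]
    -- The hypothesis on cones concerns `K` only, so the linear form over `k` is expanded in linear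
    -- forms over `K` that lie in the ideal of `f`.
    obtain ⟨F, g, hg, hgI, hgp⟩ := exists_sum_of_mem_inverseSystemIdeal_map
      (Basis.ofVectorSpace K k) (isHomogeneous_linForm p) h2
    have h3 : ∀ b ∈ F, g b = 0 := by
      intro b hb
      obtain ⟨u, hu⟩ := exists_linForm_eq (hg b)
      by_contra hne
      refine hcone rfl (isCone_of_diffOp_linForm_eq_zero (u := u) ?_ ?_)
      · rintro rfl
        exact hne (by rw [← hu, map_zero])
      · rw [hu]
        exact hgI b hb
    have h4 : linForm p = 0 := by
      rw [← hgp]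
      exact Finset.sum_eq_zero fun b hb => by rw [h3 b hb, map_zero, mul_zero]
    funext i
    have := congrArg (eval (Pi.single i 1)) h4
    simpa [linForm_apply, Pi.single_apply] using this

theorem tfae_isQuadratic_isKoszul_height (k : Type*) [Field k] [Algebra K k] [IsAlgClosed k]
    (hn : n = 3 ∨ n = 4) (hf : f.IsHomogeneous 3) (hf0 : f ≠ 0)
    (hcone : n = 4 → ¬ IsCone f) :
    List.TFAE
      [IsQuadratic (inverseSystemIdeal f),
        IsKoszul (inverseSystemIdeal f),
        (minorsIdeal 2 (hessian f)).height = n,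
        ∀ p : Fin n → k, IsRankLEOne (triForm (map (algebraMap K k) f) p) → p = 0] := by
  have h34 := height_minorsIdeal_eq_iff (k := k) hf
  have h14 : IsQuadratic (inverseSystemIdeal f) →
      ∀ p : Fin n → k, IsRankLEOne (triForm (map (algebraMap K k) f) p) → p = 0 := fun h p =>
    eq_zero_of_isRankLEOne hn hf hf0 hcone fun l => h.eq_zero hf
  have h24 : IsKoszul (inverseSystemIdeal f) →
      ∀ p : Fin n → k, IsRankLEOne (triForm (map (algebraMap K k) f) p) → p = 0 := fun h p =>
    eq_zero_of_isRankLEOne hn hf hf0 hcone fun l => h.eq_zero hf hf0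
  have h42 : (∀ p : Fin n → k, IsRankLEOne (triForm (map (algebraMap K k) f) p) → p = 0) →
      IsKoszul (inverseSystemIdeal f) := isKoszul_of_isRankLEOne hn hf
  have h41 : (∀ p : Fin n → k, IsRankLEOne (triForm (map (algebraMap K k) f) p) → p = 0) →
      IsQuadratic (inverseSystemIdeal f) := by
    intro h
    refine (h42 h).isQuadratic hf hf0 fun g hg hg1 => ?_
    obtain ⟨u, rfl⟩ := exists_linForm_eq hg1
    have h5 := h (fun i => algebraMap K k (u i)) fun v w v' w' => by
      have h6 : ∀ v w, triForm (map (algebraMap K k) f) (fun i => algebraMap K k (u i)) v w = 0 := by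
        intro v w
        have h7 : linForm (fun i => algebraMap K k (u i)) = map (algebraMap K k) (linForm u) := by
          simp [linForm_apply]
        rw [triForm_apply, h7, mul_assoc, mul_comm, trace_apply, diffOp_mul_apply, diffOp_map,
          mem_inverseSystemIdeal.1 hg, map_zero, map_zero, coeff_zero]
      simp [h6]
    have h6 : u = 0 := funext fun i => (map_eq_zero _).1 (congrFun h5 i)
    rw [h6, map_zero]
  tfae_have 1 → 4 := h14
  tfae_have 4 → 1 := h41
  tfae_have 2 → 4 := h24
  tfae_have 4 → 2 := h42
  tfae_have 3 ↔ 4 := h34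
  tfae_finish

end Equivalence

end CubicKoszul

namespace CubicKoszul

open Module

/-! ### Self-adjoint endomorphisms of a ternary cubic -/

section SelfAdjoint

variable {k V : Type*} [Field k] [IsAlgClosed k] [AddCommGroup V] [Module k V]
  [FiniteDimensional k V] {T : V →ₗ[k] V →ₗ[k] V →ₗ[k] k}

/-- A non-scalar endomorphism that is self-adjoint for a ternary cubic produces a second
polar of rank at most one. -/
theorem exists_isRankLEOne_of_selfAdjoint (hV : finrank k V = 3) {β : End k V}
    (hβ : ∀ c : k, β ≠ algebraMap k _ c) (h : ∀ u v w, T (β u) v w = T u (β v) w) :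
    ∃ p, p ≠ 0 ∧ IsRankLEOne (T p) := by
  have : Nontrivial V := nontrivial_of_finrank_pos (R := k) (by omega)
  obtain ⟨c, hc⟩ := Module.End.exists_eigenvalue β
  set γ : End k V := β - algebraMap k _ c
  have hγ : ∀ u v w, T (γ u) v w = T u (γ v) w := by
    intro u v w
    simp [γ, h]
  have hγ0 : γ ≠ 0 := fun h0 => hβ c (sub_eq_zero.1 h0)
  have hker : LinearMap.ker γ ≠ ⊥ := by
    obtain ⟨v, hv⟩ := hc.exists_hasEigenvector
    refine (Submodule.ne_bot_iff _).2 ⟨v, ?_, hv.2⟩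
    rw [LinearMap.mem_ker, LinearMap.sub_apply, hv.apply_eq_smul, Module.algebraMap_end_apply,
      sub_self]
  have hrange : LinearMap.range γ ≠ ⊥ := fun h0 => hγ0 (LinearMap.range_eq_bot.1 h0)
  have h1 := γ.finrank_range_add_finrank_ker
  obtain ⟨w, hw, hw0⟩ := Submodule.exists_mem_ne_zero_of_ne_bot hker
  obtain ⟨_, ⟨q, rfl⟩, hq0⟩ := Submodule.exists_mem_ne_zero_of_ne_bot hrange
  -- By self-adjointness `T (γ q)` kills the kernel of `γ`, and `T w` with `γ w = 0` kills its
  -- range. One of these two spaces has dimension at least two.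
  rcases le_or_gt 2 (finrank k (LinearMap.ker γ)) with h2 | h2
  · refine ⟨γ q, hq0, isRankLEOne_of_finrank_ker ?_⟩
    have : LinearMap.ker γ ≤ LinearMap.ker (T (γ q)) := by
      intro x hx
      refine LinearMap.mem_ker.2 (LinearMap.ext fun v => ?_)
      rw [hγ, LinearMap.mem_ker.1 hx]
      simp
    have := Submodule.finrank_mono this
    omega
  · refine ⟨w, hw0, isRankLEOne_of_finrank_ker ?_⟩
    have : LinearMap.range γ ≤ LinearMap.ker (T w) := by
      rintro _ ⟨x, rfl⟩
      refine LinearMap.mem_ker.2 (LinearMap.ext fun v => ?_)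
      rw [← hγ, LinearMap.mem_ker.1 hw]
      simp
    have := Submodule.finrank_mono this
    omega

end SelfAdjoint

/-! ### The orbit of the Fermat cubic and linear functionals of forms -/

section FermatOrbit

variable {K : Type*} [Field K] {n : ℕ}

theorem linSubst_fermatCubic (A : Matrix (Fin n) (Fin n) K) :
    linSubst A (fermatCubic K n) = ∑ i, linForm (A.row i) ^ 3 := by
  simp [linSubst, fermatCubic, linForm_apply]

theorem isHomogeneous_sum_linForm_pow {ι : Type*} [Fintype ι] (c : ι → Fin n → K) :
    (∑ i, linForm (c i) ^ 3).IsHomogeneous 3 :=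
  IsHomogeneous.sum _ _ _ fun i _ => by simpa using (isHomogeneous_linForm (c i)).pow 3

theorem diffOp_linForm_mul (w : Fin n → K) (a b : MvPolynomial (Fin n) K) :
    diffOp K n (linForm w) (a * b) =
      diffOp K n (linForm w) a * b + a * diffOp K n (linForm w) b := by
  simp only [diffOp_linForm_apply, pderiv_mul, mul_add, Finset.sum_add_distrib, Finset.sum_mul,
    Finset.mul_sum]
  congr 1 <;> exact Finset.sum_congr rfl fun i _ => by ring

theorem diffOp_linForm_linForm (w c : Fin n → K) :
    diffOp K n (linForm w) (linForm c) = C (c ⬝ᵥ w) := by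
  rw [diffOp_linForm_apply, dotProduct, map_sum]
  refine Finset.sum_congr rfl fun i _ => ?_
  rw [linForm_apply, map_sum, Finset.sum_eq_single i]
  · simp [mul_comm]
  · intro j _ hj
    simp [pderiv_X_of_ne hj]
  · simp

theorem diffOp_linForm_C (w : Fin n → K) (c : K) : diffOp K n (linForm w) (C c) = 0 := by
  simp [diffOp_linForm_apply]

theorem triForm_sum_linForm_pow {ι : Type*} [Fintype ι] (c : ι → Fin n → K) (u v w : Fin n → K) :
    triForm (∑ i, linForm (c i) ^ 3) u v w =
      ∑ i, 6 * ((c i ⬝ᵥ u) * (c i ⬝ᵥ v) * (c i ⬝ᵥ w)) := by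
  rw [triForm_apply, trace_apply, map_sum, coeff_sum]
  refine Finset.sum_congr rfl fun i _ => ?_
  rw [diffOp_mul_apply, diffOp_mul_apply, pow_succ, pow_two]
  simp only [diffOp_linForm_mul, diffOp_linForm_linForm, map_add, diffOp_linForm_C, mul_zero,
    zero_mul, add_zero, zero_add]
  simp only [← C_mul, ← C_add, coeff_zero_C]
  ring

instance {d : ℕ} : Finite {m : Fin n →₀ ℕ // m.degree = d} :=
  (Finsupp.finite_of_degree_eq (σ := Fin n) d).to_subtype

/-- Linear functionals of forms are linear polynomials in the coefficients. -/
theorem exists_aeval_formCoeffs_eq (d : ℕ) (Λ : MvPolynomial (Fin n) K →ₗ[K] K) :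
    ∃ P : MvPolynomial {m : Fin n →₀ ℕ // m.degree = d} K,
      ∀ g : MvPolynomial (Fin n) K, g.IsHomogeneous d → aeval (formCoeffs d g) P = Λ g := by
  classical
  have := Fintype.ofFinite {m : Fin n →₀ ℕ // m.degree = d}
  refine ⟨∑ m, C (Λ (monomial m.1 1)) * X m, fun g hg => ?_⟩
  have h : g = ∑ m : {m : Fin n →₀ ℕ // m.degree = d}, coeff m.1 g • monomial m.1 1 := by
    ext m
    simp only [coeff_sum, coeff_smul, coeff_monomial, smul_eq_mul, mul_ite, mul_one, mul_zero]
    by_cases hm : m.degree = d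
    · rw [Finset.sum_eq_single ⟨m, hm⟩]
      · simp
      · rintro ⟨m', hm'⟩ - hne
        exact if_neg fun h => hne (Subtype.ext h)
      · simp
    · rw [hg.coeff_eq_zero hm]
      refine (Finset.sum_eq_zero ?_).symm
      rintro ⟨m', hm'⟩ -
      exact if_neg fun h => hm (by rw [← h]; exact hm')
  conv_rhs => rw [h]
  simp [formCoeffs, mul_comm]

end FermatOrbit

/-! ### Self-adjoint endomorphisms on the closure of the Fermat orbit -/

section SelfAdjointSystem

variable {K : Type*} [Field K]

/-- The linear system for trace zero endomorphisms that are self-adjoint for the cubic `g`. -/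
noncomputable def selfAdjointSystem (g : MvPolynomial (Fin 3) K) :
    Matrix (Fin 3) (Fin 3) K →ₗ[K] (Fin 3 → Fin 3 → Fin 3 → K) × K :=
  (LinearMap.pi fun a => LinearMap.pi fun b => LinearMap.pi fun c =>
    trace g ∘ₗ (LinearMap.mulRight K (X c)) ∘ₗ
      ((LinearMap.mulRight K (X b)) ∘ₗ linForm ∘ₗ LinearMap.proj a -
        (LinearMap.mulLeft K (X a)) ∘ₗ linForm ∘ₗ LinearMap.proj b) ∘ₗ
      (Matrix.transposeLinearEquiv (Fin 3) (Fin 3) K K).toLinearMap).prod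
    (Matrix.traceLinearMap (Fin 3) K K)

theorem selfAdjointSystem_apply (g : MvPolynomial (Fin 3) K) (β : Matrix (Fin 3) (Fin 3) K) :
    selfAdjointSystem g β = (fun a b c => trace g ((linForm (β.col a) * X b -
      X a * linForm (β.col b)) * X c), β.trace) := rfl

theorem selfAdjointSystem_eq_zero_iff {g : MvPolynomial (Fin 3) K} {β : Matrix (Fin 3) (Fin 3) K} :
    selfAdjointSystem g β = 0 ↔ β.trace = 0 ∧
      ∀ u v w, triForm g (β.mulVec u) v w = triForm g u (β.mulVec v) w := by
  have hcol : ∀ a, β.col a = β.mulVec (Pi.single a 1) := fun a => by simp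
  have key : ∀ a b c, trace g ((linForm (β.col a) * X b - X a * linForm (β.col b)) * X c) =
      triForm g (β.mulVec (Pi.single a 1)) (Pi.single b 1) (Pi.single c 1) -
      triForm g (Pi.single a 1) (β.mulVec (Pi.single b 1)) (Pi.single c 1) := by
    intro a b c
    rw [triForm_apply, triForm_apply, linForm_single, linForm_single, linForm_single, hcol, hcol,
      sub_mul, map_sub]
  rw [selfAdjointSystem_apply, Prod.ext_iff, and_comm]
  refine and_congr_right fun _ => ?_
  constructor
  · intro h u v w
    have h1 : (triForm g).comp β.mulVecLin = (LinearMap.lcomp K _ β.mulVecLin).comp (triForm g) := by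
      refine LinearMap.pi_ext' fun a => LinearMap.ext_ring (LinearMap.pi_ext' fun b =>
        LinearMap.ext_ring (LinearMap.pi_ext' fun c => LinearMap.ext_ring ?_))
      have := congrFun (congrFun (congrFun h a) b) c
      exact sub_eq_zero.1 ((key a b c).symm.trans this)
    exact LinearMap.congr_fun (LinearMap.congr_fun (LinearMap.congr_fun h1 u) v) w
  · intro h
    funext a b c
    exact (key a b c).trans (sub_eq_zero.2 (h _ _ _))

/-- Cubics in the closure of the orbit of the Fermat cubic have a non-scalar self-adjoint
endomorphism. -/
theorem exists_selfAdjoint_of_mem_zariskiClosure [CharZero K] {f : MvPolynomial (Fin 3) K}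
    (hf : f ∈ zariskiClosure 3 (glOrbit (fermatCubic K 3))) :
    ∃ β : Matrix (Fin 3) (Fin 3) K, β ≠ 0 ∧ β.trace = 0 ∧
      ∀ u v w, triForm f (β.mulVec u) v w = triForm f u (β.mulVec v) w := by
  classical
  by_contra! hne
  have hinj : LinearMap.ker (selfAdjointSystem f) = ⊥ := by
    refine LinearMap.ker_eq_bot'.2 fun β hβ => ?_
    by_contra hβ0
    obtain ⟨h1, h2⟩ := selfAdjointSystem_eq_zero_iff.1 hβ
    obtain ⟨u, v, w, h3⟩ := hne β hβ0 h1
    exact h3 (h2 u v w)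
  -- With a left inverse `π` at `f`, the determinant of `π ∘ selfAdjointSystem g` is a polynomial in
  -- the coefficients of `g`. It is `1` at `f` but vanishes on the orbit, where the system has a
  -- kernel.
  obtain ⟨π, hπ⟩ := (selfAdjointSystem f).exists_leftInverse_of_injective hinj
  let B := Matrix.stdBasis K (Fin 3) (Fin 3)
  have hentry : ∀ i j, ∃ P : MvPolynomial {m : Fin 3 →₀ ℕ // m.degree = 3} K,
      ∀ g : MvPolynomial (Fin 3) K, g.IsHomogeneous 3 →
        aeval (formCoeffs 3 g) P = LinearMap.toMatrix B B (π ∘ₗ selfAdjointSystem g) i j := by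
    intro i j
    let Λ : MvPolynomial (Fin 3) K →ₗ[K] K := B.coord i ∘ₗ π ∘ₗ LinearMap.inl K _ _ ∘ₗ
      (LinearMap.pi fun a => LinearMap.pi fun b => LinearMap.pi fun c =>
        lcoeff K 0 ∘ₗ diffOp K 3 ((linForm ((B j).col a) * X b - X a * linForm ((B j).col b)) * X c))
    obtain ⟨P, hP⟩ := exists_aeval_formCoeffs_eq 3 Λ
    refine ⟨P + C (B.coord i (π (0, (B j).trace))), fun g hg => ?_⟩
    rw [map_add, hP g hg, aeval_C, LinearMap.toMatrix_apply, Algebra.algebraMap_self_apply]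
    show _ = B.coord i (π (selfAdjointSystem g (B j)))
    rw [selfAdjointSystem_apply]
    have : ∀ x : Fin 3 → Fin 3 → Fin 3 → K, B.coord i (π (x, (B j).trace)) =
        B.coord i (π (x, 0)) + B.coord i (π (0, (B j).trace)) := by
      intro x
      rw [← map_add, ← map_add, Prod.mk_add_mk, add_zero, zero_add]
    exact (this _).symm
  choose P hP using hentry
  have hdet : ∀ g : MvPolynomial (Fin 3) K, g.IsHomogeneous 3 →
      aeval (formCoeffs 3 g) (Matrix.of P).det = LinearMap.det (π ∘ₗ selfAdjointSystem g) := by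
    intro g hg
    rw [AlgHom.map_det, ← LinearMap.det_toMatrix B]
    congr 1
    ext i j
    exact hP i j g hg
  have h0 : aeval (formCoeffs 3 f) (Matrix.of P).det = 0 := by
    refine hf.2 _ ?_
    rintro _ ⟨_, ⟨A, rfl⟩, rfl⟩
    have hhom : (linSubst (A : Matrix (Fin 3) (Fin 3) K) (fermatCubic K 3)).IsHomogeneous 3 := by
      rw [linSubst_fermatCubic]
      exact isHomogeneous_sum_linForm_pow _
    show aeval (formCoeffs 3 (linSubst (A : Matrix (Fin 3) (Fin 3) K) (fermatCubic K 3))) _ = 0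
    rw [hdet _ hhom, LinearMap.det_eq_zero_iff_ker_ne_bot, Submodule.ne_bot_iff]
    set M := (A : Matrix (Fin 3) (Fin 3) K)
    set M' := ((A⁻¹ : GL (Fin 3) K) : Matrix (Fin 3) (Fin 3) K)
    have hM : M * M' = 1 := by
      simp [M, M']
    have hM' : M' * M = 1 := by
      simp [M, M']
    -- Diagonal matrices are self-adjoint for the Fermat cubic; this one is traceless and nonzero,
    -- and it is transported to the orbit by conjugation.
    let D : Matrix (Fin 3) (Fin 3) K := Matrix.diagonal ![1, -1, 0]
    refine ⟨M' * D * M, ?_, fun h => ?_⟩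
    · rw [LinearMap.mem_ker, LinearMap.comp_apply, selfAdjointSystem_eq_zero_iff.2, map_zero]
      constructor
      · rw [Matrix.mul_assoc, Matrix.trace_mul_comm, Matrix.mul_assoc, hM, Matrix.mul_one,
          Matrix.trace_diagonal]
        simp [Fin.sum_univ_three]
      · intro u v w
        have h1 : ∀ u i, M.row i ⬝ᵥ (M' * D * M).mulVec u = ![1, -1, 0] i * (M.row i ⬝ᵥ u) := by
          intro u i
          have : M.mulVec ((M' * D * M).mulVec u) = D.mulVec (M.mulVec u) := by
            rw [Matrix.mulVec_mulVec, Matrix.mulVec_mulVec, ← Matrix.mul_assoc, ← Matrix.mul_assoc,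
              hM, Matrix.one_mul]
          have := congrFun this i
          rw [Matrix.mulVec_diagonal] at this
          exact this
        rw [linSubst_fermatCubic, triForm_sum_linForm_pow, triForm_sum_linForm_pow]
        refine Finset.sum_congr rfl fun i _ => ?_
        rw [h1, h1]
        ring
    · have h2 : D = M * (M' * D * M) * M' := by
        rw [Matrix.mul_assoc, Matrix.mul_assoc, Matrix.mul_assoc, hM, Matrix.mul_one,
          ← Matrix.mul_assoc, hM, Matrix.one_mul]
      rw [h, Matrix.mul_zero, Matrix.zero_mul] at h2
      have := congrFun (congrFun h2 0) 0
      simp [D] at this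
  rw [hdet f hf.1, hπ, LinearMap.det_id] at h0
  exact one_ne_zero h0

theorem exists_isRankLEOne_of_mem_zariskiClosure [CharZero K] {k : Type*} [Field k] [Algebra K k]
    [IsAlgClosed k] {f : MvPolynomial (Fin 3) K}
    (hf : f ∈ zariskiClosure 3 (glOrbit (fermatCubic K 3))) :
    ∃ p : Fin 3 → k, p ≠ 0 ∧ IsRankLEOne (triForm (map (algebraMap K k) f) p) := by
  have : CharZero k := charZero_of_injective_algebraMap (algebraMap K k).injective
  obtain ⟨β, hβ0, htr, hβ⟩ := exists_selfAdjoint_of_mem_zariskiClosure hf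
  let β' := β.map (algebraMap K k)
  have hsys : selfAdjointSystem (map (algebraMap K k) f) β' = 0 := by
    have h0 := selfAdjointSystem_eq_zero_iff.2 ⟨htr, hβ⟩
    rw [selfAdjointSystem_apply, Prod.ext_iff] at h0 ⊢
    refine ⟨funext fun a => funext fun b => funext fun c => ?_, ?_⟩
    · have h1 := congrFun (congrFun (congrFun h0.1 a) b) c
      have h2 : ∀ a, linForm (β'.col a) = map (algebraMap K k) (linForm (β.col a)) := by
        intro a
        simp [linForm_apply, β']
      have h3 : (linForm (β'.col a) * X b - X a * linForm (β'.col b)) * X c =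
          map (algebraMap K k) ((linForm (β.col a) * X b - X a * linForm (β.col b)) * X c) := by
        simp [h2]
      show trace (map (algebraMap K k) f) _ = 0
      rw [h3, trace_apply, diffOp_map, coeff_map]
      exact (congrArg (algebraMap K k) h1).trans (map_zero _)
    · show β'.trace = 0
      rw [← map_zero (algebraMap K k), ← htr]
      simp [Matrix.trace, β']
  obtain ⟨htr', hβ'⟩ := selfAdjointSystem_eq_zero_iff.1 hsys
  refine exists_isRankLEOne_of_selfAdjoint (by simp) (β := Matrix.toLin' β') ?_ hβ'
  intro c hc
  have h1 : β' = Matrix.scalar (Fin 3) c := by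
    rw [← Matrix.toLin'.injective.eq_iff, hc]
    ext
    simp [Pi.single_apply]
  rw [h1] at htr'
  -- A traceless scalar matrix is zero, since `3` is invertible.
  have hc0 : c = 0 := by
    simpa [Matrix.trace] using htr'
  rw [hc0, map_zero] at h1
  refine hβ0 (Matrix.ext fun i j => ?_)
  exact (map_eq_zero (algebraMap K k)).1 (congrFun (congrFun h1 i) j)

end SelfAdjointSystem

end CubicKoszul

namespace CubicKoszul

open Module

/-! ### Limits along curves and sums of cubes -/

section Limits

variable {K k : Type*} [Field K] [Field k] [Algebra K k] {n : ℕ}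

theorem eval_aeval_formCoeffs (d : ℕ)
    (P : MvPolynomial {m : Fin n →₀ ℕ // m.degree = d} K) (g₀ g₁ g₂ : MvPolynomial (Fin n) k) :
    ∃ Q : Polynomial k, ∀ t, Q.eval t =
      aeval (formCoeffs d (g₀ + C t * g₁ + C (t ^ 2) * g₂)) P := by
  refine ⟨aeval (fun m => Polynomial.C (formCoeffs d g₀ m) +
    Polynomial.X * Polynomial.C (formCoeffs d g₁ m) +
    Polynomial.X ^ 2 * Polynomial.C (formCoeffs d g₂ m)) P, fun t => ?_⟩
  have h := comp_aeval_apply (R := K) (fun m => Polynomial.C (formCoeffs d g₀ m) +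
    Polynomial.X * Polynomial.C (formCoeffs d g₁ m) +
    Polynomial.X ^ 2 * Polynomial.C (formCoeffs d g₂ m))
    ((Polynomial.aeval (R := k) t).restrictScalars K) P
  rw [← Polynomial.coe_aeval_eq_eval]
  refine h.trans ?_
  congr 2
  funext m
  simp only [formCoeffs, coeff_add, coeff_C_mul]
  simp only [AlgHom.coe_restrictScalars', map_add, map_mul,
    map_pow, Polynomial.aeval_X, Polynomial.aeval_C, Algebra.algebraMap_self_apply]

/-- The zero locus of a polynomial is closed under limits along curves. -/
theorem aeval_formCoeffs_eq_zero_of_forall_ne [Infinite k] (d : ℕ)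
    {P : MvPolynomial {m : Fin n →₀ ℕ // m.degree = d} K} {g₀ g₁ g₂ : MvPolynomial (Fin n) k}
    (h : ∀ t : k, t ≠ 0 → aeval (formCoeffs d (g₀ + C t * g₁ + C (t ^ 2) * g₂)) P = 0) :
    aeval (formCoeffs d g₀) P = 0 := by
  obtain ⟨Q, hQ⟩ := eval_aeval_formCoeffs d P g₀ g₁ g₂
  have hQ0 : Q = 0 := by
    refine Polynomial.eq_zero_of_infinite_isRoot Q ((Set.finite_singleton (0 : k)).infinite_compl.mono ?_)
    intro t ht
    exact (hQ t).trans (h t ht)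
  have := hQ 0
  rw [hQ0] at this
  simpa using this.symm

/-- The form `∑ᵢ (∑ⱼ aᵢⱼ xⱼ)³` with indeterminate coefficients `aᵢⱼ`. -/
noncomputable def genericCubes (K : Type*) [Field K] (n : ℕ) :
    MvPolynomial (Fin n) (MvPolynomial (Fin n × Fin n) K) :=
  ∑ i, (∑ j, C (X (i, j)) * X j) ^ 3

theorem aeval_aeval_coeff_genericCubes (P : MvPolynomial {m : Fin n →₀ ℕ // m.degree = 3} K)
    (a : Fin n → Fin n → k) :
    aeval (fun ij : Fin n × Fin n => a ij.1 ij.2)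
        (aeval (fun m : {m : Fin n →₀ ℕ // m.degree = 3} => coeff m.1 (genericCubes K n)) P) =
      aeval (formCoeffs 3 (∑ i, linForm (a i) ^ 3)) P := by
  refine (comp_aeval_apply (R := K) _ (aeval fun ij : Fin n × Fin n => a ij.1 ij.2) P).trans ?_
  congr 2
  funext m
  have : ∑ i, linForm (a i) ^ 3 =
      map (aeval (R := K) fun ij : Fin n × Fin n => a ij.1 ij.2).toRingHom (genericCubes K n) := by
    simp [genericCubes, linForm_apply]
  rw [formCoeffs, this, coeff_map]
  rfl

/-- Polynomials vanishing at the orbit of the Fermat form vanish at all sums of cubes. -/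
theorem aeval_formCoeffs_sum_linForm_pow [Infinite K]
    {P : MvPolynomial {m : Fin n →₀ ℕ // m.degree = 3} K}
    (hP : ∀ A : GL (Fin n) K,
      aeval (formCoeffs 3 (linSubst (A : Matrix (Fin n) (Fin n) K) (fermatCubic K n))) P = 0)
    (c : Fin n → Fin n → k) : aeval (formCoeffs 3 (∑ i, linForm (c i) ^ 3)) P = 0 := by
  set Q : MvPolynomial (Fin n × Fin n) K :=
    aeval (fun m : {m : Fin n →₀ ℕ // m.degree = 3} => coeff m.1 (genericCubes K n)) P with hQdef
  -- The generic determinant removes the condition of invertibility: the product vanishes at all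
  -- points over the infinite field `K`, hence identically. So `Q = 0`, which can be evaluated over
  -- any extension.
  have hQ : (Matrix.mvPolynomialX (Fin n) (Fin n) K).det * Q = 0 := by
    refine MvPolynomial.funext fun a => ?_
    rw [map_mul, map_zero]
    by_cases hdet : eval a (Matrix.mvPolynomialX (Fin n) (Fin n) K).det = 0
    · rw [hdet, zero_mul]
    · have h1 : eval a (Matrix.mvPolynomialX (Fin n) (Fin n) K).det =
          (Matrix.of fun i j => a (i, j)).det := by
        rw [RingHom.map_det]
        congr 1
        ext i j
        simp
      rw [h1] at hdet
      have h2 := hP (Matrix.GeneralLinearGroup.mkOfDetNeZero _ hdet)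
      rw [linSubst_fermatCubic] at h2
      have h3 := (aeval_aeval_coeff_genericCubes P fun i j => a (i, j)).trans h2
      rw [aeval_eq_eval] at h3
      exact mul_eq_zero_of_right _ h3
  have hQ0 : Q = 0 :=
    (mul_eq_zero.1 hQ).resolve_left (Matrix.det_mvPolynomialX_ne_zero (Fin n) K)
  rw [← aeval_aeval_coeff_genericCubes, ← hQdef, hQ0, map_zero]

end Limits

/-! ### Cubics that are limits of sums of three cubes -/

section NormalForms

variable {k : Type*} [Field k] {n : ℕ}

/-- Sets of cubics that contain the sums of three cubes of linear forms and the limits of their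
elements along quadratic curves. -/
structure ContainsCubes (Z : Set (MvPolynomial (Fin n) k)) : Prop where
  sum_pow_mem : ∀ u v w : Fin n → k, linForm u ^ 3 + linForm v ^ 3 + linForm w ^ 3 ∈ Z
  limit_mem : ∀ g₀ g₁ g₂ : MvPolynomial (Fin n) k,
    (∀ t : k, t ≠ 0 → g₀ + C t * g₁ + C (t ^ 2) * g₂ ∈ Z) → g₀ ∈ Z

namespace ContainsCubes

variable {Z : Set (MvPolynomial (Fin n) k)} (hZ : ContainsCubes Z)
  [IsAlgClosed k]
include hZ

theorem add_cubes_mem (a b c : k) (u v w : Fin n → k) :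
    C a * linForm u ^ 3 + C b * linForm v ^ 3 + C c * linForm w ^ 3 ∈ Z := by
  obtain ⟨a, rfl⟩ := IsAlgClosed.exists_pow_nat_eq a (n := 3) (by norm_num)
  obtain ⟨b, rfl⟩ := IsAlgClosed.exists_pow_nat_eq b (n := 3) (by norm_num)
  obtain ⟨c, rfl⟩ := IsAlgClosed.exists_pow_nat_eq c (n := 3) (by norm_num)
  have := hZ.sum_pow_mem (a • u) (b • v) (c • w)
  simpa only [map_smul, smul_eq_C_mul, mul_pow, ← C_pow] using this

variable [CharZero k]

/-- The term `v w²` is the limit of `((w + t v)³ - w³) / (3 t)`, and the multiple of `w³` is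
absorbed by the last summand. -/
theorem add_tangent_mem (a b c : k) (u v w : Fin n → k) :
    C a * linForm u ^ 3 + C b * (linForm v * linForm w ^ 2) + C c * linForm w ^ 3 ∈ Z := by
  obtain ⟨b, rfl⟩ : ∃ b', b = 3 * b' := ⟨b / 3, by field_simp⟩
  refine hZ.limit_mem _ (C (3 * b) * (linForm w * linForm v ^ 2)) (C b * linForm v ^ 3)
    fun t ht => ?_
  obtain ⟨s, rfl⟩ : ∃ s, b = t * s := ⟨b / t, by field_simp⟩
  convert hZ.add_cubes_mem a s (c - s) u (w + t • v) w using 1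
  simp only [map_add, map_sub, map_smul, smul_eq_C_mul, map_mul, map_pow, map_ofNat]
  ring

/-- Completing the square turns the binary cubic into `κ v y² + δ v³`. This is a tangent term if `δ
= 0`, and otherwise a multiple of the difference of the cubes of `y + s v` and `y - s v`. -/
theorem add_mul_quadric_mem (a α β γ : k) (u v w : Fin n → k) :
    C a * linForm u ^ 3 + linForm v * (C α * linForm v ^ 2 + C β * (linForm v * linForm w) +
      C γ * linForm w ^ 2) ∈ Z := by
  by_cases hγ : γ = 0
  · convert hZ.add_tangent_mem a β α u w v using 1
    rw [hγ, map_zero]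
    ring
  obtain ⟨κ, hκ⟩ : ∃ κ, 4 * γ * κ = 1 := ⟨(4 * γ)⁻¹, mul_inv_cancel₀ (by simp [hγ])⟩
  have hκ0 : κ ≠ 0 := right_ne_zero_of_mul_eq_one hκ
  obtain ⟨δ, hδ⟩ : ∃ δ, α = δ + κ * β ^ 2 := ⟨α - κ * β ^ 2, by ring⟩
  have hκ' := congrArg (C : k → MvPolynomial (Fin n) k) hκ
  simp only [map_mul, map_ofNat, map_one] at hκ'
  obtain ⟨y, hy⟩ : ∃ y : Fin n → k, y = (2 * γ) • w + β • v := ⟨_, rfl⟩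
  have hy' := congrArg linForm hy
  simp only [map_add, map_smul, smul_eq_C_mul, map_mul, map_ofNat] at hy'
  have key : linForm v * (C α * linForm v ^ 2 + C β * (linForm v * linForm w) +
      C γ * linForm w ^ 2) = C κ * (linForm v * linForm y ^ 2) + C δ * linForm v ^ 3 := by
    rw [hy', hδ]
    simp only [map_add, map_mul, map_pow]
    linear_combination (-(C β * linForm v ^ 2 * linForm w) - C γ * linForm v * linForm w ^ 2) * hκ'
  rw [key]
  by_cases hδ0 : δ = 0
  · convert hZ.add_tangent_mem a κ 0 u v y using 1
    simp only [hδ0, map_zero]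
    ring
  -- The difference of cubes is `6 s v y² + 2 s³ v³`, so `s² = 3 δ / κ` gives the right ratio.
  obtain ⟨s, hs⟩ := IsAlgClosed.exists_pow_nat_eq (3 * δ / κ) (n := 2) (by norm_num)
  have hs0 : s ≠ 0 := by
    rintro rfl
    have : 3 * δ / κ ≠ 0 := by simp [hδ0, hκ0]
    exact this (by simpa using hs.symm)
  obtain ⟨l, rfl⟩ : ∃ l, κ = 6 * s * l := ⟨κ / (6 * s), by field_simp⟩
  have hδl : δ = 2 * s ^ 3 * l := by
    rw [eq_div_iff hκ0] at hs
    linear_combination (-1 / 3) * hs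
  convert hZ.add_cubes_mem a l (-l) u (s • v + y) (-s • v + y) using 1
  rw [hδl]
  simp only [map_add, map_smul, smul_eq_C_mul, map_mul, map_ofNat, map_neg, map_pow]
  ring

/-- Over an algebraically closed field a binary cubic has a linear factor, here `w - r v`, which
reduces to the previous case. -/
theorem add_binary_mem (a a₀ a₁ a₂ a₃ : k) (u v w : Fin n → k) :
    C a * linForm u ^ 3 + (C a₀ * linForm v ^ 3 + C a₁ * (linForm v ^ 2 * linForm w) +
      C a₂ * (linForm v * linForm w ^ 2) + C a₃ * linForm w ^ 3) ∈ Z := by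
  by_cases h3 : a₃ = 0
  · convert hZ.add_mul_quadric_mem a a₀ a₁ a₂ u v w using 1
    rw [h3, map_zero]
    ring
  obtain ⟨r, hr⟩ : ∃ r, a₀ + a₁ * r + a₂ * r ^ 2 + a₃ * r ^ 3 = 0 := by
    obtain ⟨r, hr⟩ := IsAlgClosed.exists_root (Polynomial.C a₃ * Polynomial.X ^ 3 +
      Polynomial.C a₂ * Polynomial.X ^ 2 + Polynomial.C a₁ * Polynomial.X + Polynomial.C a₀) (by
        rw [Polynomial.degree_cubic h3]
        norm_num)
    refine ⟨r, ?_⟩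
    simp only [Polynomial.IsRoot, Polynomial.eval_add, Polynomial.eval_mul, Polynomial.eval_C,
      Polynomial.eval_pow, Polynomial.eval_X] at hr
    linear_combination hr
  have hr' := congrArg (C : k → MvPolynomial (Fin n) k) hr
  simp only [map_add, map_mul, map_pow, map_zero] at hr'
  convert hZ.add_mul_quadric_mem a a₃ (a₂ + 3 * r * a₃) (a₁ + 2 * r * a₂ + 3 * r ^ 2 * a₃) u
    (w + (-r) • v) v using 1
  simp only [map_add, map_smul, smul_eq_C_mul, map_mul, map_ofNat, map_neg, map_pow]
  linear_combination (linForm v ^ 3) * hr'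

/-- Again `u w²` is a limit of differences of cubes of `w + t u` and `w`; the unwanted multiple of
`w³` is moved into the binary cubic. -/
theorem tangent_add_binary_mem (b a₀ a₁ a₂ a₃ : k) (u v w : Fin n → k) :
    C b * (linForm u * linForm w ^ 2) +
      (C a₀ * linForm v ^ 3 + C a₁ * (linForm v ^ 2 * linForm w) +
      C a₂ * (linForm v * linForm w ^ 2) + C a₃ * linForm w ^ 3) ∈ Z := by
  obtain ⟨b, rfl⟩ : ∃ b', b = 3 * b' := ⟨b / 3, by field_simp⟩
  refine hZ.limit_mem _ (C (3 * b) * (linForm w * linForm u ^ 2)) (C b * linForm u ^ 3)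
    fun t ht => ?_
  obtain ⟨s, rfl⟩ : ∃ s, b = t * s := ⟨b / t, by field_simp⟩
  convert hZ.add_binary_mem s a₀ a₁ a₂ (a₃ - s) (w + t • u) v w using 1
  simp only [map_add, map_sub, map_smul, smul_eq_C_mul, map_mul, map_pow, map_ofNat]
  ring

end ContainsCubes

end NormalForms

end CubicKoszul

namespace CubicKoszul

open Module

/-! ### A basis adapted to a polar of rank at most one -/

section AdaptedBasis

variable {k V : Type*} [Field k] [AddCommGroup V] [Module k V] [FiniteDimensional k V]

theorem finrank_ker_add_one_le_of_isRankLEOne {S : V →ₗ[k] V →ₗ[k] k}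
    (hs : ∀ v w, S v w = S w v) (h : IsRankLEOne S) :
    finrank k V ≤ finrank k (LinearMap.ker S) + 1 := by
  by_cases hS : S = 0
  · rw [hS, LinearMap.ker_zero, finrank_top]
    omega
  obtain ⟨x₀, hx₀, hx⟩ := exists_ne_zero_of_isRankLEOne hs h hS
  have h1 : LinearMap.ker (S x₀) ≤ LinearMap.ker S := by
    intro x hx'
    refine LinearMap.mem_ker.2 (LinearMap.ext fun y => ?_)
    rw [hx, LinearMap.mem_ker.1 hx', zero_mul, mul_zero, LinearMap.zero_apply]
  have h2 := Submodule.finrank_mono h1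
  have h3 := (S x₀).finrank_range_add_finrank_ker
  have h4 := (LinearMap.range (S x₀)).finrank_le
  rw [finrank_self] at h4
  omega

/-- A basis adapted to a point whose second polar has rank at most one. -/
theorem exists_basis_of_isRankLEOne {T : V →ₗ[k] V →ₗ[k] V →ₗ[k] k} (hV : finrank k V = 3)
    (hs₂ : ∀ u v w, T u v w = T u w v) {p : V} (hp : p ≠ 0)
    (h : IsRankLEOne (T p)) :
    ∃ b : Basis (Fin 3) k V, T (b 0) (b 1) = 0 ∧ T (b 0) (b 0) (b 2) = 0 ∧
      (T (b 0) (b 0) (b 0) = 0 ∨ T (b 0) (b 2) (b 2) = 0) := by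
  have hfin := finrank_ker_add_one_le_of_isRankLEOne (hs₂ p) h
  suffices ∃ q r, LinearIndependent k ![p, q, r] ∧ T p q = 0 ∧ T p p r = 0 ∧
      (T p p p = 0 ∨ T p r r = 0) by
    obtain ⟨q, r, hli, h1, h2, h3⟩ := this
    exact ⟨basisOfLinearIndependentOfCardEqFinrank hli (by simp [hV]), by simpa using h1,
      by simpa using h2, by simpa using h3⟩
  -- If `p` is in the radical of `T p`, it is completed by `q` inside the radical and by an
  -- arbitrary `r`. Otherwise the radical is a complement of `p` and contains both `q` and `r`.
  by_cases hpp : T p p = 0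
  · obtain ⟨q, hq, hqp⟩ : ∃ q ∈ LinearMap.ker (T p), q ∉ Submodule.span k {p} := by
      by_contra! h0
      have h1 := Submodule.finrank_mono (show LinearMap.ker (T p) ≤ Submodule.span k {p} from h0)
      rw [finrank_span_singleton hp] at h1
      omega
    have hpq : LinearIndependent k ![q, p] := by
      refine linearIndependent_finCons.2 ⟨?_, ?_⟩
      · simpa using hp
      · simpa using hqp
    obtain ⟨r, hr⟩ : ∃ r, r ∉ Submodule.span k (Set.range ![q, p]) := by
      by_contra! h0
      have h1 := finrank_span_eq_card hpq
      rw [(Submodule.eq_top_iff'.2 h0), finrank_top, hV] at h1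
      simp at h1
    have hli : LinearIndependent k ![r, q, p] := linearIndependent_finCons.2 ⟨hpq, hr⟩
    refine ⟨q, r, ?_, hq, by rw [hpp, LinearMap.zero_apply], Or.inl (by rw [hpp, LinearMap.zero_apply])⟩
    convert hli.comp ![2, 1, 0] (by decide) using 1
    funext i
    fin_cases i <;> rfl
  · have hne : T p ≠ 0 := fun h0 => hpp (by rw [h0, LinearMap.zero_apply])
    have hpW : p ∉ LinearMap.ker (T p) := hpp
    obtain ⟨q, hq, hq0⟩ := Submodule.exists_mem_ne_zero_of_ne_bot
      (show LinearMap.ker (T p) ≠ ⊥ from fun h0 => by rw [h0, finrank_bot] at hfin; omega)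
    obtain ⟨r, hr, hrq⟩ : ∃ r ∈ LinearMap.ker (T p), r ∉ Submodule.span k {q} := by
      by_contra! h0
      have h1 := Submodule.finrank_mono (show LinearMap.ker (T p) ≤ Submodule.span k {q} from h0)
      rw [finrank_span_singleton hq0] at h1
      omega
    have hrq : LinearIndependent k ![r, q] := by
      refine linearIndependent_finCons.2 ⟨?_, ?_⟩
      · simpa using hq0
      · simpa using hrq
    have hli : LinearIndependent k ![p, r, q] := by
      refine linearIndependent_finCons.2 ⟨hrq, fun hmem => hpW (?_)⟩
      refine Submodule.span_le.2 ?_ hmem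
      rintro _ ⟨i, rfl⟩
      fin_cases i
      · exact hr
      · exact hq
    refine ⟨q, r, ?_, hq, ?_, Or.inr ?_⟩
    · convert hli.comp ![0, 2, 1] (by decide) using 1
      funext i
      fin_cases i <;> rfl
    · rw [hs₂, LinearMap.mem_ker.1 hr, LinearMap.zero_apply]
    · rw [LinearMap.mem_ker.1 hr, LinearMap.zero_apply]

end AdaptedBasis

/-! ### Recovering a cubic from its trilinear form -/

section Euler

variable {k : Type*} [Field k] {n : ℕ}

/-- Euler's formula applied twice, for degrees 3 and 2. -/
theorem six_mul_eval {f : MvPolynomial (Fin n) k} (hf : f.IsHomogeneous 3) (x : Fin n → k) :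
    6 * eval x f = triForm f x x x := by
  have h1 := congrArg (eval x) hf.sum_X_mul_pderiv
  have h2 : ∀ i, ∑ j, x j * eval x (pderiv j (pderiv i f)) = 2 * eval x (pderiv i f) := by
    intro i
    have := congrArg (eval x) (hf.pderiv (i := i)).sum_X_mul_pderiv
    simpa using this
  have h3 : ∑ i, x i * eval x (pderiv i f) = 3 * eval x f := by simpa using h1
  have h4 : triForm f x x x = ∑ i, x i * ∑ j, x j * eval x (pderiv j (pderiv i f)) := by
    have : ∀ j i, eval x (pderiv j (pderiv i f)) =
      triForm f x (Pi.single j 1) (Pi.single i 1) := eval_hessian hf x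
    simp only [this]
    have h5 : ∀ i, ∑ j, x j * triForm f x (Pi.single j 1) (Pi.single i 1) =
        triForm f x x (Pi.single i 1) := by
      intro i
      conv_rhs => rw [show triForm f x x = triForm f x (∑ j, x j • Pi.single j 1) by
        rw [← eq_sum_smul_single]]
      simp [LinearMap.sum_apply]
    simp only [h5]
    rw [show triForm f x x x = triForm f x x (∑ j, x j • Pi.single j 1) by
        rw [← eq_sum_smul_single]]
    simp
  rw [h4]
  simp only [h2]
  rw [show (6 : k) * eval x f = 2 * (3 * eval x f) by ring, ← h3, Finset.mul_sum]
  exact Finset.sum_congr rfl fun i _ => by ring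

theorem eval_linForm_repr {ι : Type*} (b : Basis ι k (Fin n → k)) (i : ι) (x : Fin n → k) :
    eval x (linForm fun j => b.repr (Pi.single j 1) i) = b.repr x i := by
  conv_rhs => rw [eq_sum_smul_single x]
  simp [linForm_apply, mul_comm]

end Euler

/-! ### Cubics with a polar of rank at most one lie in the closure -/

section Closure

/-- In the adapted basis the only monomials containing `ξ₀` are `ξ₀³` and `ξ₀ ξ₂²`, and one of the
two is absent. What remains is a binary cubic in `ξ₁`, `ξ₂`. -/
theorem ContainsCubes.mem_of_isRankLEOne {k : Type*} [Field k] [IsAlgClosed k] [CharZero k]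
    {Z : Set (MvPolynomial (Fin 3) k)} (hZ : ContainsCubes Z) {f : MvPolynomial (Fin 3) k}
    (hf : f.IsHomogeneous 3) {p : Fin 3 → k} (hp : p ≠ 0) (h : IsRankLEOne (triForm f p)) :
    f ∈ Z := by
  have hs₁ := triForm_swap₁ f
  have hs₂ := triForm_swap₂ f
  obtain ⟨b, h1, h2, h3⟩ := exists_basis_of_isRankLEOne (by simp) hs₂ hp h
  set T := triForm f
  let ξ : Fin 3 → Fin 3 → k := fun i j => b.repr (Pi.single j 1) i
  have key : f = C (T (b 0) (b 0) (b 0) / 6) * linForm (ξ 0) ^ 3 +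
      C (T (b 0) (b 2) (b 2) / 2) * (linForm (ξ 0) * linForm (ξ 2) ^ 2) +
      (C (T (b 1) (b 1) (b 1) / 6) * linForm (ξ 1) ^ 3 +
        C (T (b 1) (b 1) (b 2) / 2) * (linForm (ξ 1) ^ 2 * linForm (ξ 2)) +
        C (T (b 1) (b 2) (b 2) / 2) * (linForm (ξ 1) * linForm (ξ 2) ^ 2) +
        C (T (b 2) (b 2) (b 2) / 6) * linForm (ξ 2) ^ 3) := by
    refine MvPolynomial.funext fun x => ?_
    have h6 := six_mul_eval hf x
    have hx : triForm f x x x = T (∑ i, b.repr x i • b i) (∑ i, b.repr x i • b i)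
        (∑ i, b.repr x i • b i) := by
      rw [b.sum_repr]
    rw [hx] at h6
    simp only [Fin.sum_univ_three, map_add, map_smul, LinearMap.add_apply, LinearMap.smul_apply,
      smul_eq_mul] at h6
    have e01 : ∀ w, T (b 0) (b 1) w = 0 := fun w => by rw [h1, LinearMap.zero_apply]
    have e10 : ∀ w, T (b 1) (b 0) w = 0 := fun w => by rw [hs₁, e01]
    have f01 : ∀ w, T (b 0) w (b 1) = 0 := fun w => by rw [hs₂, e01]
    have f10 : ∀ w, T (b 1) w (b 0) = 0 := fun w => by rw [hs₂, e10]
    have g01 : ∀ w, T w (b 0) (b 1) = 0 := fun w => by rw [hs₁, f01]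
    have g10 : ∀ w, T w (b 1) (b 0) = 0 := fun w => by rw [hs₁, f10]
    have e020 : T (b 0) (b 2) (b 0) = 0 := by rw [hs₂, h2]
    have e200 : T (b 2) (b 0) (b 0) = 0 := by rw [hs₁, e020]
    have e202 : T (b 2) (b 0) (b 2) = T (b 0) (b 2) (b 2) := hs₁ _ _ _
    have e220 : T (b 2) (b 2) (b 0) = T (b 0) (b 2) (b 2) := by rw [hs₂, e202]
    have e121 : T (b 1) (b 2) (b 1) = T (b 1) (b 1) (b 2) := hs₂ _ _ _
    have e211 : T (b 2) (b 1) (b 1) = T (b 1) (b 1) (b 2) := by rw [hs₁, e121]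
    have e212 : T (b 2) (b 1) (b 2) = T (b 1) (b 2) (b 2) := hs₁ _ _ _
    have e221 : T (b 2) (b 2) (b 1) = T (b 1) (b 2) (b 2) := by rw [hs₂, e212]
    simp only [e01, e10, f01, f10, g01, g10, e020, e200, e202, e220, e121, e211, e212, e221, h2]
      at h6
    simp only [map_add, map_mul, map_pow, eval_C, ξ, eval_linForm_repr]
    linear_combination (1 / 6) * h6
  rw [key]
  rcases h3 with h3 | h3
  · rw [h3, zero_div, C_0, zero_mul, zero_add]
    exact hZ.tangent_add_binary_mem _ _ _ _ _ _ _ _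
  · rw [h3, zero_div, C_0, zero_mul, add_zero]
    exact hZ.add_binary_mem _ _ _ _ _ _ _ _

/-- Each polynomial over `K` that vanishes on the orbit has a zero set over `k` to which the normal
forms apply; its value at `f` lies in `K` and can be tested in `k`. -/
theorem mem_zariskiClosure_of_isRankLEOne {K k : Type*} [Field K] [CharZero K] [Field k]
    [Algebra K k] [IsAlgClosed k] {f : MvPolynomial (Fin 3) K} (hf : f.IsHomogeneous 3)
    {p : Fin 3 → k} (hp : p ≠ 0) (h : IsRankLEOne (triForm (map (algebraMap K k) f) p)) :
    f ∈ zariskiClosure 3 (glOrbit (fermatCubic K 3)) := by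
  have : CharZero k := charZero_of_injective_algebraMap (algebraMap K k).injective
  refine ⟨hf, fun P hP => ?_⟩
  have hZ : ContainsCubes {g : MvPolynomial (Fin 3) k | aeval (formCoeffs 3 g) P = 0} := by
    refine ⟨fun u v w => ?_, fun g₀ g₁ g₂ hg => aeval_formCoeffs_eq_zero_of_forall_ne 3 hg⟩
    have := aeval_formCoeffs_sum_linForm_pow (k := k) (P := P)
      (fun A => hP _ ⟨_, ⟨A, rfl⟩, rfl⟩) ![u, v, w]
    rwa [Fin.sum_univ_three] at this
  have h1 : aeval (formCoeffs 3 (map (algebraMap K k) f)) P = 0 :=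
    hZ.mem_of_isRankLEOne (hf.map _) hp h
  have h2 : formCoeffs 3 (map (algebraMap K k) f) = algebraMap K k ∘ formCoeffs 3 f := by
    funext m
    simp [formCoeffs, coeff_map]
  rw [h2] at h1
  have h3 := aeval_algebraMap_apply (B := k) (formCoeffs 3 f) P
  exact (map_eq_zero (algebraMap K k)).1 (h3.symm.trans h1)

end Closure

end CubicKoszul

open CubicKoszul
theorem mainTheorem7 {K : Type*} [Field K] [CharZero K] (n : ℕ) (hn : n = 3 ∨ n = 4)
    (f : MvPolynomial (Fin n) K) (hf : f.IsHomogeneous 3) (hf0 : f ≠ 0)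
    (hcone : n = 4 → ¬ IsCone f) :
    List.TFAE
      [IsQuadratic (inverseSystemIdeal f),
        IsKoszul (inverseSystemIdeal f),
        (minorsIdeal 2 (hessian f)).height = n] ∧
    (n = 3 →
      (IsQuadratic (inverseSystemIdeal f) ↔
        f ∉ zariskiClosure 3 (glOrbit (fermatCubic K n)))) := by
  have h := tfae_isQuadratic_isKoszul_height (AlgebraicClosure K) hn hf hf0 hcone
  refine ⟨?_, ?_⟩
  · tfae_have 1 ↔ 2 := h.out 0 1
    tfae_have 1 ↔ 3 := h.out 0 2
    tfae_finish
  · rintro rfl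
    refine (h.out 0 3).trans ?_
    constructor
    · intro hB hmem
      obtain ⟨p, hp, hr⟩ := exists_isRankLEOne_of_mem_zariskiClosure (k := AlgebraicClosure K) hmem
      exact hp (hB p hr)
    · intro hmem p hr
      by_contra hp
      exact hmem (mem_zariskiClosure_of_isRankLEOne hf hp hr)
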